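/- **Setting.** Let $\mathcal A$ be a unital Fréchet $*$-algebra over $\mathbb C$ with continuous involution in which self-adjoint elements have a smooth functional calculus, in the following sense: the topology of $\mathcal A$ is complete and defined by an increasing sequence of submultiplicative seminorms $p_0\le p_1\le\cdots$, where $p_0$ is a $C^*$-norm, and for each $n$ there are $m,N,C$ with $p_n(e^{ia})\le C(1+p_m(a))^N$ for all $a=a^*\in\mathcal A$ (for example $\mathcal A=C^\infty(\mathbb T^m_\theta)$, a smooth noncommutative torus). Let $\varphi_0:\mathcal A\to\mathbb C$ be a continuous linear functional with $\varphi_0(ab)=\varphi_0(ba)$, and let $\delta:\mathcal A\to\mathcal A$ be a continuous linear derivation with $\varphi_0\circ\delta=0$ (for example the generator of a one-parameter group of continuous automorphisms of $\mathcal A$ preserving $\varphi_0$). For $h=h^*\in\mathcal A$ put $k=e^h$ (the Weyl factor), $k^j=e^{jh}$ for $j\in\mathbb R$, $\mathbf x=[\,\cdot\,,h]$ and $\mathbf y=e^{\mathbf x}=k^{-1}(\cdot)k$. On products $\rho_1\cdots\rho_n$ of elements of $\mathcal A$, $\mathbf x_l$ and $\mathbf y_l$ denote $\mathbf x$ and $\mathbf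 y$ acting on the $l$-th factor only. For a function $f$ on $(0,\infty)^n$ the functional calculus is $$f(\mathbf y_1,\dots,\mathbf y_n)(\rho_1\cdots\rho_n)=\int_{\mathbb R^n}g(\xi)\,e^{-i\xi_1\mathbf x}(\rho_1)\cdots e^{-i\xi_n\mathbf x}(\rho_n)\,d\xi ,$$ where the integral is a weak integral in $\mathcal A$ and $g$ is any Schwartz function such that $f(e^{x_1},\dots,e^{x_n})=\int_{\mathbb R^n} g(\xi)e^{-i\langle x,\xi\rangle}d\xi$ for $x\in U^n$, $U\subset\mathbb R$ being a (suitable) bounded open set that contains the spectrum of $\mathbf x$. Write $f\in C(\mathbb R_+^n)$ if this calculus is well defined (exists, with a unique value) for all $h=h^*$ and all $\rho_1,\dots,\rho_n\in\mathcal A$. For $j\in\mathbb R$ and a function $f$ of $n\ge1$ positive variables let $$\boldsymbol\sigma_j(f)(y_1,\dots,y_n)=(y_1\cdots y_n)^{j}f\big((y_1\cdots y_n)^{-1},y_1,\dots,y_{n-1}\big),$$ and for a function $f$ of one positive variable let $\blacksquare^+(f)(y_1,y_2)=f[y_1,y_1y_2]$ be the divided difference $\frac{f(y_1y_2)-f(y_1)}{y_1y_2-y_1}$,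 equal to $f'(y_1)$ if $y_2=1$. **Theorem.** Let $j\in\mathbb R$, let $\tilde f:(0,\infty)\to\mathbb C$ be smooth, and consider $$F(k)=\varphi_0\big(k^j\tilde f(\mathbf y)(\delta k)\cdot\delta k\big).$$ For $a=a^*\in\mathcal A$ let $\boldsymbol\delta_a=\frac{d}{d\varepsilon}\big|_{\varepsilon=0}$ be the variation along $k\mapsto\exp(\log k+\varepsilon a)$. An element $G\in\mathcal A$ is called a gradient of $F$ at $k$ if $\boldsymbol\delta_a(k)$ and $\boldsymbol\delta_aF(k)$ exist and $\boldsymbol\delta_aF(k)=\varphi_0(\boldsymbol\delta_a(k)\,G)$ for all $a=a^*\in\mathcal A$. Put $$\tilde K=-(1+\boldsymbol\sigma_j)(\tilde f),\qquad \tilde H=(1+\boldsymbol\sigma_{j-1}-\boldsymbol\sigma_{j-1}^2)\cdot\blacksquare^+(\tilde K).$$ Then $\tilde f,\tilde K\in C(\mathbb R_+)$, $\tilde H\in C(\mathbb R_+^2)$, and for every Weyl factor $k=e^h$, $h=h^*\in\mathcal A$, the element $$\operatorname{grad}_kF=k^{j}\,\tilde K(\mathbf y)(\delta^2k)+k^{j-1}\,\tilde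 H(\mathbf y_1,\mathbf y_2)(\delta k\,\delta k)$$ is a gradient of $F$ at $k$. If moreover $\varphi_0$ is nondegenerate ($\varphi_0(ab)=0$ for all $a\in\mathcal A$ implies $b=0$), it is the only gradient of $F$ at $k$. -/

import Mathlib

open scoped ContDiff SchwartzMap Topology

noncomputable section

namespace ModularVariation

/-- The class of unital Fréchet *-algebras in which the smooth functional calculus of self-adjoint
elements makes sense: the topology is defined by an increasing sequence of submultiplicative
seminorms, the first of which is a C*-norm, and the unitaries `exp (i a)`, `a = a*`, grow at most
polynomially in `a`. (Completeness and continuity of the involution are separate instance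
arguments.) Typical members are the algebras of smooth elements of C*-dynamical systems over Lie
groups, such as smooth noncommutative tori, `C^∞(M)` and matrices over it, and all unital
C*-algebras. -/
class SmoothFrechetStarAlgebra (A : Type*) [Ring A] [StarRing A] [Algebra ℂ A]
    [TopologicalSpace A] [IsTopologicalRing A] : Prop where
  exists_seminorms : ∃ p : ℕ → Seminorm ℂ A,
    WithSeminorms p ∧ Monotone p ∧
    (∀ n a b, p n (a * b) ≤ p n a * p n b) ∧
    (∀ a, p 0 (star a * a) = p 0 a ^ 2) ∧ (∀ a, p 0 a = 0 → a = 0) ∧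
    (∀ n, ∃ m N : ℕ, ∃ C : ℝ, ∀ a : A, IsSelfAdjoint a →
      p n (NormedSpace.exp (Complex.I • a)) ≤ C * (1 + p m a) ^ N)

section Calculus

variable {A : Type*} [Ring A] [Algebra ℂ A] [TopologicalSpace A] [IsTopologicalRing A]

/-- The power `k ^ j = exp (j h)` of the Weyl factor `k = exp h`. -/
def weylPow (h : A) (j : ℝ) : A := NormedSpace.exp ((j : ℂ) • h)

/-- The modular derivation `𝐱 = [·, h]`; the modular operator is `𝐲 = exp 𝐱 = k⁻¹ (·) k`. -/
def modularDerivation (h : A) : Module.End ℂ A := LinearMap.mulRight ℂ h - LinearMap.mulLeft ℂ h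

/-- `exp (-i ξ 𝐱) (ρ) = exp (i ξ h) ρ exp (-i ξ h)`. -/
def modularFlow (h : A) (ξ : ℝ) (ρ : A) : A :=
  NormedSpace.exp ((Complex.I * ξ) • h) * ρ * NormedSpace.exp ((-(Complex.I * ξ)) • h)

/-- `exp (-i (ξ₁ 𝐱₁ + ⋯ + ξₙ 𝐱ₙ)) (ρ₁ ⋯ ρₙ)`, where `𝐱ₗ` acts on the `l`-th factor only. -/
def partialModularFlow {n : ℕ} (h : A) (ξ : EuclideanSpace ℝ (Fin n)) (ρ : Fin n → A) : A :=
  (List.ofFn fun l => modularFlow h (ξ l) (ρ l)).prod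

/-- `b = ∫ Φ`, as a weak (Pettis) integral in `A`. -/
def HasWeakIntegral {n : ℕ} (Φ : EuclideanSpace ℝ (Fin n) → A) (b : A) : Prop :=
  ∀ l : A →L[ℂ] ℂ, MeasureTheory.Integrable (fun ξ => l (Φ ξ)) ∧ ∫ ξ, l (Φ ξ) = l b

/-- On `Uⁿ` the function `f` is the Fourier integral `∫ g(ξ) exp (-i ⟨x, ξ⟩) dξ` of the Schwartz
function `g`, i.e. `g` is the suitably normalized Fourier transform of a Schwartz extension of
`f` from `Uⁿ`. -/
def IsFourierDensityOn {n : ℕ} (U : Set ℝ) (f : (Fin n → ℝ) → ℂ)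
    (g : 𝓢(EuclideanSpace ℝ (Fin n), ℂ)) : Prop :=
  ∀ x : Fin n → ℝ, (∀ l, x l ∈ U) →
    f x = ∫ ξ : EuclideanSpace ℝ (Fin n), g ξ * Complex.exp (-Complex.I * ∑ l, (x l : ℂ) * ξ l)

/-- `b = f(𝐱₁, …, 𝐱ₙ)(ρ₁ ⋯ ρₙ)`: for some bounded open set `U` of reals containing the spectrum of
`𝐱`, the function `f` has a Schwartz extension from `Uⁿ`, and for any such extension `b` is the
integral `∫ g(ξ) exp (-i (ξ₁ 𝐱₁ + ⋯ + ξₙ 𝐱ₙ)) (ρ₁ ⋯ ρₙ) dξ`. -/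
def IsDerivationCalculus {n : ℕ} (h : A) (f : (Fin n → ℝ) → ℂ) (ρ : Fin n → A) (b : A) : Prop :=
  ∃ U : Set ℝ, IsOpen U ∧ Bornology.IsBounded U ∧
    spectrum ℂ (modularDerivation h) ⊆ (fun t : ℝ => (t : ℂ)) '' U ∧
    (∃ g, IsFourierDensityOn U f g) ∧
    ∀ g, IsFourierDensityOn U f g → HasWeakIntegral (fun ξ => g ξ • partialModularFlow h ξ ρ) b

/-- `b = f(𝐲₁, …, 𝐲ₙ)(ρ₁ ⋯ ρₙ)`, through the substitution `𝐲ₗ = exp 𝐱ₗ`. -/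
def IsModularCalculus {n : ℕ} (h : A) (f : (Fin n → ℝ) → ℂ) (ρ : Fin n → A) (b : A) : Prop :=
  IsDerivationCalculus h (fun x => f fun l => Real.exp (x l)) ρ b

/-- The element `f(𝐲₁, …, 𝐲ₙ)(ρ₁ ⋯ ρₙ)` (arbitrary if the calculus is not defined). -/
def modularCalculus {n : ℕ} (h : A) (f : (Fin n → ℝ) → ℂ) (ρ : Fin n → A) : A :=
  Classical.epsilon (IsModularCalculus h f ρ)

/-- `f ∈ C(ℝ₊ⁿ)`: for every self-adjoint `h`, the functional calculus of `f` is well defined. -/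
def IsSpectralFunction (A : Type*) [Ring A] [StarRing A] [Algebra ℂ A] [TopologicalSpace A]
    [IsTopologicalRing A] {n : ℕ} (f : (Fin n → ℝ) → ℂ) : Prop :=
  ∀ h : A, IsSelfAdjoint h → ∀ ρ : Fin n → A, ∃! b, IsModularCalculus h f ρ b

end Calculus

/-- The cyclic operator
`σ_j(f)(y₁, …, yₙ) = (y₁ ⋯ yₙ) ^ j * f((y₁ ⋯ yₙ)⁻¹, y₁, …, yₙ₋₁)`, for `n ≥ 1`. -/
def cyclicOp {n : ℕ} (j : ℝ) (f : (Fin (n + 1) → ℝ) → ℂ) : (Fin (n + 1) → ℝ) → ℂ :=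
  fun y => (((∏ l, y l) ^ j : ℝ) : ℂ) * f (Fin.cons (∏ l, y l)⁻¹ (Fin.init y))

/-- `■⁺(f)(y₁, y₂) = f[y₁, y₁ y₂]`, a divided difference (confluent, i.e. `f'(y₁)`, if the two
points agree). -/
def blackSquare (f : (Fin 1 → ℝ) → ℂ) : (Fin 2 → ℝ) → ℂ :=
  fun y => dslope (fun z => f ![z]) (y 0) (y 0 * y 1)

/-- `K̃ = -(1 + σ_j)(f)`. -/
def gradK (j : ℝ) (f : (Fin 1 → ℝ) → ℂ) : (Fin 1 → ℝ) → ℂ := -(f + cyclicOp j f)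

/-- `H̃ = (1 + σ_{j-1} - σ_{j-1}²) ■⁺(K̃)`. -/
def gradH (j : ℝ) (f : (Fin 1 → ℝ) → ℂ) : (Fin 2 → ℝ) → ℂ :=
  blackSquare (gradK j f) + cyclicOp (j - 1) (blackSquare (gradK j f))
    - cyclicOp (j - 1) (cyclicOp (j - 1) (blackSquare (gradK j f)))

section Functional

variable {A : Type*} [Ring A] [Algebra ℂ A] [TopologicalSpace A] [IsTopologicalRing A]

/-- `F(k) = φ₀(k^j f(𝐲)(δ k) · δ k)` for the Weyl factor `k = exp h`, as a function of
`h = log k`. -/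
def weylFunctional (φ₀ : A →L[ℂ] ℂ) (δ : A →L[ℂ] A) (j : ℝ) (f : (Fin 1 → ℝ) → ℂ) (h : A) : ℂ :=
  φ₀ (weylPow h j * modularCalculus h f ![δ (NormedSpace.exp h)] * δ (NormedSpace.exp h))

/-- `v = 𝛅_a(k)`, the derivative at `ε = 0` of `exp (h + ε a)`, `ε` real. -/
def IsWeylVariation (h a v : A) : Prop :=
  Filter.Tendsto (fun ε : ℝ => ((ε⁻¹ : ℝ) : ℂ) •
    (NormedSpace.exp (h + (ε : ℂ) • a) - NormedSpace.exp h)) (𝓝[≠] 0) (𝓝 v)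

/-- `G` is a gradient with respect to `k`, at `k = exp h`, of a functional `F` (written as a
function of `h = log k`): for all self-adjoint `a` the variations `𝛅_a F` and `𝛅_a(k)` along
`k ↦ exp (log k + ε a)` exist and `𝛅_a F = φ₀(𝛅_a(k) G)`. -/
def IsGradient [StarRing A] (φ₀ : A →L[ℂ] ℂ) (F : A → ℂ) (h G : A) : Prop :=
  ∀ a : A, IsSelfAdjoint a → ∃ v : A, IsWeylVariation h a v ∧
    HasDerivAt (fun ε : ℝ => F (h + (ε : ℂ) • a)) (φ₀ (v * G)) 0

/-- `k^j K̃(𝐲)(δ² k) + k^{j-1} H̃(𝐲₁, 𝐲₂)(δ k δ k)` for `k = exp h`. -/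
def gradFormula (δ : A →L[ℂ] A) (j : ℝ) (f : (Fin 1 → ℝ) → ℂ) (h : A) : A :=
  weylPow h j * modularCalculus h (gradK j f) ![δ (δ (NormedSpace.exp h))] +
    weylPow h (j - 1) *
      modularCalculus h (gradH j f) ![δ (NormedSpace.exp h), δ (NormedSpace.exp h)]

end Functional

end ModularVariation

end

/-!
The proof turns identities in `A` into identities between functions of three real variables, the
symbols, and checks these by the algebra of divided differences.

*Symbols.* As `p 0` is a C*-norm, `A` embeds isometrically, for `p 0`, in a C*-algebra `B`
(`exists_cstar_completion`). Every element which occurs is an integral of exponential words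
`e^{z₀h} ρ e^{z₁h} σ e^{z₂h}` with complex exponents; its symbol is the Laplace integral
`x ↦ ∫ c(o) e^{⟨z(o), x⟩}` of the same density. In `B`, the exponentials of a self-adjoint `h` are
limits of sums `∑ₖ e^{z tₖ} χₖ` with `|tₖ| ≤ ‖h‖` up to an arbitrarily small error
(`exists_partition_approx`, a Bernstein partition of unity under the continuous functional
calculus). Hence such an integral is a limit of linear combinations whose coefficients are values
of its symbol near the spectrum, and is determined by them (`HasSymbol.unique`). Multiplication by
powers of `k`, substitution of Duhamel's formula for `δ k`, and the transposed derivative of `exp`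
multiply the symbol by exponentials and divided differences of the exponential function.

*Integrals in `A`.* The hypothesis on `p n (e^{ia})` makes all integrands grow at most polynomially,
for each seminorm. Against a Schwartz density their Bochner integrals exist in the Banach
completions of `A`, and completeness yields the weak integral in `A`
(`IsDominated.exists_weakIntegral`). In the same way difference quotients are dominated, so that the
functional may be differentiated under the integral (`IsDiffFamily.hasDerivAt_integral`).

*The calculus.* The spectrum of `[·, h]` lies in every interval `(-2R, 2R)` with `R > p 0 h`,
because the resolvent is itself given by the calculus (`spectrum_modularDerivation_subset`). A
smooth function has Schwartz densities on bounded sets, and by uniqueness of symbols its value does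
not depend on the density; so `f`, `K̃` and `H̃`, which are smooth in logarithmic coordinates by
the smoothness of divided differences, define spectral functions.

*The gradient.* Write `v` for the variation of `k` in the direction `a`, and `Q` for the transposed
derivative of `exp`, so that `φ₀(v b) = φ₀(a Q(b))`. By `exists_variation`, the variation of the
functional is `φ₀(a (Y₁ + Y₂)) + φ₀(δ v (P₁ + P₂))`, where `Y₁, Y₂` come from the exponentials and
`P₁, P₂` from the factors `δ k`. Partial integration replaces the last term by `-φ₀(v δ(P₁ + P₂))`.
It remains to see that `Q(grad + δ P₁ + δ P₂) = Y₁ + Y₂` (`transpose_gradFormula_eq`). Terms with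
`δ² k` cancel by the definition of `K̃`. On symbols, `H̃` is a sum of three divided differences,
cyclic permutations of each other (`cexp_mul_gradH`); two of them cancel against the remaining
terms of `δ P₁ + δ P₂`, and the third is the symbol of `Y₁ + Y₂` (`gradient_symbol_identity`).

*Uniqueness.* If `φ₀` is nondegenerate, two gradients differ by an element of the kernel of `Q`, and
`Q` is injective (`eq_zero_of_integral_transpose_eq_zero`).
-/

noncomputable section

universe u

namespace ModularVariation

/-! ### Completions with respect to a submultiplicative seminorm -/

/-- The completion of an algebra with respect to a submultiplicative seminorm. -/
theorem exists_banach_completion {A : Type u} [Ring A] [Algebra ℂ A] (p : Seminorm ℂ A)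
    (hp : ∀ a b, p (a * b) ≤ p a * p b) :
    ∃ (E : Type u) (_ : NormedRing E) (_ : NormedAlgebra ℂ E) (_ : CompleteSpace E)
      (π : A →ₐ[ℂ] E), (∀ a, ‖π a‖ = p a) ∧ DenseRange π := by
  let q : RingSeminorm A :=
    { p.toAddGroupSeminorm with mul_le' := hp }
  let _ : SeminormedRing A := q.toSeminormedRing
  let _ : NormedAlgebra ℂ A :=
    { ‹Algebra ℂ A› with norm_smul_le := fun c a => (map_smul_eq_mul p c a).le }
  let _ : NormedAlgebra ℂ (UniformSpace.Completion A) :=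
    { (inferInstance : Algebra ℂ (UniformSpace.Completion A)) with
      norm_smul_le := norm_smul_le }
  refine ⟨UniformSpace.Completion A, inferInstance, inferInstance, inferInstance,
    { UniformSpace.Completion.coeRingHom with commutes' := fun c => rfl },
    fun a => UniformSpace.Completion.norm_coe a, UniformSpace.Completion.denseRange_coe⟩

/-- The completion of a *-algebra with respect to a C*-norm. -/
theorem exists_cstar_completion {A : Type u} [Ring A] [StarRing A] [Algebra ℂ A] [StarModule ℂ A]
    (p : Seminorm ℂ A) (hp : ∀ a b, p (a * b) ≤ p a * p b)
    (hstar : ∀ a, p (star a * a) = p a ^ 2) :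
    ∃ (B : Type u) (_ : CStarAlgebra B) (π : A →⋆ₐ[ℂ] B), ∀ a, ‖π a‖ = p a := by
  let q : RingSeminorm A :=
    { p.toAddGroupSeminorm with mul_le' := hp }
  let _ : SeminormedRing A := q.toSeminormedRing
  let _ : NormedAlgebra ℂ A :=
    { ‹Algebra ℂ A› with norm_smul_le := fun c a => (map_smul_eq_mul p c a).le }
  -- The C*-identity forces the involution to be isometric, so it extends to the completion.
  have hle : ∀ a : A, ‖a‖ ≤ ‖star a‖ := by
    intro a
    rcases (norm_nonneg a).eq_or_lt with h0 | h0
    · rw [← h0]; exact norm_nonneg _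
    · have h1 : ‖a‖ ^ 2 ≤ ‖star a‖ * ‖a‖ := by
        have := hp (star a) a
        rw [hstar] at this
        exact this
      rw [sq] at h1
      exact le_of_mul_le_mul_right h1 h0
  have hnorm : ∀ a : A, ‖star a‖ = ‖a‖ := fun a =>
    le_antisymm (by simpa using hle (star a)) (hle a)
  let s : A →+ A := starAddEquiv.toAddMonoidHom
  have hs : UniformContinuous s :=
    (AddMonoidHomClass.isometry_of_norm s hnorm).uniformContinuous
  let _ : Star (UniformSpace.Completion A) := ⟨UniformSpace.Completion.map s⟩
  have hcoe : ∀ a : A, star (a : UniformSpace.Completion A) =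
      ((star a : A) : UniformSpace.Completion A) :=
    fun a => UniformSpace.Completion.map_coe hs a
  have hc : Continuous (star : UniformSpace.Completion A → UniformSpace.Completion A) :=
    UniformSpace.Completion.continuous_map
  let _ : StarRing (UniformSpace.Completion A) :=
    { star := star
      star_involutive := fun x => by
        induction x using UniformSpace.Completion.induction_on with
        | hp => exact isClosed_eq (by fun_prop) (by fun_prop)
        | ih a => rw [hcoe, hcoe, star_star]
      star_mul := fun x y => by
        induction x, y using UniformSpace.Completion.induction_on₂ with
        | hp => exact isClosed_eq (by fun_prop) (by fun_prop)
        | ih a b =>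
          rw [← UniformSpace.Completion.coe_mul, hcoe, hcoe, hcoe, star_mul,
            UniformSpace.Completion.coe_mul]
      star_add := fun x y => by
        induction x, y using UniformSpace.Completion.induction_on₂ with
        | hp => exact isClosed_eq (by fun_prop) (by fun_prop)
        | ih a b =>
          rw [← UniformSpace.Completion.coe_add, hcoe, hcoe, hcoe, star_add,
            UniformSpace.Completion.coe_add] }
  let _ : NormedAlgebra ℂ (UniformSpace.Completion A) :=
    { (inferInstance : Algebra ℂ (UniformSpace.Completion A)) with
      norm_smul_le := norm_smul_le }
  let _ : StarModule ℂ (UniformSpace.Completion A) :=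
    { star_smul := fun c x => by
        induction x using UniformSpace.Completion.induction_on with
        | hp => exact isClosed_eq (hc.comp (continuous_const_smul c)) (hc.const_smul (star c))
        | ih a =>
          rw [← UniformSpace.Completion.coe_smul, hcoe, hcoe, star_smul,
            UniformSpace.Completion.coe_smul] }
  let _ : CStarRing (UniformSpace.Completion A) :=
    { norm_mul_self_le := fun x => by
        induction x using UniformSpace.Completion.induction_on with
        | hp => exact isClosed_le (by fun_prop) (by fun_prop)
        | ih a =>
          rw [hcoe, ← UniformSpace.Completion.coe_mul, UniformSpace.Completion.norm_coe,
            UniformSpace.Completion.norm_coe, ← sq]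
          exact (hstar a).ge }
  let _ : CStarAlgebra (UniformSpace.Completion A) := {}
  exact ⟨UniformSpace.Completion A, inferInstance,
    { UniformSpace.Completion.coeRingHom with
      commutes' := fun c => rfl
      map_star' := fun a => (hcoe a).symm },
    fun a => UniformSpace.Completion.norm_coe a⟩

/-! ### Approximation of the exponentials of a self-adjoint element -/

section Approximation

variable {B : Type*} [CStarAlgebra B]

/-- The unit-interval coordinate of a point of `[-R, R]`; points off this interval are projected to
the nearest one. -/
def intervalCoord (R : ℝ) (w : ℂ) : unitInterval :=
  Set.projIcc 0 1 zero_le_one ((w.re + R) / (2 * R))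

theorem continuous_intervalCoord (R : ℝ) : Continuous (intervalCoord R) :=
  continuous_projIcc.comp (by fun_prop)

theorem norm_cfc_intervalCoord_le (R : ℝ) (h : B) (f : C(unitInterval, ℂ)) :
    ‖cfc (fun w : ℂ => f (intervalCoord R w)) h‖ ≤ ‖f‖ :=
  norm_cfc_le (norm_nonneg _) fun _ _ => f.norm_coe_le_norm _

/-- The exponential function of slope `z`, on `[-R, R]` parametrized by the unit interval. -/
def expOnInterval (R : ℝ) (z : ℂ) : C(unitInterval, ℂ) :=
  ⟨fun x => Complex.exp (z * ((2 * R * x - R : ℝ) : ℂ)), by fun_prop⟩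

theorem norm_expOnInterval_le {R : ℝ} (hR : 0 < R) (z : ℂ) :
    ‖expOnInterval R z‖ ≤ Real.exp (|z.re| * R) := by
  refine (ContinuousMap.norm_le _ (Real.exp_pos _).le).2 fun x => ?_
  have hx := x.2
  simp only [expOnInterval, ContinuousMap.coe_mk, Complex.norm_exp, Complex.re_mul_ofReal]
  refine Real.exp_le_exp.2 ((le_abs_self _).trans ?_)
  rw [abs_mul]
  refine mul_le_mul_of_nonneg_left ?_ (abs_nonneg _)
  rw [abs_le]
  constructor <;> nlinarith [hx.1, hx.2]

theorem abs_re_le_of_mem_spectrum {h : B} {w : ℂ} (hw : w ∈ spectrum ℂ h) : |w.re| ≤ ‖h‖ := by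
  have hone : ‖(1 : B)‖ ≤ 1 := by
    rcases subsingleton_or_nontrivial B with hB | hB
    · rw [Subsingleton.elim (1 : B) 0, norm_zero]; exact zero_le_one
    · exact CStarRing.norm_one.le
  exact (Complex.abs_re_le_norm w).trans ((spectrum.norm_le_norm_mul_of_mem hw).trans
      (mul_le_of_le_one_right (norm_nonneg _) hone))

theorem cfc_cexp_mul {h : B} (hh : IsSelfAdjoint h) (z : ℂ) :
    cfc (fun w : ℂ => Complex.exp (z * w)) h = NormedSpace.exp (z • h) := by
  have hn : IsStarNormal h := hh.isStarNormal
  have hzn : IsStarNormal (z • h) := by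
    constructor
    simp only [Commute, SemiconjBy, star_smul, hh.star_eq, smul_mul_smul_comm, mul_comm]
  rw [← CFC.complex_exp_eq_normedSpace_exp (a := z • h), ← cfc_comp_smul z Complex.exp h]
  rfl

theorem cfc_expOnInterval {R : ℝ} (hR : 0 < R) {h : B} (hh : IsSelfAdjoint h) (hhR : ‖h‖ ≤ R)
    (z : ℂ) :
    cfc (fun w : ℂ => expOnInterval R z (intervalCoord R w)) h = NormedSpace.exp (z • h) := by
  rw [← cfc_cexp_mul hh]
  refine cfc_congr fun w hw => ?_
  have hw1 : w = w.re := hh.mem_spectrum_eq_re hw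
  have hw2 : |w.re| ≤ R := (abs_re_le_of_mem_spectrum hw).trans hhR
  have h1 : (w.re + R) / (2 * R) ∈ Set.Icc (0 : ℝ) 1 := by
    rw [abs_le] at hw2
    constructor
    · apply div_nonneg <;> linarith
    · rw [div_le_one (by linarith)]; linarith
  have h2 : 2 * R * ((w.re + R) / (2 * R)) - R = w.re := by field_simp; ring
  simp only [expOnInterval, intervalCoord, Set.projIcc_of_mem _ h1, ContinuousMap.coe_mk, h2]
  rw [← hw1]

/-- The exponentials `exp (z h)` of a self-adjoint element are limits of finite sums
`∑ₖ exp (z tₖ) χₖ`, bounded like the exponentials themselves: `χ` is the image of the Bernstein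
partition of unity under the functional calculus. -/
theorem exists_partition_approx {R : ℝ} (hR : 0 < R) {h : B} (hh : IsSelfAdjoint h)
    (hhR : ‖h‖ ≤ R) :
    ∃ (χ : (N : ℕ) → Fin (N + 1) → B) (t : (N : ℕ) → Fin (N + 1) → ℝ),
      (∀ N k, |t N k| ≤ R) ∧
      (∀ z : ℂ, Filter.Tendsto (fun N => ∑ k, Complex.exp (z * t N k) • χ N k) Filter.atTop
        (𝓝 (NormedSpace.exp (z • h)))) ∧
      (∀ N z, ‖∑ k, Complex.exp (z * t N k) • χ N k‖ ≤ Real.exp (|z.re| * R)) := by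
  have hn : IsStarNormal h := hh.isStarNormal
  -- Summing the partition against the values of `exp (z ·)` at its nodes gives the Bernstein
  -- approximation of this function, under the functional calculus.
  have key : ∀ N z, ∑ k : Fin (N + 1), Complex.exp (z * ((2 * R * bernstein.z k - R : ℝ) : ℂ)) •
      cfc (fun w : ℂ => ((bernstein N k (intervalCoord R w) : ℝ) : ℂ)) h =
      cfc (fun w : ℂ => bernsteinApproximation N (expOnInterval R z) (intervalCoord R w)) h := by
    intro N z
    have hc : ∀ k : Fin (N + 1), Continuous
        (fun w : ℂ => ((bernstein N k (intervalCoord R w) : ℝ) : ℂ)) := fun k =>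
      Complex.continuous_ofReal.comp
        ((bernstein N k).continuous.comp (continuous_intervalCoord R))
    have : (fun w : ℂ => bernsteinApproximation N (expOnInterval R z) (intervalCoord R w)) =
        fun w => ∑ k : Fin (N + 1), Complex.exp (z * ((2 * R * bernstein.z k - R : ℝ) : ℂ)) •
          ((bernstein N k (intervalCoord R w) : ℝ) : ℂ) := by
      funext w
      rw [bernsteinApproximation.apply]
      refine Finset.sum_congr rfl fun k _ => ?_
      rw [Complex.real_smul, smul_eq_mul, mul_comm]
      rfl
    rw [this]
    have h2 := cfc_sum (s := Finset.univ) (a := h) (fun (k : Fin (N + 1)) (w : ℂ) =>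
      Complex.exp (z * ((2 * R * bernstein.z k - R : ℝ) : ℂ)) •
          ((bernstein N k (intervalCoord R w) : ℝ) : ℂ))
        (fun k _ => by
          have := hc k
          exact Continuous.continuousOn (by fun_prop))
    rw [Finset.sum_fn] at h2
    rw [h2]
    exact Finset.sum_congr rfl fun k _ => (cfc_smul _ _ h (hc k).continuousOn).symm
  have hnorm1 : ∀ N (f : C(unitInterval, ℂ)), ‖bernsteinApproximation N f‖ ≤ ‖f‖ := by
    intro N f
    refine (ContinuousMap.norm_le _ (norm_nonneg _)).2 fun x => ?_
    rw [bernsteinApproximation.apply]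
    refine (norm_sum_le _ _).trans ?_
    calc ∑ k : Fin (N + 1), ‖(bernstein N k x) • f (bernstein.z k)‖
        ≤ ∑ k : Fin (N + 1), bernstein N k x * ‖f‖ := by
          refine Finset.sum_le_sum fun k _ => ?_
          rw [norm_smul, Real.norm_of_nonneg bernstein_nonneg]
          exact mul_le_mul_of_nonneg_left (f.norm_coe_le_norm _) bernstein_nonneg
      _ = ‖f‖ := by rw [← Finset.sum_mul, bernstein.probability, one_mul]
  refine ⟨fun N k => cfc (fun w : ℂ => ((bernstein N k (intervalCoord R w) : ℝ) : ℂ)) h,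
    fun N k => 2 * R * bernstein.z k - R, fun N k => ?_, fun z => ?_, fun N z => ?_⟩
  · have hx := (bernstein.z k).2
    rw [abs_le]
    constructor <;> nlinarith [hx.1, hx.2]
  · simp only [key]
    rw [← cfc_expOnInterval hR hh hhR z, tendsto_iff_norm_sub_tendsto_zero]
    have h3 := tendsto_iff_norm_sub_tendsto_zero.1
      (bernsteinApproximation_uniform (expOnInterval R z))
    refine squeeze_zero (fun _ => norm_nonneg _) (fun N => ?_) h3
    have hc : ∀ f : C(unitInterval, ℂ), ContinuousOn (fun w : ℂ => f (intervalCoord R w))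
        (spectrum ℂ h) := fun f => (f.continuous.comp (continuous_intervalCoord R)).continuousOn
    rw [← cfc_sub _ _ h (hc _) (hc _)]
    exact norm_cfc_intervalCoord_le R h (bernsteinApproximation N (expOnInterval R z) -
      expOnInterval R z)
  · rw [key]
    exact (norm_cfc_intervalCoord_le R h _).trans ((hnorm1 _ _).trans (norm_expOnInterval_le hR z))

theorem norm_exp_smul_le {R : ℝ} (hR : 0 < R) {h : B} (hh : IsSelfAdjoint h) (hhR : ‖h‖ ≤ R)
    (z : ℂ) : ‖NormedSpace.exp (z • h)‖ ≤ Real.exp (|z.re| * R) := by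
  rw [← cfc_expOnInterval hR hh hhR z]
  exact (norm_cfc_intervalCoord_le R h _).trans (norm_expOnInterval_le hR z)

end Approximation

/-! ### Integrals of exponential words and their symbols -/

section Words

/-- The word `exp (z₀ h) ρ exp (z₁ h) σ exp (z₂ h)`. -/
def expWord {A : Type*} [Ring A] [Algebra ℂ A] [TopologicalSpace A] [IsTopologicalRing A]
    (h : A) (z : Fin 3 → ℂ) (ρ σ : A) : A :=
  NormedSpace.exp (z 0 • h) * ρ * NormedSpace.exp (z 1 • h) * σ * NormedSpace.exp (z 2 • h)

/-- An integrable density `c` together with exponents `z` of bounded real part, so that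
`∫ c(o) exp ⟨z(o), x⟩ dμ(o)` converges for all real `x`, and the corresponding integral of
exponential words converges in every C*-algebra. -/
structure IsExpFamily {Ω : Type*} [MeasurableSpace Ω] (μ : MeasureTheory.Measure Ω) (c : Ω → ℂ)
    (z : Ω → Fin 3 → ℂ) : Prop where
  integrable : MeasureTheory.Integrable c μ
  measurable : Measurable z
  bounded : ∃ M : ℝ, ∀ o i, |(z o i).re| ≤ M

/-- The Laplace integral `∫ c(o) exp ⟨z(o), x⟩ dμ(o)`. -/
def expSymbol {Ω : Type*} [MeasurableSpace Ω] (μ : MeasureTheory.Measure Ω) (c : Ω → ℂ)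
    (z : Ω → Fin 3 → ℂ) (x : Fin 3 → ℝ) : ℂ :=
  ∫ o, c o * Complex.exp (∑ i, z o i * x i) ∂μ

theorem continuous_normedSpace_exp {E : Type*} [NormedRing E] [NormedAlgebra ℂ E]
    [CompleteSpace E] : Continuous (NormedSpace.exp : E → E) := by
  let _ : NormedAlgebra ℚ E := NormedAlgebra.restrictScalars ℚ ℂ E
  exact NormedSpace.exp_continuous

theorem continuous_expWord {E : Type*} [NormedRing E] [NormedAlgebra ℂ E]
    [CompleteSpace E] (h ρ σ : E) : Continuous fun z => expWord h z ρ σ := by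
  have := continuous_normedSpace_exp (E := E)
  unfold expWord
  fun_prop

variable {Ω Ω' : Type*} [MeasurableSpace Ω] [MeasurableSpace Ω'] {μ : MeasureTheory.Measure Ω}
  {ν : MeasureTheory.Measure Ω'} {c : Ω → ℂ} {z : Ω → Fin 3 → ℂ} {d : Ω' → ℂ}
  {w : Ω' → Fin 3 → ℂ}

theorem IsExpFamily.integrable_exp (H : IsExpFamily μ c z) (x : Fin 3 → ℝ) :
    MeasureTheory.Integrable (fun o => c o * Complex.exp (∑ i, z o i * x i)) μ := by
  obtain ⟨M, hM⟩ := H.bounded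
  have hz := H.measurable
  refine H.integrable.mul_bdd (c := Real.exp (∑ i, M * |x i|)) (by fun_prop) ?_
  refine Filter.Eventually.of_forall fun o => ?_
  rw [Complex.norm_exp, Complex.re_sum]
  refine Real.exp_le_exp.2 (Finset.sum_le_sum fun i _ => ?_)
  rw [Complex.re_mul_ofReal]
  refine (le_abs_self _).trans ?_
  rw [abs_mul]
  exact mul_le_mul_of_nonneg_right (hM o i) (abs_nonneg _)

theorem IsExpFamily.continuous_expSymbol (H : IsExpFamily μ c z) :
    Continuous (expSymbol μ c z) := by
  obtain ⟨M, hM⟩ := H.bounded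
  have hz := H.measurable
  rw [continuous_iff_continuousAt]
  intro x₀
  refine MeasureTheory.continuousAt_of_dominated
    (bound := fun o => ‖c o‖ * Real.exp (∑ i, |M| * (|x₀ i| + 1)))
    (Filter.Eventually.of_forall fun x => (H.integrable_exp x).aestronglyMeasurable) ?_
    (H.integrable.norm.mul_const _)
    (Filter.Eventually.of_forall fun o => Continuous.continuousAt (by fun_prop))
  filter_upwards [Metric.ball_mem_nhds x₀ one_pos] with x hx
  refine Filter.Eventually.of_forall fun o => ?_
  rw [norm_mul, Complex.norm_exp, Complex.re_sum]
  refine mul_le_mul_of_nonneg_left (Real.exp_le_exp.2 (Finset.sum_le_sum fun i _ => ?_))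
    (norm_nonneg _)
  rw [Complex.re_mul_ofReal]
  refine (le_abs_self _).trans ?_
  rw [abs_mul]
  refine mul_le_mul ((hM o i).trans (le_abs_self _)) ?_ (abs_nonneg _) (abs_nonneg _)
  have h1 : |x i - x₀ i| < 1 := by
    have := (dist_le_pi_dist x x₀ i).trans_lt (Metric.mem_ball.1 hx)
    rwa [Real.dist_eq] at this
  have := abs_sub_abs_le_abs_sub (x i) (x₀ i)
  linarith

/-- Adding the exponents and multiplying the densities multiplies the symbols. -/
theorem IsExpFamily.prod [MeasureTheory.SFinite μ] [MeasureTheory.SFinite ν]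
    (H : IsExpFamily μ c z) (H' : IsExpFamily ν d w) :
    IsExpFamily (μ.prod ν) (fun p => c p.1 * d p.2) (fun p => z p.1 + w p.2) := by
  obtain ⟨M, hM⟩ := H.bounded
  obtain ⟨M', hM'⟩ := H'.bounded
  have hz := H.measurable
  have hw := H'.measurable
  refine ⟨H.integrable.mul_prod H'.integrable, by fun_prop, M + M', fun p i => ?_⟩
  rw [Pi.add_apply, Complex.add_re]
  exact (abs_add_le _ _).trans (add_le_add (hM _ _) (hM' _ _))

theorem IsExpFamily.expSymbol_prod [MeasureTheory.SFinite μ] [MeasureTheory.SFinite ν]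
    (x : Fin 3 → ℝ) :
    expSymbol (μ.prod ν) (fun p => c p.1 * d p.2) (fun p => z p.1 + w p.2) x =
      expSymbol μ c z x * expSymbol ν d w x := by
  unfold expSymbol
  rw [← MeasureTheory.integral_prod_mul]
  refine MeasureTheory.integral_congr_ae (Filter.Eventually.of_forall fun p => ?_)
  simp only [Pi.add_apply, add_mul, Finset.sum_add_distrib, Complex.exp_add]
  ring

section CStar

variable {B : Type*} [CStarAlgebra B] {R : ℝ} {h ρ σ : B}

theorem norm_mul₅_le {a b c d e : B} {K : ℝ} (hK : 0 ≤ K) (ha : ‖a‖ ≤ K) (hc : ‖c‖ ≤ K)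
    (he : ‖e‖ ≤ K) : ‖a * b * c * d * e‖ ≤ K * ‖b‖ * K * ‖d‖ * K := by
  calc ‖a * b * c * d * e‖ ≤ ‖a‖ * ‖b‖ * ‖c‖ * ‖d‖ * ‖e‖ := by
        refine (norm_mul_le _ _).trans ?_
        gcongr
        refine (norm_mul_le _ _).trans ?_
        gcongr
        refine (norm_mul_le _ _).trans ?_
        gcongr
        exact norm_mul_le _ _
    _ ≤ _ := by gcongr

theorem norm_expWord_le (hR : 0 < R) (hh : IsSelfAdjoint h) (hhR : ‖h‖ ≤ R) {M : ℝ}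
    {z : Fin 3 → ℂ} (hz : ∀ i, |(z i).re| ≤ M) :
    ‖expWord h z ρ σ‖ ≤ Real.exp (M * R) * ‖ρ‖ * Real.exp (M * R) * ‖σ‖ * Real.exp (M * R) := by
  have h1 : ∀ i, ‖NormedSpace.exp (z i • h)‖ ≤ Real.exp (M * R) := fun i =>
    (norm_exp_smul_le hR hh hhR _).trans
      (Real.exp_le_exp.2 (mul_le_mul_of_nonneg_right (hz i) hR.le))
  exact norm_mul₅_le (Real.exp_pos _).le (h1 _) (h1 _) (h1 _)

theorem IsExpFamily.integrable_word (H : IsExpFamily μ c z) (hh : IsSelfAdjoint h) (ρ σ : B) :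
    MeasureTheory.Integrable (fun o => c o • expWord h (z o) ρ σ) μ := by
  obtain ⟨M, hM⟩ := H.bounded
  have hR : 0 < ‖h‖ + 1 := by positivity
  refine H.integrable.smul_bdd (C := Real.exp (M * (‖h‖ + 1)) * ‖ρ‖ * Real.exp (M * (‖h‖ + 1)) *
    ‖σ‖ * Real.exp (M * (‖h‖ + 1))) ?_ (Filter.Eventually.of_forall fun o =>
      norm_expWord_le hR hh (by linarith) (hM o))
  exact ((continuous_expWord h ρ σ).comp_aestronglyMeasurable
    (H.measurable.aestronglyMeasurable))

/-- The integral of exponential words is a limit of linear combinations whose coefficients are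
values of the symbol; hence it only depends on the symbol. -/
theorem IsExpFamily.tendsto_integral_word (H : IsExpFamily μ c z) {R : ℝ} (hR : 0 < R)
    {χ : (N : ℕ) → Fin (N + 1) → B} {t : (N : ℕ) → Fin (N + 1) → ℝ}
    (hlim : ∀ z : ℂ, Filter.Tendsto (fun N => ∑ k, Complex.exp (z * t N k) • χ N k) Filter.atTop
        (𝓝 (NormedSpace.exp (z • h))))
    (hbd : ∀ N z, ‖∑ k, Complex.exp (z * t N k) • χ N k‖ ≤ Real.exp (|z.re| * R)) (ρ σ : B) :
    Filter.Tendsto (fun N => ∑ i, ∑ j, ∑ k, expSymbol μ c z ![t N i, t N j, t N k] •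
      (χ N i * ρ * χ N j * σ * χ N k)) Filter.atTop
      (𝓝 (∫ o, c o • expWord h (z o) ρ σ ∂μ)) := by
  obtain ⟨M, hM⟩ := H.bounded
  let u : ℕ → ℂ → B := fun N z => ∑ k, Complex.exp (z * t N k) • χ N k
  have hu : ∀ N, Continuous (u N) := fun N => by fun_prop
  have hz := H.measurable
  have hz' : ∀ i, Measurable fun o => z o i := fun i => by fun_prop
  -- `u N` approximates `exp (· h)`; in a word of three such sums, each summand of the expansion
  -- contributes one value of the symbol.
  have expand : ∀ N o, c o • (u N (z o 0) * ρ * u N (z o 1) * σ * u N (z o 2)) =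
      ∑ i, ∑ j, ∑ k, (c o * Complex.exp (∑ l, z o l * (![t N i, t N j, t N k] l : ℝ))) •
        (χ N i * ρ * χ N j * σ * χ N k) := by
    intro N o
    simp only [u]
    rw [Finset.sum_mul, Finset.sum_mul, Finset.sum_mul, Finset.sum_mul, Finset.smul_sum]
    refine Finset.sum_congr rfl fun i _ => ?_
    simp only [Finset.mul_sum, Finset.sum_mul, Finset.smul_sum]
    rw [Finset.sum_comm]
    refine Finset.sum_congr rfl fun j _ => ?_
    refine Finset.sum_congr rfl fun k _ => ?_
    simp only [smul_mul_assoc, mul_smul_comm, smul_smul, Fin.sum_univ_three, Complex.exp_add,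
      Matrix.cons_val_zero, Matrix.cons_val_one, Matrix.cons_val]
    congr 1
    ring
  have hint : ∀ N, ∫ o, c o • (u N (z o 0) * ρ * u N (z o 1) * σ * u N (z o 2)) ∂μ =
      ∑ i, ∑ j, ∑ k, expSymbol μ c z ![t N i, t N j, t N k] •
        (χ N i * ρ * χ N j * σ * χ N k) := by
    intro N
    have hI : ∀ i j k, MeasureTheory.Integrable (fun o => (c o * Complex.exp
        (∑ l, z o l * (![t N i, t N j, t N k] l : ℝ))) • (χ N i * ρ * χ N j * σ * χ N k)) μ :=
      fun i j k => (H.integrable_exp _).smul_const _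
    simp only [expand]
    rw [MeasureTheory.integral_finsetSum _ fun i _ => MeasureTheory.integrable_finsetSum _
      fun j _ => MeasureTheory.integrable_finsetSum _ fun k _ => hI i j k]
    refine Finset.sum_congr rfl fun i _ => ?_
    rw [MeasureTheory.integral_finsetSum _ fun j _ => MeasureTheory.integrable_finsetSum _
      fun k _ => hI i j k]
    refine Finset.sum_congr rfl fun j _ => ?_
    rw [MeasureTheory.integral_finsetSum _ fun k _ => hI i j k]
    refine Finset.sum_congr rfl fun k _ => ?_
    rw [integral_smul_const]
    rfl
  simp only [← hint]
  have hK : ∀ N o i, ‖u N (z o i)‖ ≤ Real.exp (M * R) := fun N o i =>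
    (hbd N _).trans (Real.exp_le_exp.2 (mul_le_mul_of_nonneg_right (hM o i) hR.le))
  refine MeasureTheory.tendsto_integral_of_dominated_convergence
    (fun o => ‖c o‖ * (Real.exp (M * R) * ‖ρ‖ * Real.exp (M * R) * ‖σ‖ * Real.exp (M * R)))
    (fun N => ?_) (H.integrable.norm.mul_const _) (fun N => Filter.Eventually.of_forall fun o => ?_)
    (Filter.Eventually.of_forall fun o => ?_)
  · have h2 : ∀ i, MeasureTheory.AEStronglyMeasurable (fun o => u N (z o i)) μ := fun i =>
      (hu N).comp_aestronglyMeasurable (hz' i).aestronglyMeasurable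
    exact H.integrable.aestronglyMeasurable.smul
      (((((h2 0).mul_const ρ).mul (h2 1)).mul_const σ).mul (h2 2))
  · rw [norm_smul]
    exact mul_le_mul_of_nonneg_left
      (norm_mul₅_le (Real.exp_pos _).le (hK _ _ _) (hK _ _ _) (hK _ _ _)) (norm_nonneg _)
  · exact (((((hlim _).mul_const ρ).mul (hlim _)).mul_const σ).mul (hlim _)).const_smul _

/-- `b` is an integral of exponential words with symbol `F` on the open cube `(-R, R)³`, off the
diagonals. Leaving out the diagonals costs nothing, as the symbol is continuous, and allows to write
divided differences as quotients. -/
def HasSymbol (R : ℝ) (h ρ σ : B) (F : (Fin 3 → ℝ) → ℂ) (b : B) : Prop :=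
  ∃ (Ω : Type) (_ : MeasurableSpace Ω) (μ : MeasureTheory.Measure Ω)
    (_ : MeasureTheory.SFinite μ) (c : Ω → ℂ) (z : Ω → Fin 3 → ℂ), IsExpFamily μ c z ∧
    (∀ x : Fin 3 → ℝ, (∀ i, |x i| < R) → Function.Injective x → expSymbol μ c z x = F x) ∧
    ∫ o, c o • expWord h (z o) ρ σ ∂μ = b

/-- An integral of exponential words is determined by its symbol near the spectrum, off the
diagonals. -/
theorem HasSymbol.unique (hh : IsSelfAdjoint h) (hhR : ‖h‖ < R) {F G : (Fin 3 → ℝ) → ℂ} {b b' : B}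
    (H : HasSymbol R h ρ σ F b) (H' : HasSymbol R h ρ σ G b')
    (hFG : ∀ x : Fin 3 → ℝ, (∀ i, |x i| < R) → Function.Injective x → F x = G x) : b = b' := by
  obtain ⟨Ω, _, μ, _, c, z, hz, hF, rfl⟩ := H
  obtain ⟨Ω', _, μ', _, c', z', hz', hG, rfl⟩ := H'
  have hn := norm_nonneg h
  obtain ⟨χ, t, ht, hlim, hbd⟩ := exists_partition_approx (R := (‖h‖ + R) / 2) (by linarith) hh
    (by linarith)
  -- The two symbols agree off the diagonals, hence everywhere in the cube by continuity: `y s` has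
  -- distinct coordinates for small `s ≠ 0`.
  have hEq : ∀ x : Fin 3 → ℝ, (∀ i, |x i| < R) → expSymbol μ c z x = expSymbol μ' c' z' x := by
    intro x hx
    let y : ℝ → Fin 3 → ℝ := fun s i => x i + s * (![0, 1, 3] i : ℝ)
    have hy : Continuous y := by fun_prop
    have hy0 : y 0 = x := by funext i; simp [y]
    have hinj : ∀ᶠ s in 𝓝[≠] (0 : ℝ), Function.Injective (y s) := by
      have hne : ∀ i k : Fin 3, i ≠ k → ∀ᶠ s in 𝓝[≠] (0 : ℝ), y s i ≠ y s k := by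
        intro i k hik
        have hm : (![0, 1, 3] i : ℝ) ≠ (![0, 1, 3] k : ℝ) := by
          fin_cases i <;> fin_cases k <;> simp at hik ⊢
        by_cases hxe : x i = x k
        · filter_upwards [self_mem_nhdsWithin] with s hs he
          simp only [y, hxe, add_right_inj] at he
          exact hm (mul_left_cancel₀ hs he)
        · have hcont : ContinuousAt (fun s => y s i - y s k) 0 := by fun_prop
          have h0 : y 0 i - y 0 k ≠ 0 := by rw [hy0]; exact sub_ne_zero.2 hxe
          filter_upwards [(hcont.eventually_ne h0).filter_mono nhdsWithin_le_nhds] with s hs he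
          exact hs (sub_eq_zero.2 he)
      have hall : ∀ᶠ s in 𝓝[≠] (0 : ℝ), ∀ i k : Fin 3, i ≠ k → y s i ≠ y s k := by
        rw [Filter.eventually_all]
        intro i
        rw [Filter.eventually_all]
        intro k
        by_cases hik : i = k
        · exact Filter.Eventually.of_forall fun s hne => absurd hik hne
        · exact (hne i k hik).mono fun s hs _ => hs
      filter_upwards [hall] with s hs i k hik
      by_contra hne
      exact hs i k hne hik
    have hbox : ∀ᶠ s in 𝓝[≠] (0 : ℝ), ∀ i, |y s i| < R := by
      rw [Filter.eventually_all]
      intro i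
      have hcont : ContinuousAt (fun s => |y s i|) 0 := by fun_prop
      exact (hcont.eventually_lt continuousAt_const (by rw [hy0]; exact hx i)).filter_mono
        nhdsWithin_le_nhds
    have l1 : Filter.Tendsto (fun s => expSymbol μ c z (y s)) (𝓝[≠] 0) (𝓝 (expSymbol μ c z x)) := by
      rw [← hy0]
      exact ((hz.continuous_expSymbol.comp hy).tendsto 0).mono_left nhdsWithin_le_nhds
    have l2 : Filter.Tendsto (fun s => expSymbol μ' c' z' (y s)) (𝓝[≠] 0)
        (𝓝 (expSymbol μ' c' z' x)) := by
      rw [← hy0]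
      exact ((hz'.continuous_expSymbol.comp hy).tendsto 0).mono_left nhdsWithin_le_nhds
    refine tendsto_nhds_unique l1 (l2.congr' ?_)
    filter_upwards [hinj, hbox] with s h1 h2
    rw [hF _ h2 h1, hG _ h2 h1, hFG _ h2 h1]
  have L1 := hz.tendsto_integral_word (R := (‖h‖ + R) / 2) (by linarith) hlim hbd ρ σ
  have L2 := hz'.tendsto_integral_word (R := (‖h‖ + R) / 2) (by linarith) hlim hbd ρ σ
  refine tendsto_nhds_unique L1 (L2.congr fun N => ?_)
  refine Finset.sum_congr rfl fun i _ => Finset.sum_congr rfl fun j _ =>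
    Finset.sum_congr rfl fun k _ => ?_
  rw [hEq]
  intro l
  have : ∀ i, |t N i| < R := fun i => (ht N i).trans_lt (by linarith)
  fin_cases l <;> simp [this]

end CStar

end Words

/-! ### Duhamel formulas -/

section Duhamel

theorem integral_unitInterval {E : Type*} [NormedAddCommGroup E] [NormedSpace ℝ E] (f : ℝ → E) :
    ∫ s : unitInterval, f s = ∫ s in (0 : ℝ)..1, f s := by
  rw [intervalIntegral.integral_of_le zero_le_one, ← MeasureTheory.integral_Icc_eq_integral_Ioc]
  exact MeasureTheory.integral_subtype measurableSet_Icc f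

variable {E : Type*} [NormedRing E] [NormedAlgebra ℂ E] [CompleteSpace E]

/-- The twisted Duhamel formula: integration of the derivative of `exp (s a) d exp ((1 - s) b)`. -/
theorem integral_exp_mul_exp (a b d : E) :
    ∫ s : unitInterval, NormedSpace.exp (((s : ℝ) : ℂ) • a) * (a * d - d * b) *
      NormedSpace.exp ((1 - ((s : ℝ) : ℂ)) • b) =
      NormedSpace.exp a * d - d * NormedSpace.exp b := by
  have hexp := continuous_normedSpace_exp (E := E)
  rw [integral_unitInterval (fun s : ℝ => NormedSpace.exp ((s : ℂ) • a) * (a * d - d * b) *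
      NormedSpace.exp ((1 - (s : ℂ)) • b))]
  have hd : ∀ s : ℝ, HasDerivAt (fun s : ℝ => NormedSpace.exp ((s : ℂ) • a) * d *
      NormedSpace.exp ((1 - (s : ℂ)) • b)) (NormedSpace.exp ((s : ℂ) • a) * (a * d - d * b) *
      NormedSpace.exp ((1 - (s : ℂ)) • b)) s := by
    intro s
    have h1 : HasDerivAt (fun s : ℝ => NormedSpace.exp ((s : ℂ) • a))
        (NormedSpace.exp ((s : ℂ) • a) * a) s := by
      simpa using! (hasDerivAt_exp_smul_const a (s : ℂ)).scomp s Complex.ofRealCLM.hasDerivAt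
    have h2 : HasDerivAt (fun s : ℝ => NormedSpace.exp ((1 - (s : ℂ)) • b))
        (-(b * NormedSpace.exp ((1 - (s : ℂ)) • b))) s := by
      simpa using! (hasDerivAt_exp_smul_const' b (1 - (s : ℂ))).scomp s
        (Complex.ofRealCLM.hasDerivAt.const_sub 1)
    refine ((h1.mul_const d).mul h2).congr_deriv ?_
    noncomm_ring
  rw [intervalIntegral.integral_eq_sub_of_hasDerivAt (fun s _ => hd s)
    (Continuous.intervalIntegrable (by fun_prop) _ _)]
  simp [NormedSpace.exp_zero]

/-- Duhamel's formula for the difference of two exponentials. -/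
theorem exp_sub_exp (a b : E) :
    NormedSpace.exp a - NormedSpace.exp b = ∫ s : unitInterval,
      NormedSpace.exp (((s : ℝ) : ℂ) • a) * (a - b) *
        NormedSpace.exp ((1 - ((s : ℝ) : ℂ)) • b) := by
  have := integral_exp_mul_exp a b (1 : E)
  simp only [mul_one, one_mul] at this
  exact this.symm

/-- The divided difference of the exponential function, times the difference of the points. -/
theorem mul_integral_cexp (a b : ℂ) :
    (a - b) * ∫ s : unitInterval, Complex.exp ((s : ℝ) * a + (1 - (s : ℝ)) * b) =
      Complex.exp a - Complex.exp b := by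
  rw [Complex.exp_eq_exp_ℂ, exp_sub_exp a b, ← MeasureTheory.integral_const_mul]
  refine MeasureTheory.integral_congr_ae (Filter.Eventually.of_forall fun s => ?_)
  simp only [← Complex.exp_eq_exp_ℂ, smul_eq_mul, Complex.exp_add]
  ring

end Duhamel

/-! ### Operations on integrals of exponential words -/

section Operations

variable {B : Type*} [CStarAlgebra B] {R : ℝ} {h ρ σ : B} {F G : (Fin 3 → ℝ) → ℂ} {b b' : B}

theorem HasSymbol.congr (H : HasSymbol R h ρ σ F b)
    (hFG : ∀ x : Fin 3 → ℝ, (∀ i, |x i| < R) → Function.Injective x → F x = G x) :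
    HasSymbol R h ρ σ G b := by
  obtain ⟨Ω, _, μ, _, c, z, hz, hF, rfl⟩ := H
  exact ⟨Ω, _, μ, ‹_›, c, z, hz, fun x h1 h2 => (hF x h1 h2).trans (hFG x h1 h2), rfl⟩

theorem HasSymbol.neg (H : HasSymbol R h ρ σ F b) : HasSymbol R h ρ σ (fun x => -F x) (-b) := by
  obtain ⟨Ω, _, μ, _, c, z, hz, hF, rfl⟩ := H
  refine ⟨Ω, _, μ, ‹_›, fun o => -c o, z, ⟨hz.integrable.neg, hz.measurable, hz.bounded⟩,
    fun x h1 h2 => ?_, ?_⟩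
  · simp only [← hF x h1 h2, expSymbol, neg_mul, MeasureTheory.integral_neg]
  · simp only [neg_smul, MeasureTheory.integral_neg]

theorem measurableEmbedding_sumInl {Ω Ω' : Type*} [MeasurableSpace Ω] [MeasurableSpace Ω'] :
    MeasurableEmbedding (Sum.inl : Ω → Ω ⊕ Ω') :=
  ⟨Sum.inl_injective, measurable_inl, fun _ hs => hs.inl_image⟩

theorem measurableEmbedding_sumInr {Ω Ω' : Type*} [MeasurableSpace Ω] [MeasurableSpace Ω'] :
    MeasurableEmbedding (Sum.inr : Ω' → Ω ⊕ Ω') :=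
  ⟨Sum.inr_injective, measurable_inr, fun _ hs => hs.inr_image⟩

theorem integrable_sum_measure {Ω Ω' E : Type*} [MeasurableSpace Ω] [MeasurableSpace Ω']
    {μ : MeasureTheory.Measure Ω} {ν : MeasureTheory.Measure Ω'} [NormedAddCommGroup E]
    {f : Ω ⊕ Ω' → E} (h1 : MeasureTheory.Integrable (fun o => f (Sum.inl o)) μ)
    (h2 : MeasureTheory.Integrable (fun o => f (Sum.inr o)) ν) :
    MeasureTheory.Integrable f (μ.map Sum.inl + ν.map Sum.inr) :=
  (measurableEmbedding_sumInl.integrable_map_iff.2 h1).add_measure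
    (measurableEmbedding_sumInr.integrable_map_iff.2 h2)

theorem integral_sum_measure {Ω Ω' E : Type*} [MeasurableSpace Ω] [MeasurableSpace Ω']
    {μ : MeasureTheory.Measure Ω} {ν : MeasureTheory.Measure Ω'} [NormedAddCommGroup E]
    [NormedSpace ℝ E] {f : Ω ⊕ Ω' → E}
    (h1 : MeasureTheory.Integrable (fun o => f (Sum.inl o)) μ)
    (h2 : MeasureTheory.Integrable (fun o => f (Sum.inr o)) ν) :
    ∫ o, f o ∂(μ.map Sum.inl + ν.map Sum.inr) =
      ∫ o, f (Sum.inl o) ∂μ + ∫ o, f (Sum.inr o) ∂ν := by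
  rw [MeasureTheory.integral_add_measure (measurableEmbedding_sumInl.integrable_map_iff.2 h1)
    (measurableEmbedding_sumInr.integrable_map_iff.2 h2), measurableEmbedding_sumInl.integral_map,
    measurableEmbedding_sumInr.integral_map]

theorem HasSymbol.add (hh : IsSelfAdjoint h) (H : HasSymbol R h ρ σ F b)
    (H' : HasSymbol R h ρ σ G b') : HasSymbol R h ρ σ (fun x => F x + G x) (b + b') := by
  obtain ⟨Ω, _, μ, _, c, z, hz, hF, rfl⟩ := H
  obtain ⟨Ω', _, μ', _, c', z', hz', hG, rfl⟩ := H'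
  refine ⟨Ω ⊕ Ω', _, μ.map Sum.inl + μ'.map Sum.inr, inferInstance, Sum.elim c c', Sum.elim z z',
    ⟨integrable_sum_measure hz.integrable hz'.integrable, hz.measurable.sumElim hz'.measurable, ?_⟩,
    fun x h1 h2 => ?_, ?_⟩
  · obtain ⟨M, hM⟩ := hz.bounded
    obtain ⟨M', hM'⟩ := hz'.bounded
    refine ⟨max M M', fun o i => ?_⟩
    rcases o with o | o
    · exact (hM o i).trans (le_max_left _ _)
    · exact (hM' o i).trans (le_max_right _ _)
  · exact (integral_sum_measure (hz.integrable_exp x) (hz'.integrable_exp x)).trans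
      (congrArg₂ (· + ·) (hF x h1 h2) (hG x h1 h2))
  · exact integral_sum_measure (hz.integrable_word hh ρ σ) (hz'.integrable_word hh ρ σ)

theorem HasSymbol.sub (hh : IsSelfAdjoint h) (H : HasSymbol R h ρ σ F b)
    (H' : HasSymbol R h ρ σ G b') : HasSymbol R h ρ σ (fun x => F x - G x) (b - b') := by
  simpa only [sub_eq_add_neg] using H.add hh H'.neg

theorem exp_add_smul {E : Type*} [NormedRing E] [NormedAlgebra ℂ E] [CompleteSpace E] (z w : ℂ)
    (h : E) :
    NormedSpace.exp ((z + w) • h) = NormedSpace.exp (z • h) * NormedSpace.exp (w • h) := by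
  let _ : NormedAlgebra ℚ E := NormedAlgebra.restrictScalars ℚ ℂ E
  rw [add_smul]
  exact NormedSpace.exp_add_of_commute
    (((Commute.refl h).smul_left z).smul_right w)

/-- Left multiplication by `exp (w h)` shifts the exponents and multiplies the symbol by
`exp (w x₀)`. -/
theorem HasSymbol.exp_mul (w : ℂ) (H : HasSymbol R h ρ σ F b) (hh : IsSelfAdjoint h) :
    HasSymbol R h ρ σ (fun x => Complex.exp (w * x 0) * F x) (NormedSpace.exp (w • h) * b) := by
  obtain ⟨Ω, _, μ, _, c, z, hz, hF, rfl⟩ := H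
  obtain ⟨M, hM⟩ := hz.bounded
  have hm := hz.measurable
  refine ⟨Ω, _, μ, ‹_›, c, fun o => Pi.single 0 w + z o, ⟨hz.integrable, by fun_prop,
    |w.re| + M, fun o i => ?_⟩, fun x h1 h2 => ?_, ?_⟩
  · rw [Pi.add_apply, Complex.add_re]
    refine (abs_add_le _ _).trans (add_le_add ?_ (hM o i))
    fin_cases i <;> simp
  · refine Eq.trans ?_ (congrArg (Complex.exp (w * x 0) * ·) (hF x h1 h2))
    simp only [expSymbol]
    rw [← MeasureTheory.integral_const_mul]
    refine MeasureTheory.integral_congr_ae (Filter.Eventually.of_forall fun o => ?_)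
    simp only [Pi.add_apply, add_mul, Finset.sum_add_distrib, Complex.exp_add,
      Fin.sum_univ_three]
    simp
    ring
  · refine Eq.trans ?_ ((ContinuousLinearMap.mul ℂ B (NormedSpace.exp (w • h))).integral_comp_comm
      (hz.integrable_word hh ρ σ))
    refine MeasureTheory.integral_congr_ae (Filter.Eventually.of_forall fun o => ?_)
    simp [expWord, exp_add_smul, mul_assoc]

/-- The exponents `s e_p + (1 - s) e_q`, `0 ≤ s ≤ 1`, whose symbol is the divided difference of
the exponential function. -/
def duhamelExponent (p q : Fin 3) (s : unitInterval) : Fin 3 → ℂ :=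
  Pi.single p ((s : ℝ) : ℂ) + Pi.single q (1 - ((s : ℝ) : ℂ))

theorem isExpFamily_duhamel (p q : Fin 3) :
    IsExpFamily (MeasureTheory.volume : MeasureTheory.Measure unitInterval) (fun _ => 1)
      (duhamelExponent p q) := by
  have hc : Continuous (duhamelExponent p q) :=
    ((continuous_single p).comp (by fun_prop)).add ((continuous_single q).comp (by fun_prop))
  refine ⟨MeasureTheory.integrable_const _, hc.measurable, 2, fun s i => ?_⟩
  have h0 := s.2.1
  have h1 := s.2.2
  have h2 : |((Pi.single p ((s : ℝ) : ℂ) : Fin 3 → ℂ) i).re| ≤ 1 := by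
    by_cases hip : i = p
    · subst hip; simp [abs_le]; constructor <;> linarith
    · simp [hip]
  have h3 : |((Pi.single q (1 - ((s : ℝ) : ℂ)) : Fin 3 → ℂ) i).re| ≤ 1 := by
    by_cases hip : i = q
    · subst hip; simp [abs_le]; constructor <;> linarith
    · simp [hip]
  rw [duhamelExponent, Pi.add_apply, Complex.add_re]
  exact (abs_add_le _ _).trans (by linarith)

/-- The divided difference of the exponential function at `x p` and `x q`, for distinct points. -/
def expDiff (p q : Fin 3) (x : Fin 3 → ℝ) : ℂ :=
  (Complex.exp (x p) - Complex.exp (x q)) / ((x p : ℂ) - x q)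

theorem expSymbol_duhamel {p q : Fin 3} (hpq : p ≠ q) {x : Fin 3 → ℝ} (hx : Function.Injective x) :
    expSymbol MeasureTheory.volume (fun _ => 1) (duhamelExponent p q) x = expDiff p q x := by
  have hne : (x p : ℂ) - x q ≠ 0 := by
    rw [sub_ne_zero]
    exact_mod_cast fun he => hpq (hx he)
  rw [expDiff, eq_div_iff hne, mul_comm, ← mul_integral_cexp, expSymbol]
  congr 1
  refine MeasureTheory.integral_congr_ae (Filter.Eventually.of_forall fun s => ?_)
  simp [duhamelExponent, Finset.sum_add_distrib, add_mul, Pi.single_apply]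

end Operations

/-! ### Composition with divided differences -/

section Composition

variable {B : Type*} [CStarAlgebra B] {R : ℝ} {h ρ σ : B} {F G : (Fin 3 → ℝ) → ℂ} {b : B}

/-- Multiplication of the symbol by a Laplace integral: the integrals of exponential words form a
module over such functions. -/
theorem hasSymbol_prod {Ω Ω' : Type} [MeasurableSpace Ω] [MeasurableSpace Ω']
    {μ : MeasureTheory.Measure Ω} {ν : MeasureTheory.Measure Ω'} [MeasureTheory.SFinite μ]
    [MeasureTheory.SFinite ν] {c : Ω → ℂ} {z : Ω → Fin 3 → ℂ} {d : Ω' → ℂ} {w : Ω' → Fin 3 → ℂ}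
    (H : IsExpFamily μ c z) (H' : IsExpFamily ν d w)
    (hF : ∀ x : Fin 3 → ℝ, (∀ i, |x i| < R) → Function.Injective x → expSymbol μ c z x = F x)
    (hG : ∀ x : Fin 3 → ℝ, (∀ i, |x i| < R) → Function.Injective x → expSymbol ν d w x = G x) :
    HasSymbol R h ρ σ (fun x => G x * F x)
      (∫ p, (c p.1 * d p.2) • expWord h (z p.1 + w p.2) ρ σ ∂(μ.prod ν)) := by
  refine ⟨Ω × Ω', _, μ.prod ν, inferInstance, _, _, H.prod H', fun x h1 h2 => ?_, rfl⟩
  rw [IsExpFamily.expSymbol_prod, hF x h1 h2, hG x h1 h2, mul_comm]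

theorem integral_integral_word_eq_prod {Ω Ω' : Type} [MeasurableSpace Ω] [MeasurableSpace Ω']
    {μ : MeasureTheory.Measure Ω} {ν : MeasureTheory.Measure Ω'} [MeasureTheory.SFinite μ]
    [MeasureTheory.SFinite ν] {c : Ω → ℂ} {z : Ω → Fin 3 → ℂ} {d : Ω' → ℂ} {w : Ω' → Fin 3 → ℂ}
    (H : IsExpFamily μ c z) (H' : IsExpFamily ν d w) (hh : IsSelfAdjoint h) :
    ∫ p, (c p.1 * d p.2) • expWord h (z p.1 + w p.2) ρ σ ∂(μ.prod ν) =
      ∫ o, c o • ∫ s, d s • expWord h (z o + w s) ρ σ ∂ν ∂μ := by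
  rw [MeasureTheory.integral_prod _ ((H.prod H').integrable_word hh ρ σ)]
  refine MeasureTheory.integral_congr_ae (Filter.Eventually.of_forall fun o => ?_)
  simp only [mul_smul, MeasureTheory.integral_smul]

/-- The operator `b ↦ ∫₀¹ k^{1-s} b k^s ds`, `k = exp h`, multiplies the symbol by the divided
difference of the exponential function at the outer points. -/
theorem HasSymbol.conj (H : HasSymbol R h ρ σ F b) (hh : IsSelfAdjoint h) :
    HasSymbol R h ρ σ (fun x => expDiff 2 0 x * F x)
      (∫ s : unitInterval, NormedSpace.exp ((1 - ((s : ℝ) : ℂ)) • h) * b *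
        NormedSpace.exp (((s : ℝ) : ℂ) • h)) := by
  obtain ⟨Ω, _, μ, _, c, z, hz, hF, rfl⟩ := H
  have hD := isExpFamily_duhamel 2 0
  convert hasSymbol_prod (h := h) (ρ := ρ) (σ := σ) hz hD hF
    (fun x _ h2 => expSymbol_duhamel (by decide) h2) using 1
  rw [MeasureTheory.integral_prod_symm _ ((hz.prod hD).integrable_word hh ρ σ)]
  refine MeasureTheory.integral_congr_ae (Filter.Eventually.of_forall fun s => ?_)
  dsimp only
  refine Eq.trans (((ContinuousLinearMap.mul ℂ B).flip
    (NormedSpace.exp (((s : ℝ) : ℂ) • h)) ∘L (ContinuousLinearMap.mul ℂ B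
    (NormedSpace.exp ((1 - ((s : ℝ) : ℂ)) • h)))).integral_comp_comm
      (hz.integrable_word hh ρ σ)).symm ?_
  refine MeasureTheory.integral_congr_ae (Filter.Eventually.of_forall fun o => ?_)
  have e0 : (z o + duhamelExponent 2 0 s) 0 = (1 - ((s : ℝ) : ℂ)) + z o 0 := by
    simp [duhamelExponent, add_comm]
  have e1 : (z o + duhamelExponent 2 0 s) 1 = z o 1 := by simp [duhamelExponent]
  have e2 : (z o + duhamelExponent 2 0 s) 2 = z o 2 + ((s : ℝ) : ℂ) := by simp [duhamelExponent]
  simp only [expWord, e0, e1, e2, exp_add_smul]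
  simp [mul_assoc]

/-- Substitution of `κ = ∫₀¹ k^s η k^{1-s} ds` for the first argument. -/
theorem HasSymbol.subst_left {κ η : B} (H : HasSymbol R h κ σ F b) (hh : IsSelfAdjoint h)
    (hκ : κ = ∫ s : unitInterval, NormedSpace.exp (((s : ℝ) : ℂ) • h) * η *
        NormedSpace.exp ((1 - ((s : ℝ) : ℂ)) • h)) :
    HasSymbol R h η σ (fun x => expDiff 0 1 x * F x) b := by
  obtain ⟨Ω, _, μ, _, c, z, hz, hF, rfl⟩ := H
  have hD := isExpFamily_duhamel 0 1
  convert hasSymbol_prod (h := h) (ρ := η) (σ := σ) hz hD hF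
    (fun x _ h2 => expSymbol_duhamel (by decide) h2) using 1
  rw [integral_integral_word_eq_prod hz hD hh]
  refine MeasureTheory.integral_congr_ae (Filter.Eventually.of_forall fun o => ?_)
  dsimp only
  congr 1
  have hexp := continuous_normedSpace_exp (E := B)
  have hint : MeasureTheory.Integrable (fun s : unitInterval =>
      NormedSpace.exp (((s : ℝ) : ℂ) • h) * η * NormedSpace.exp ((1 - ((s : ℝ) : ℂ)) • h)) :=
    Continuous.integrable_of_hasCompactSupport (by fun_prop) (HasCompactSupport.of_compactSpace _)
  have := ((ContinuousLinearMap.mul ℂ B).flip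
    (NormedSpace.exp (z o 1 • h) * σ * NormedSpace.exp (z o 2 • h)) ∘L (ContinuousLinearMap.mul ℂ B
    (NormedSpace.exp (z o 0 • h)))).integral_comp_comm hint
  rw [← hκ] at this
  refine Eq.trans (Eq.trans ?_ this.symm) ?_
  · simp [expWord, mul_assoc]
  refine MeasureTheory.integral_congr_ae (Filter.Eventually.of_forall fun s => ?_)
  have e0 : (z o + duhamelExponent 0 1 s) 0 = z o 0 + ((s : ℝ) : ℂ) := by
    simp [duhamelExponent]
  have e1 : (z o + duhamelExponent 0 1 s) 1 = (1 - ((s : ℝ) : ℂ)) + z o 1 := by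
    simp [duhamelExponent, add_comm]
  have e2 : (z o + duhamelExponent 0 1 s) 2 = z o 2 := by simp [duhamelExponent]
  simp only [expWord, e0, e1, e2, exp_add_smul]
  simp [mul_assoc]

/-- Substitution of `κ = ∫₀¹ k^s η k^{1-s} ds` for the second argument. -/
theorem HasSymbol.subst_right {κ η : B} (H : HasSymbol R h ρ κ F b) (hh : IsSelfAdjoint h)
    (hκ : κ = ∫ s : unitInterval, NormedSpace.exp (((s : ℝ) : ℂ) • h) * η *
        NormedSpace.exp ((1 - ((s : ℝ) : ℂ)) • h)) :
    HasSymbol R h ρ η (fun x => expDiff 1 2 x * F x) b := by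
  obtain ⟨Ω, _, μ, _, c, z, hz, hF, rfl⟩ := H
  have hD := isExpFamily_duhamel 1 2
  convert hasSymbol_prod (h := h) (ρ := ρ) (σ := η) hz hD hF
    (fun x _ h2 => expSymbol_duhamel (by decide) h2) using 1
  rw [integral_integral_word_eq_prod hz hD hh]
  refine MeasureTheory.integral_congr_ae (Filter.Eventually.of_forall fun o => ?_)
  dsimp only
  congr 1
  have hexp := continuous_normedSpace_exp (E := B)
  have hint : MeasureTheory.Integrable (fun s : unitInterval =>
      NormedSpace.exp (((s : ℝ) : ℂ) • h) * η * NormedSpace.exp ((1 - ((s : ℝ) : ℂ)) • h)) :=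
    Continuous.integrable_of_hasCompactSupport (by fun_prop) (HasCompactSupport.of_compactSpace _)
  have := ((ContinuousLinearMap.mul ℂ B).flip
    (NormedSpace.exp (z o 2 • h)) ∘L (ContinuousLinearMap.mul ℂ B
    (NormedSpace.exp (z o 0 • h) * ρ * NormedSpace.exp (z o 1 • h)))).integral_comp_comm hint
  rw [← hκ] at this
  refine Eq.trans (Eq.trans ?_ this.symm) ?_
  · simp [expWord, mul_assoc]
  refine MeasureTheory.integral_congr_ae (Filter.Eventually.of_forall fun s => ?_)
  have e0 : (z o + duhamelExponent 1 2 s) 0 = z o 0 := by simp [duhamelExponent]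
  have e1 : (z o + duhamelExponent 1 2 s) 1 = z o 1 + ((s : ℝ) : ℂ) := by
    simp [duhamelExponent]
  have e2 : (z o + duhamelExponent 1 2 s) 2 = (1 - ((s : ℝ) : ℂ)) + z o 2 := by
    simp [duhamelExponent, add_comm]
  simp only [expWord, e0, e1, e2, exp_add_smul]
  simp [mul_assoc]

/-- The exponents `s w e_p + (1 - s) w e_q + w' e_r`. -/
def splitExponent (p q r : Fin 3) (w w' : ℂ) (s : unitInterval) : Fin 3 → ℂ :=
  Pi.single p ((s : ℝ) * w) + Pi.single q ((1 - ((s : ℝ) : ℂ)) * w) + Pi.single r w'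

/-- The family `∫∫ c w exp (splitExponent) ds dμ`, which arises when Duhamel's formula is applied to
`exp (w h)`; the factor `w` comes from the derivative of `w h`. -/
theorem isExpFamily_split {X : Type*} [MeasurableSpace X] {μ : MeasureTheory.Measure X}
    [MeasureTheory.SFinite μ] {c w w' : X → ℂ}
    (hcw : MeasureTheory.Integrable (fun x => c x * w x) μ) (hw : Measurable w)
    (hw' : Measurable w') {M : ℝ} (hM : ∀ x, |(w x).re| ≤ M) (hM' : ∀ x, |(w' x).re| ≤ M)
    (p q r : Fin 3) :
    IsExpFamily (μ.prod (MeasureTheory.volume : MeasureTheory.Measure unitInterval))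
      (fun y => c y.1 * w y.1) (fun y => splitExponent p q r (w y.1) (w' y.1) y.2) := by
  have hs : Measurable fun y : X × unitInterval => ((y.2 : ℝ) : ℂ) := by fun_prop
  have hsingle : ∀ i : Fin 3, Measurable fun v : ℂ => (Pi.single i v : Fin 3 → ℂ) := fun i =>
    (continuous_single i).measurable
  refine ⟨hcw.comp_fst _, ?_, M + M + M, fun y i => ?_⟩
  · unfold splitExponent
    exact (((hsingle p).comp (by fun_prop)).add ((hsingle q).comp (by fun_prop))).add
      ((hsingle r).comp (by fun_prop))
  · have hM0 : 0 ≤ M := (abs_nonneg _).trans (hM y.1)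
    have key : ∀ (k : Fin 3) (v : ℂ), |v.re| ≤ M → |((Pi.single k v : Fin 3 → ℂ) i).re| ≤ M := by
      intro k v hv
      by_cases hik : i = k
      · subst hik; simpa using hv
      · simpa [hik] using hM0
    have h0 := y.2.2.1
    have h1 := y.2.2.2
    unfold splitExponent
    simp only [Pi.add_apply, Complex.add_re]
    refine (abs_add_le _ _).trans (add_le_add ((abs_add_le _ _).trans (add_le_add ?_ ?_)) ?_)
    · refine key _ _ ?_
      rw [Complex.re_ofReal_mul, abs_mul, abs_of_nonneg h0]
      exact (mul_le_of_le_one_left (abs_nonneg _) h1).trans (hM _)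
    · refine key _ _ ?_
      rw [← Complex.ofReal_one, ← Complex.ofReal_sub, Complex.re_ofReal_mul, abs_mul,
        abs_of_nonneg (by linarith)]
      exact (mul_le_of_le_one_left (abs_nonneg _) (by linarith)).trans (hM _)
    · exact key _ _ (hM' _)

theorem sum_splitExponent (p q r : Fin 3) (w w' : ℂ) (s : unitInterval) (x : Fin 3 → ℝ) :
    ∑ i, splitExponent p q r w w' s i * x i =
      ((s : ℝ) * (w * x p) + (1 - (s : ℝ)) * (w * x q)) + w' * x r := by
  simp [splitExponent, Finset.sum_add_distrib, add_mul, Pi.single_apply, mul_assoc]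

/-- The symbol of the family of `isExpFamily_split` is the divided difference, in `x p` and `x q`,
of the symbol of the family with exponents `w` and `w'`. -/
theorem expSymbol_split {X : Type*} [MeasurableSpace X] {μ : MeasureTheory.Measure X}
    [MeasureTheory.SFinite μ] {c w w' : X → ℂ}
    (hcw : MeasureTheory.Integrable (fun x => c x * w x) μ) (hw : Measurable w)
    (hw' : Measurable w') {M : ℝ} (hM : ∀ x, |(w x).re| ≤ M) (hM' : ∀ x, |(w' x).re| ≤ M)
    (p q r : Fin 3) (x : Fin 3 → ℝ) :
    ((x p : ℂ) - x q) *
      expSymbol (μ.prod (MeasureTheory.volume : MeasureTheory.Measure unitInterval))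
      (fun y => c y.1 * w y.1) (fun y => splitExponent p q r (w y.1) (w' y.1) y.2) x =
    ∫ y, c y * (Complex.exp (w y * x p) - Complex.exp (w y * x q)) *
      Complex.exp (w' y * x r) ∂μ := by
  rw [expSymbol, MeasureTheory.integral_prod _
    ((isExpFamily_split hcw hw hw' hM hM' p q r).integrable_exp x),
    ← MeasureTheory.integral_const_mul]
  refine MeasureTheory.integral_congr_ae (Filter.Eventually.of_forall fun y => ?_)
  simp only [sum_splitExponent, Complex.exp_add _ (w' y * x r)]
  rw [MeasureTheory.integral_const_mul, MeasureTheory.integral_mul_const, ← mul_integral_cexp]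
  ring

end Composition

/-! ### Fréchet algebras -/

section Frechet

variable {A : Type u} [Ring A] [Algebra ℂ A] [UniformSpace A] [IsUniformAddGroup A]
  [CompleteSpace A] [IsTopologicalRing A]

/-- An increasing sequence of submultiplicative seminorms which defines the topology and whose
first member is a norm. -/
structure IsFrechetFamily {A : Type u} [Ring A] [Algebra ℂ A] [TopologicalSpace A]
    (p : ℕ → Seminorm ℂ A) : Prop where
  withSeminorms : WithSeminorms p
  mono : Monotone p
  mul_le : ∀ n a b, p n (a * b) ≤ p n a * p n b
  eq_zero : ∀ a, p 0 a = 0 → a = 0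

variable {p : ℕ → Seminorm ℂ A} (hp : IsFrechetFamily p)

include hp

omit [IsUniformAddGroup A] [CompleteSpace A] [IsTopologicalRing A] in
theorem IsFrechetFamily.t2Space : T2Space A := by
  have : T1Space A := hp.withSeminorms.T1_of_separating fun x hx =>
    ⟨0, fun h0 => hx (hp.eq_zero x h0)⟩
  infer_instance

omit [IsUniformAddGroup A] [CompleteSpace A] [IsTopologicalRing A] in
theorem IsFrechetFamily.continuousSMul : ContinuousSMul ℂ A :=
  hp.withSeminorms.continuousSMul

omit [IsUniformAddGroup A] [CompleteSpace A] [IsTopologicalRing A] in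
theorem IsFrechetFamily.continuous_seminorm (m : ℕ) : Continuous (p m) :=
  hp.withSeminorms.continuous_seminorm m

omit [IsUniformAddGroup A] [CompleteSpace A] [IsTopologicalRing A] in
theorem IsFrechetFamily.finset_sup_le (s : Finset ℕ) : ∃ n, s.sup p ≤ p n :=
  ⟨s.sup id, Finset.sup_le fun _ hi => hp.mono (Finset.le_sup (f := id) hi)⟩

omit [IsUniformAddGroup A] [CompleteSpace A] in
theorem IsFrechetFamily.tendsto_iff {ι : Type*} {l : Filter ι} {u : ι → A} {a : A} :
    Filter.Tendsto u l (𝓝 a) ↔ ∀ m, Filter.Tendsto (fun i => p m (u i - a)) l (𝓝 0) := by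
  constructor
  · intro H m
    have h1 : Filter.Tendsto (fun i => u i - a) l (𝓝 (a - a)) := H.sub_const a
    have h2 := ((hp.continuous_seminorm m).tendsto (a - a)).comp h1
    simpa [Function.comp_def] using! h2
  · intro H
    rw [hp.withSeminorms.tendsto_nhds]
    intro m ε hε
    exact (H m).eventually (gt_mem_nhds hε)

omit [IsUniformAddGroup A] [CompleteSpace A] [IsTopologicalRing A] in
theorem IsFrechetFamily.exists_bound {E : Type*} [NormedAddCommGroup E] [NormedSpace ℂ E]
    (T : A →L[ℂ] E) : ∃ n C, 0 ≤ C ∧ ∀ a, ‖T a‖ ≤ C * p n a := by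
  have hc : Continuous ((normSeminorm ℂ E).comp (T : A →ₗ[ℂ] E)) :=
    continuous_norm.comp T.continuous
  obtain ⟨s, C, -, hC⟩ := Seminorm.bound_of_continuous hp.withSeminorms _ hc
  obtain ⟨n, hn⟩ := hp.finset_sup_le s
  exact ⟨n, C, C.2, fun a => (hC a).trans (mul_le_mul_of_nonneg_left (hn a) C.2)⟩

omit [IsUniformAddGroup A] [CompleteSpace A] in
/-- The Banach algebra completion for the `m`-th seminorm. -/
theorem IsFrechetFamily.exists_completion (m : ℕ) :
    ∃ (E : Type u) (_ : NormedRing E) (_ : NormedAlgebra ℂ E) (_ : CompleteSpace E)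
      (π : A →ₐ[ℂ] E), (∀ a, ‖π a‖ = p m a) ∧ DenseRange π ∧ Continuous π := by
  obtain ⟨E, i1, i2, i3, π, h1, h2⟩ := exists_banach_completion (p m) (hp.mul_le m)
  refine ⟨E, i1, i2, i3, π, h1, h2, ?_⟩
  rw [continuous_iff_continuousAt]
  intro a
  rw [ContinuousAt, tendsto_iff_norm_sub_tendsto_zero]
  simp only [← map_sub, h1]
  exact hp.tendsto_iff.1 Filter.tendsto_id m

omit [IsTopologicalRing A] in
/-- Absolute convergence for all seminorms implies convergence. -/
theorem IsFrechetFamily.summable {f : ℕ → A} (hf : ∀ m, Summable fun k => p m (f k)) :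
    Summable f := by
  rw [summable_iff_vanishing]
  intro e he
  obtain ⟨s, r, hr, hs⟩ := (hp.withSeminorms.mem_nhds_iff 0 e).1 he
  obtain ⟨n, hn⟩ := hp.finset_sup_le s
  obtain ⟨t, ht⟩ := summable_iff_vanishing_norm.1 (hf n) r hr
  refine ⟨t, fun t' ht' => hs ?_⟩
  rw [Seminorm.mem_ball_zero]
  refine (hn _).trans_lt (lt_of_le_of_lt ?_ (ht t' ht'))
  exact (Finset.le_sum_of_subadditive (p n) (map_zero _).le (map_add_le_add _) t' f).trans
    (le_abs_self _)

omit [IsUniformAddGroup A] [CompleteSpace A] [IsTopologicalRing A] in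
theorem IsFrechetFamily.pow_le (m : ℕ) (a : A) (k : ℕ) :
    p m (a ^ k) ≤ (p m 1 + 1) * p m a ^ k := by
  induction k with
  | zero => simp
  | succ k ih =>
    rw [pow_succ, pow_succ, ← mul_assoc]
    exact (hp.mul_le m _ _).trans (mul_le_mul_of_nonneg_right ih (apply_nonneg _ _))

omit [IsUniformAddGroup A] [CompleteSpace A] [IsTopologicalRing A] in
theorem IsFrechetFamily.seminorm_exp_term_le (m : ℕ) (a : A) (k : ℕ) :
    p m (((k.factorial : ℂ))⁻¹ • a ^ k) ≤ (p m 1 + 1) * (p m a ^ k / k.factorial) := by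
  rw [map_smul_eq_mul, norm_inv, Complex.norm_natCast]
  calc ((k.factorial : ℝ))⁻¹ * p m (a ^ k)
      ≤ ((k.factorial : ℝ))⁻¹ * ((p m 1 + 1) * p m a ^ k) :=
        mul_le_mul_of_nonneg_left (hp.pow_le m a k) (by positivity)
    _ = _ := by ring

omit [IsTopologicalRing A] in
theorem IsFrechetFamily.summable_exp_term (a : A) :
    Summable fun k : ℕ => ((k.factorial : ℂ))⁻¹ • a ^ k := by
  refine hp.summable fun m => ?_
  refine Summable.of_nonneg_of_le (fun _ => apply_nonneg _ _)
    (fun k => hp.seminorm_exp_term_le m a k) ?_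
  exact (Real.summable_pow_div_factorial _).mul_left _

/-- The exponential series converges in `A`, and is preserved by continuous homomorphisms to Banach
algebras; this transfers identities between exponentials to `A`. -/
theorem IsFrechetFamily.map_exp {E : Type*} [NormedRing E] [NormedAlgebra ℂ E]
    {π : A →ₐ[ℂ] E} (hπ : Continuous π) (a : A) :
    π (NormedSpace.exp a) = NormedSpace.exp (π a) := by
  rw [NormedSpace.exp_eq_tsum ℂ, NormedSpace.exp_eq_tsum ℂ]
  have := hp.t2Space
  refine ((hp.summable_exp_term a).hasSum.map π hπ).tsum_eq.symm.trans ?_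
  simp

theorem IsFrechetFamily.seminorm_exp_le (m : ℕ) (a : A) :
    p m (NormedSpace.exp a) ≤ (p m 1 + 1) * Real.exp (p m a) := by
  have := hp.t2Space
  have h1 := ((hp.summable_exp_term a).hasSum.tendsto_sum_nat)
  rw [NormedSpace.exp_eq_tsum ℂ]
  refine le_of_tendsto (((hp.continuous_seminorm m).tendsto _).comp h1)
    (Filter.Eventually.of_forall fun n => ?_)
  have h2 : ∑ k ∈ Finset.range n, p m a ^ k / k.factorial ≤ Real.exp (p m a) :=
    Real.sum_le_exp_of_nonneg (apply_nonneg _ _) n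
  refine (Finset.le_sum_of_subadditive (p m) (map_zero _).le (map_add_le_add _) _ _).trans
    ((Finset.sum_le_sum fun k _ => hp.seminorm_exp_term_le m a k).trans ?_)
  rw [← Finset.mul_sum]
  have := apply_nonneg (p m) (1 : A)
  exact mul_le_mul_of_nonneg_left h2 (by linarith)

omit [IsUniformAddGroup A] [CompleteSpace A] in
/-- Continuity can be tested in the Banach algebras to which `A` maps. -/
theorem IsFrechetFamily.continuous_of_seminorms {X : Type*} [TopologicalSpace X] {u : X → A}
    (h : ∀ (E : Type u) [NormedRing E] [NormedAlgebra ℂ E] [CompleteSpace E] (π : A →ₐ[ℂ] E),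
      Continuous π → Continuous fun x => π (u x)) : Continuous u := by
  rw [continuous_iff_continuousAt]
  intro x
  refine hp.tendsto_iff.2 fun m => ?_
  obtain ⟨E, _, _, _, π, h1, -, h3⟩ := hp.exists_completion m
  have := tendsto_iff_norm_sub_tendsto_zero.1 ((h E π h3).tendsto x)
  simpa only [← map_sub, h1] using this

theorem IsFrechetFamily.continuous_exp : Continuous (NormedSpace.exp : A → A) := by
  refine hp.continuous_of_seminorms fun E _ _ _ π hπ => ?_
  simp only [hp.map_exp hπ]
  exact continuous_normedSpace_exp.comp hπ

omit [IsUniformAddGroup A] [CompleteSpace A] in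
/-- Continuous linear maps into Banach spaces factor through one of the completions. -/
theorem IsFrechetFamily.exists_factor {F : Type*} [NormedAddCommGroup F] [NormedSpace ℂ F]
    [CompleteSpace F] (T : A →L[ℂ] F) :
    ∃ (E : Type u) (_ : NormedRing E) (_ : NormedAlgebra ℂ E) (_ : CompleteSpace E)
      (π : A →ₐ[ℂ] E) (S : E →L[ℂ] F), Continuous π ∧ ∀ a, T a = S (π a) := by
  obtain ⟨n, C, -, hC⟩ := hp.exists_bound T
  obtain ⟨E, i1, i2, i3, π, h1, h2, h3⟩ := hp.exists_completion n
  refine ⟨E, i1, i2, i3, π, (T : A →ₗ[ℂ] F).extendOfNorm π.toLinearMap, h3, fun a => ?_⟩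
  exact (LinearMap.extendOfNorm_eq (f := (T : A →ₗ[ℂ] F)) (e := π.toLinearMap) h2
    ⟨C, fun x => by simpa [h1] using hC x⟩ a).symm

end Frechet

/-! ### Weak integrals -/

section WeakIntegral

/-- `b = ∫ Φ dμ`, as a weak integral over an arbitrary measure space; `HasWeakIntegral` is the case
of Lebesgue measure. -/
def HasWeakIntegralOn {A : Type*} [Ring A] [Algebra ℂ A] [TopologicalSpace A] {Ω : Type*}
    [MeasurableSpace Ω] (μ : MeasureTheory.Measure Ω) (Φ : Ω → A) (b : A) : Prop :=
  ∀ l : A →L[ℂ] ℂ, MeasureTheory.Integrable (fun o => l (Φ o)) μ ∧ ∫ o, l (Φ o) ∂μ = l b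

/-- `Φ` is continuous and each seminorm of `Φ` is bounded by an integrable function. -/
structure IsDominated {A : Type*} [Ring A] [Algebra ℂ A] [TopologicalSpace A]
    (p : ℕ → Seminorm ℂ A) {Ω : Type*} [TopologicalSpace Ω]
    [MeasurableSpace Ω] (μ : MeasureTheory.Measure Ω) (Φ : Ω → A) : Prop where
  continuous : Continuous Φ
  bound : ∀ m, ∃ G : Ω → ℝ, MeasureTheory.Integrable G μ ∧ ∀ o, p m (Φ o) ≤ G o

variable {A : Type u} [Ring A] [Algebra ℂ A] [UniformSpace A] [IsUniformAddGroup A]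
  [CompleteSpace A] [IsTopologicalRing A] {p : ℕ → Seminorm ℂ A}
  {Ω : Type*} [TopologicalSpace Ω] [SecondCountableTopology Ω] [MeasurableSpace Ω]
  [OpensMeasurableSpace Ω] {μ : MeasureTheory.Measure Ω} {Φ : Ω → A} {b : A}

omit [IsUniformAddGroup A] [CompleteSpace A] [IsTopologicalRing A] in
omit [TopologicalSpace Ω] [SecondCountableTopology Ω] [OpensMeasurableSpace Ω] in
theorem HasWeakIntegralOn.map {A' : Type*} [Ring A'] [Algebra ℂ A'] [TopologicalSpace A']
    (H : HasWeakIntegralOn μ Φ b) (T : A →L[ℂ] A') :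
    HasWeakIntegralOn μ (fun o => T (Φ o)) (T b) :=
  fun l => H (l ∘L T)

omit [IsUniformAddGroup A] [CompleteSpace A] [IsTopologicalRing A] in
theorem IsDominated.integrable (hp : IsFrechetFamily p) (H : IsDominated p μ Φ) {E : Type*}
    [NormedAddCommGroup E] [NormedSpace ℂ E] (T : A →L[ℂ] E) :
    MeasureTheory.Integrable (fun o => T (Φ o)) μ := by
  obtain ⟨n, C, hC0, hC⟩ := hp.exists_bound T
  obtain ⟨G, hG, hG'⟩ := H.bound n
  refine (hG.const_mul C).mono' (T.continuous.comp H.continuous).aestronglyMeasurable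
    (Filter.Eventually.of_forall fun o => (hC _).trans ?_)
  exact mul_le_mul_of_nonneg_left (hG' o) hC0

omit [IsUniformAddGroup A] [CompleteSpace A] [IsTopologicalRing A] [TopologicalSpace Ω]
  [SecondCountableTopology Ω] [OpensMeasurableSpace Ω] in
/-- A weak integral is mapped to the Bochner integral by operators into Banach spaces. -/
theorem HasWeakIntegralOn.integral_eq (H : HasWeakIntegralOn μ Φ b) {E : Type*}
    [NormedAddCommGroup E] [NormedSpace ℂ E] [CompleteSpace E] (T : A →L[ℂ] E)
    (hT : MeasureTheory.Integrable (fun o => T (Φ o)) μ) : ∫ o, T (Φ o) ∂μ = T b := by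
  refine (SeparatingDual.eq_iff_forall_dual_eq (R := ℂ)).2 fun l => ?_
  rw [← ContinuousLinearMap.integral_comp_comm l hT]
  exact (H (l ∘L T)).2

omit [CompleteSpace A] in
/-- A sequence is Cauchy if it is so, at the rate `1 / n`, for each seminorm from some index on. -/
theorem IsFrechetFamily.cauchySeq (hp : IsFrechetFamily p) {a : ℕ → A}
    (h : ∀ m n k, m ≤ n → m ≤ k → p m (a k - a n) ≤ 1 / ((n : ℝ) + 1) + 1 / ((k : ℝ) + 1)) :
    CauchySeq a := by
  rw [cauchySeq_iff_tendsto, uniformity_eq_comap_nhds_zero, Filter.tendsto_comap_iff,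
    hp.tendsto_iff]
  intro m
  have h1 := tendsto_one_div_add_atTop_nhds_zero_nat (𝕜 := ℝ)
  have h2 : Filter.Tendsto (fun q : ℕ × ℕ => 1 / ((q.1 : ℝ) + 1) + 1 / ((q.2 : ℝ) + 1))
      Filter.atTop (𝓝 0) := by
    rw [← Filter.prod_atTop_atTop_eq]
    simpa using! (h1.comp Filter.tendsto_fst).add (h1.comp Filter.tendsto_snd)
  refine squeeze_zero' (Filter.Eventually.of_forall fun _ => apply_nonneg _ _) ?_ h2
  filter_upwards [Filter.eventually_ge_atTop (m, m)] with q hq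
  simpa using! h m q.1 q.2 hq.1 hq.2

/-- Existence of weak integrals: the Bochner integrals in the completions are approximated by
elements of the algebra, which form a Cauchy sequence. -/
theorem IsDominated.exists_weakIntegral (hp : IsFrechetFamily p) (H : IsDominated p μ Φ) :
    ∃ b, HasWeakIntegralOn μ Φ b := by
  choose E i1 i2 i3 π h1 h2 h3 using hp.exists_completion
  -- The completions form a projective system with transition maps `S m n : E n → E m`, `m ≤ n`.
  let π' : ∀ m, A →L[ℂ] E m := fun m => ⟨(π m).toLinearMap, h3 m⟩
  let S : ∀ m n, E n →L[ℂ] E m := fun m n => (π m).toLinearMap.extendOfNorm (π n).toLinearMap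
  have hbd : ∀ m n, m ≤ n → ∀ x, ‖(π m).toLinearMap x‖ ≤ 1 * ‖(π n).toLinearMap x‖ := by
    intro m n hmn x
    simpa [h1] using hp.mono hmn x
  have hS : ∀ m n, m ≤ n → ∀ a, S m n (π n a) = π m a := fun m n hmn a =>
    LinearMap.extendOfNorm_eq (f := (π m).toLinearMap) (e := (π n).toLinearMap) (h2 n)
      ⟨1, hbd m n hmn⟩ a
  have hS' : ∀ m n, m ≤ n → ∀ x, ‖S m n x‖ ≤ ‖x‖ := fun m n hmn x => by
    simpa using! LinearMap.norm_extendOfNorm_apply_le (f := (π m).toLinearMap)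
      (e := (π n).toLinearMap) (h2 n) 1 (hbd m n hmn) x
  have hint : ∀ m, MeasureTheory.Integrable (fun o => π m (Φ o)) μ := fun m =>
    H.integrable hp (π' m)
  let B : ∀ m, E m := fun m => ∫ o, π m (Φ o) ∂μ
  have hB : ∀ m n, m ≤ n → S m n (B n) = B m := by
    intro m n hmn
    simp only [B]
    rw [← ContinuousLinearMap.integral_comp_comm _ (hint n)]
    simp only [hS m n hmn]
  -- Elements of `A` which approximate the integral in the `m`-th completion.
  have happ : ∀ m, ∃ a, ‖π m a - B m‖ < 1 / ((m : ℝ) + 1) := by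
    intro m
    obtain ⟨a, ha⟩ := (h2 m).exists_dist_lt (B m) (ε := 1 / ((m : ℝ) + 1)) (by positivity)
    exact ⟨a, by rwa [dist_comm, dist_eq_norm] at ha⟩
  choose a ha using happ
  have hest : ∀ m n, m ≤ n → ‖π m (a n) - B m‖ ≤ 1 / ((n : ℝ) + 1) := by
    intro m n hmn
    rw [← hB m n hmn, ← hS m n hmn, ← map_sub]
    exact (hS' m n hmn _).trans (ha n).le
  have hC : CauchySeq a := hp.cauchySeq fun m n k hn hk => by
    rw [← h1, map_sub]
    calc ‖π m (a k) - π m (a n)‖ = ‖(π m (a k) - B m) - (π m (a n) - B m)‖ := by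
          rw [sub_sub_sub_cancel_right]
      _ ≤ 1 / ((k : ℝ) + 1) + 1 / ((n : ℝ) + 1) :=
          (norm_sub_le _ _).trans (add_le_add (hest m k hk) (hest m n hn))
      _ = _ := add_comm _ _
  obtain ⟨b, hb⟩ := cauchySeq_tendsto_of_complete hC
  have hlim : ∀ m, π m b = B m := by
    intro m
    refine tendsto_nhds_unique (((h3 m).tendsto b).comp hb) ?_
    rw [tendsto_iff_norm_sub_tendsto_zero]
    refine squeeze_zero' (Filter.Eventually.of_forall fun _ => norm_nonneg _) ?_
      (tendsto_one_div_add_atTop_nhds_zero_nat (𝕜 := ℝ))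
    filter_upwards [Filter.eventually_ge_atTop m] with n hn using hest m n hn
  refine ⟨b, fun l => ⟨H.integrable hp l, ?_⟩⟩
  obtain ⟨n, C, -, hCl⟩ := hp.exists_bound l
  let T := (l : A →ₗ[ℂ] ℂ).extendOfNorm (π n).toLinearMap
  have hT : ∀ a, T (π n a) = l a := fun a =>
    LinearMap.extendOfNorm_eq (f := (l : A →ₗ[ℂ] ℂ)) (e := (π n).toLinearMap) (h2 n)
      ⟨C, fun x => by simpa [h1] using hCl x⟩ a
  rw [← hT b, hlim n]
  simp only [B]
  rw [← ContinuousLinearMap.integral_comp_comm _ (hint n)]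
  simp only [hT]

omit [TopologicalSpace Ω] [SecondCountableTopology Ω] [OpensMeasurableSpace Ω] in
omit [IsUniformAddGroup A] [CompleteSpace A] in
/-- Weak integrals are unique, since `p 0` is a norm. -/
theorem HasWeakIntegralOn.unique (hp : IsFrechetFamily p) {b' : A} (H : HasWeakIntegralOn μ Φ b)
    (H' : HasWeakIntegralOn μ Φ b') : b = b' := by
  obtain ⟨E, _, _, _, π, h1, -, h3⟩ := hp.exists_completion 0
  rw [← sub_eq_zero]
  refine hp.eq_zero _ ?_
  rw [← h1, map_sub, norm_eq_zero, sub_eq_zero]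
  refine (SeparatingDual.eq_iff_forall_dual_eq (R := ℂ)).2 fun l => ?_
  let π' : A →L[ℂ] E := ⟨π.toLinearMap, h3⟩
  exact (H (l ∘L π')).2.symm.trans (H' (l ∘L π')).2

end WeakIntegral

/-! ### Smoothness of divided differences -/

section Smooth

theorem hasFDerivAt_integral_param {E F : Type} [NormedAddCommGroup E] [NormedSpace ℝ E]
    [ProperSpace E] [NormedAddCommGroup F] [NormedSpace ℝ F] {Φ : E × ℝ → F}
    (hΦ : ContDiff ℝ ∞ Φ) (x : E) :
    HasFDerivAt (fun x => ∫ s in (0 : ℝ)..1, Φ (x, s))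
      (∫ s in (0 : ℝ)..1, (fderiv ℝ Φ (x, s)).comp (ContinuousLinearMap.inl ℝ E ℝ)) x := by
  have hc : Continuous Φ := hΦ.continuous
  have hD : Continuous fun q => (fderiv ℝ Φ q).comp (ContinuousLinearMap.inl ℝ E ℝ) :=
    (hΦ.continuous_fderiv (by simp)).clm_comp continuous_const
  obtain ⟨K, hK⟩ := ((isCompact_closedBall x 1).prod
    (isCompact_Icc (a := (0 : ℝ)) (b := 1))).exists_bound_of_continuousOn hD.continuousOn
  refine intervalIntegral.hasFDerivAt_integral_of_dominated_of_fderiv_le (bound := fun _ => K)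
    (F' := fun x s => (fderiv ℝ Φ (x, s)).comp (ContinuousLinearMap.inl ℝ E ℝ))
    (Metric.closedBall_mem_nhds x one_pos)
    (Filter.Eventually.of_forall fun y => Continuous.aestronglyMeasurable (by fun_prop))
    (Continuous.intervalIntegrable (by fun_prop) _ _)
    (Continuous.aestronglyMeasurable (hD.comp (by fun_prop)))
    (Filter.Eventually.of_forall fun s hs y hy => hK (y, s) ⟨hy, ?_⟩)
    intervalIntegrable_const
    (Filter.Eventually.of_forall fun s _ y _ => ?_)
  · rw [Set.uIoc_of_le zero_le_one] at hs
    exact Set.Ioc_subset_Icc_self hs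
  · have h1 : HasFDerivAt Φ (fderiv ℝ Φ (y, s)) (y, s) :=
      ((hΦ.differentiable (by simp)) (y, s)).hasFDerivAt
    exact h1.comp y (hasFDerivAt_prodMk_left y s)

/-- Integration over `[0, 1]` of a smooth function preserves smoothness in the parameter. -/
theorem contDiff_integral_param {E : Type} [NormedAddCommGroup E] [NormedSpace ℝ E]
    [ProperSpace E] (n : ℕ) : ∀ {F : Type} [NormedAddCommGroup F] [NormedSpace ℝ F]
    {Φ : E × ℝ → F}, ContDiff ℝ ∞ Φ → ContDiff ℝ n (fun x => ∫ s in (0 : ℝ)..1, Φ (x, s)) := by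
  induction n with
  | zero =>
    intro F _ _ Φ hΦ
    have hc : Continuous Φ := hΦ.continuous
    rw [Nat.cast_zero, contDiff_zero]
    exact intervalIntegral.continuous_parametric_intervalIntegral_of_continuous'
      (f := fun x s => Φ (x, s)) (by simpa [Function.uncurry_def] using! hc) 0 1
  | succ n ih =>
    intro F _ _ Φ hΦ
    rw [Nat.cast_add, Nat.cast_one, contDiff_succ_iff_fderiv]
    refine ⟨fun x => (hasFDerivAt_integral_param hΦ x).differentiableAt, by simp, ?_⟩
    have : fderiv ℝ (fun x => ∫ s in (0 : ℝ)..1, Φ (x, s)) = fun x => ∫ s in (0 : ℝ)..1,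
        (fderiv ℝ Φ (x, s)).comp (ContinuousLinearMap.inl ℝ E ℝ) :=
      funext fun x => (hasFDerivAt_integral_param hΦ x).fderiv
    rw [this]
    exact ih (Φ := fun q => (fderiv ℝ Φ q).comp (ContinuousLinearMap.inl ℝ E ℝ))
      ((hΦ.fderiv_right (by simp)).clm_comp contDiff_const)

/-- The divided difference as an average of the derivative; it covers the diagonal and shows
smoothness. -/
theorem dslope_eq_integral {u : ℝ → ℂ} (hu : ContDiff ℝ ∞ u) (a b : ℝ) :
    dslope u a b = ∫ s in (0 : ℝ)..1, deriv u (a + s * (b - a)) := by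
  have hc : Continuous (deriv u) := hu.continuous_deriv (by simp)
  rcases eq_or_ne b a with rfl | hba
  · simp
  · have hd : ∀ s : ℝ, HasDerivAt (fun s => (b - a)⁻¹ • u (a + s * (b - a)))
        (deriv u (a + s * (b - a))) s := by
      intro s
      have h1 : HasDerivAt u (deriv u (a + s * (b - a))) (a + s * (b - a)) :=
        ((hu.differentiable (by simp)) _).hasDerivAt
      have h2 : HasDerivAt (fun s => a + s * (b - a)) (b - a) s := by
        simpa using ((hasDerivAt_id s).mul_const (b - a)).const_add a
      refine ((h1.scomp s h2).const_smul (b - a)⁻¹).congr_deriv ?_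
      rw [smul_smul, inv_mul_cancel₀ (sub_ne_zero.2 hba), one_smul]
    rw [intervalIntegral.integral_eq_sub_of_hasDerivAt (fun s _ => hd s)
      (Continuous.intervalIntegrable (by fun_prop) _ _), dslope_of_ne _ hba, slope_def_module]
    simp [smul_sub]

theorem contDiff_dslope {u : ℝ → ℂ} (hu : ContDiff ℝ ∞ u) :
    ContDiff ℝ ∞ fun q : ℝ × ℝ => dslope u q.1 q.2 := by
  have h1 : ContDiff ℝ ∞ (deriv u) := (contDiff_infty_iff_deriv.1 hu).2
  simp only [dslope_eq_integral hu]
  rw [contDiff_infty]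
  intro n
  exact contDiff_integral_param n (Φ := fun y : (ℝ × ℝ) × ℝ =>
    deriv u (y.1.1 + y.2 * (y.1.2 - y.1.1))) (h1.comp (by fun_prop))

/-- `f` is smooth on the positive orthant, expressed in logarithmic coordinates. -/
def IsLogSmooth {n : ℕ} (f : (Fin n → ℝ) → ℂ) : Prop :=
  ContDiff ℝ ∞ fun x : Fin n → ℝ => f fun l => Real.exp (x l)

theorem isLogSmooth_of_contDiffOn {n : ℕ} {f : (Fin n → ℝ) → ℂ}
    (hf : ContDiffOn ℝ ∞ f {y | ∀ l, 0 < y l}) : IsLogSmooth f := by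
  rw [IsLogSmooth, ← contDiffOn_univ]
  exact hf.comp (t := {y | ∀ l, 0 < y l})
    (ContDiff.contDiffOn (contDiff_pi.2 fun l => by fun_prop)) fun x _ l => Real.exp_pos _

theorem IsLogSmooth.add {n : ℕ} {f g : (Fin n → ℝ) → ℂ} (hf : IsLogSmooth f)
    (hg : IsLogSmooth g) : IsLogSmooth (f + g) := ContDiff.add hf hg

theorem IsLogSmooth.neg {n : ℕ} {f : (Fin n → ℝ) → ℂ} (hf : IsLogSmooth f) : IsLogSmooth (-f) :=
  ContDiff.neg hf

theorem IsLogSmooth.sub {n : ℕ} {f g : (Fin n → ℝ) → ℂ} (hf : IsLogSmooth f)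
    (hg : IsLogSmooth g) : IsLogSmooth (f - g) := ContDiff.sub hf hg

theorem IsLogSmooth.cyclicOp {n : ℕ} {f : (Fin (n + 1) → ℝ) → ℂ} (hf : IsLogSmooth f) (j : ℝ) :
    IsLogSmooth (cyclicOp j f) := by
  have key : (fun x : Fin (n + 1) → ℝ => ModularVariation.cyclicOp j f fun l => Real.exp (x l)) =
      fun x => ((Real.exp (j * ∑ l, x l) : ℝ) : ℂ) *
        f (fun l => Real.exp ((Fin.cons (-∑ l, x l) (Fin.init x) : Fin (n + 1) → ℝ) l)) := by
    funext x
    rw [ModularVariation.cyclicOp, ← Real.exp_sum, ← Real.exp_mul, mul_comm (∑ l, x l) j]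
    congr 2
    funext l
    refine Fin.cases ?_ (fun l => ?_) l
    · simp [Real.exp_neg]
    · simp [Fin.init]
  rw [IsLogSmooth, key]
  have h1 : ContDiff ℝ ∞ fun x : Fin (n + 1) → ℝ => Real.exp (j * ∑ l, x l) := by fun_prop
  have hf' : ContDiff ℝ ∞ fun x : Fin (n + 1) → ℝ => f fun l => Real.exp (x l) := hf
  refine ContDiff.mul (Complex.ofRealCLM.contDiff.comp h1) (hf'.comp
    (f := fun x => (Fin.cons (-∑ l, x l) (Fin.init x) : Fin (n + 1) → ℝ)) ?_)
  refine contDiff_pi.2 fun l => ?_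
  refine Fin.cases ?_ (fun l => ?_) l
  · simp only [Fin.cons_zero]; fun_prop
  · simp only [Fin.cons_succ, Fin.init]; fun_prop

/-- Divided differences in logarithmic coordinates. -/
theorem dslope_comp_exp {u : ℝ → ℂ} (hu : DifferentiableOn ℝ u (Set.Ioi 0)) (a b : ℝ) :
    dslope u (Real.exp a) (Real.exp b) =
      dslope (fun t => u (Real.exp t)) a b / dslope (fun t => (Real.exp t : ℂ)) a b := by
  have he : ∀ t, HasDerivAt (fun t : ℝ => (Real.exp t : ℂ)) (Real.exp t : ℂ) t := fun t =>
    (Real.hasDerivAt_exp t).ofReal_comp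
  rcases eq_or_ne b a with rfl | hba
  · have h1 : HasDerivAt u (deriv u (Real.exp b)) (Real.exp b) :=
      (hu.differentiableAt (Ioi_mem_nhds (Real.exp_pos b))).hasDerivAt
    have h2 := h1.scomp b (Real.hasDerivAt_exp b)
    have h3 : deriv (fun t => u (Real.exp t)) b = Real.exp b • deriv u (Real.exp b) := h2.deriv
    rw [dslope_same, dslope_same, dslope_same, h3, (he b).deriv, Complex.real_smul,
      mul_div_cancel_left₀]
    exact_mod_cast (Real.exp_pos b).ne'
  · have hne : Real.exp b ≠ Real.exp a := fun h => hba (Real.exp_injective h)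
    rw [dslope_of_ne _ hne, dslope_of_ne _ hba, dslope_of_ne _ hba, slope_def_module,
      slope_def_module, slope_def_module]
    have h1 : (b : ℂ) - a ≠ 0 := by rw [sub_ne_zero]; exact_mod_cast hba
    have h2 : (Real.exp b : ℂ) - Real.exp a ≠ 0 := by rw [sub_ne_zero]; exact_mod_cast hne
    simp only [Complex.real_smul]
    push_cast at h2 ⊢
    field_simp

theorem dslope_exp_ne_zero (a b : ℝ) : dslope (fun t => (Real.exp t : ℂ)) a b ≠ 0 := by
  rcases eq_or_ne b a with rfl | hba
  · rw [dslope_same, ((Real.hasDerivAt_exp b).ofReal_comp).deriv]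
    exact_mod_cast (Real.exp_pos b).ne'
  · have hne : Real.exp b ≠ Real.exp a := fun h => hba (Real.exp_injective h)
    rw [dslope_of_ne _ hba, slope_def_module]
    refine smul_ne_zero (inv_ne_zero (sub_ne_zero.2 hba)) (sub_ne_zero.2 ?_)
    exact_mod_cast hne

theorem IsLogSmooth.blackSquare {f : (Fin 1 → ℝ) → ℂ} (hf : IsLogSmooth f) :
    IsLogSmooth (blackSquare f) := by
  have hcomp : ContDiff ℝ ∞ fun t : ℝ => f ![Real.exp t] := by
    have h1 : ContDiff ℝ ∞ fun t : ℝ => (![t] : Fin 1 → ℝ) :=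
      contDiff_pi.2 fun l => by fin_cases l; exact contDiff_id
    have h2 : (fun t : ℝ => f ![Real.exp t]) =
        (fun x : Fin 1 → ℝ => f fun l => Real.exp (x l)) ∘ fun t : ℝ => (![t] : Fin 1 → ℝ) := by
      funext t
      simp only [Function.comp]
      congr 1
      funext l
      fin_cases l
      simp
    rw [h2]
    exact ContDiff.comp hf h1
  have hu : DifferentiableOn ℝ (fun z => f ![z]) (Set.Ioi 0) := by
    have h3 : DifferentiableOn ℝ (fun z => f ![Real.exp (Real.log z)]) (Set.Ioi 0) :=
      (hcomp.differentiable (by simp)).comp_differentiableOn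
        (Real.differentiableOn_log.mono fun z hz => (ne_of_gt hz : z ≠ 0))
    exact h3.congr fun z hz => by rw [Real.exp_log hz]
  have key : (fun x : Fin 2 → ℝ => ModularVariation.blackSquare f fun l => Real.exp (x l)) =
      fun x => dslope (fun t => f ![Real.exp t]) (x 0) (x 0 + x 1) /
        dslope (fun t => (Real.exp t : ℂ)) (x 0) (x 0 + x 1) := by
    funext x
    rw [ModularVariation.blackSquare, ← Real.exp_add, dslope_comp_exp hu]
  rw [IsLogSmooth, key]
  have he : ContDiff ℝ ∞ fun t : ℝ => (Real.exp t : ℂ) :=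
    Complex.ofRealCLM.contDiff.comp Real.contDiff_exp
  have hq : ContDiff ℝ ∞ fun x : Fin 2 → ℝ => (x 0, x 0 + x 1) := by fun_prop
  simp only [div_eq_mul_inv]
  exact ((contDiff_dslope hcomp).comp hq).mul (((contDiff_dslope he).comp hq).inv fun x =>
    dslope_exp_ne_zero _ _)

theorem IsLogSmooth.gradK {f : (Fin 1 → ℝ) → ℂ} (hf : IsLogSmooth f) (j : ℝ) :
    IsLogSmooth (gradK j f) :=
  (hf.add (hf.cyclicOp j)).neg

theorem IsLogSmooth.gradH {f : (Fin 1 → ℝ) → ℂ} (hf : IsLogSmooth f) (j : ℝ) :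
    IsLogSmooth (gradH j f) := by
  have h1 := (hf.gradK j).blackSquare
  exact (h1.add (h1.cyclicOp (j - 1))).sub ((h1.cyclicOp (j - 1)).cyclicOp (j - 1))

end Smooth

/-! ### Fourier densities -/

section Density

open FourierTransform in
/-- Every smooth function has a Fourier density on bounded sets: the rescaled Fourier transform of
its product with a bump function. -/
theorem exists_isFourierDensityOn {n : ℕ} {F : (Fin n → ℝ) → ℂ} (hF : ContDiff ℝ ∞ F) {U : Set ℝ}
    (hU : Bornology.IsBounded U) :
    ∃ g : 𝓢(EuclideanSpace ℝ (Fin n), ℂ), IsFourierDensityOn U F g := by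
  obtain ⟨K, hK⟩ := hU.subset_closedBall 0
  have hcomp : IsCompact ((WithLp.toLp 2 : (Fin n → ℝ) → EuclideanSpace ℝ (Fin n)) ''
      Set.univ.pi fun _ => Metric.closedBall (0 : ℝ) K) :=
    (isCompact_univ_pi fun _ => isCompact_closedBall _ _).image (PiLp.continuous_toLp 2 _)
  obtain ⟨r, hr⟩ := hcomp.isBounded.subset_closedBall 0
  let χ : ContDiffBump (0 : EuclideanSpace ℝ (Fin n)) :=
    ⟨max r 1, max r 1 + 1, by positivity, by linarith⟩
  have hψc : HasCompactSupport fun v : EuclideanSpace ℝ (Fin n) => (χ v : ℂ) * F fun l => v l :=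
    (χ.hasCompactSupport.comp_left (g := fun t : ℝ => (t : ℂ)) (by simp)).mul_right
  have hχ : ContDiff ℝ ∞ fun v => (χ v : ℝ) := χ.contDiff
  have hcoord : ContDiff ℝ ∞ fun v : EuclideanSpace ℝ (Fin n) => (fun l => v l : Fin n → ℝ) :=
    contDiff_pi.2 fun l => by fun_prop
  have hψ : ContDiff ℝ ∞ fun v : EuclideanSpace ℝ (Fin n) => (χ v : ℂ) * F fun l => v l :=
    (Complex.ofRealCLM.contDiff.comp hχ).mul (hF.comp hcoord)
  let ψ : 𝓢(EuclideanSpace ℝ (Fin n), ℂ) := hψc.toSchwartzMap hψ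
  let a : ℝ := -(2 * Real.pi)⁻¹
  have ha : a ≠ 0 := by
    have := Real.pi_pos
    simp only [a]
    exact neg_ne_zero.2 (by positivity)
  let c : ℝ := |(a ^ Module.finrank ℝ (EuclideanSpace ℝ (Fin n)))|
  have hc : c ≠ 0 := abs_ne_zero.2 (pow_ne_zero _ ha)
  let e : EuclideanSpace ℝ (Fin n) ≃L[ℝ] EuclideanSpace ℝ (Fin n) :=
    (LinearEquiv.smulOfNeZero ℝ _ a ha).toContinuousLinearEquiv
  -- The dilation by `a` turns the character `exp (2πi ⟨w, x⟩)` of the inversion formula into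
  -- `exp (-i ⟨ξ, x⟩)`, and `c` is its Jacobian.
  refine ⟨(c : ℂ) • SchwartzMap.compCLMOfContinuousLinearEquiv ℂ e (𝓕 ψ), fun x hx => ?_⟩
  have hmem : WithLp.toLp 2 x ∈ Metric.closedBall (0 : EuclideanSpace ℝ (Fin n)) (max r 1) :=
    Metric.closedBall_subset_closedBall (le_max_left _ _)
      (hr ⟨x, fun l _ => hK (hx l), rfl⟩)
  have h1 : F x = ψ (WithLp.toLp 2 x) := by
    change F x = (χ (WithLp.toLp 2 x) : ℂ) * F _
    rw [χ.one_of_mem_closedBall hmem]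
    simp
  have h2 : ψ (WithLp.toLp 2 x) = ∫ w, Complex.exp ((↑(2 * Real.pi * inner ℝ w (WithLp.toLp 2 x)) *
      Complex.I)) • (𝓕 ψ) w := by
    have h3 : 𝓕⁻ (𝓕 ψ) = ψ := fourierInv_fourier_eq ψ
    calc ψ (WithLp.toLp 2 x) = (𝓕⁻ (𝓕 ψ)) (WithLp.toLp 2 x) := by rw [h3]
      _ = _ := by rw [SchwartzMap.fourierInv_coe, Real.fourierInv_eq']
  have h4 := MeasureTheory.Measure.integral_comp_smul
    (MeasureTheory.volume : MeasureTheory.Measure (EuclideanSpace ℝ (Fin n)))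
    (fun w => Complex.exp ((↑(2 * Real.pi * inner ℝ w (WithLp.toLp 2 x)) *
      Complex.I)) • (𝓕 ψ) w) a
  rw [h1, h2]
  have h5 : ∀ b : ℂ,
      (c : ℂ) * ((|(a ^ Module.finrank ℝ (EuclideanSpace ℝ (Fin n)))⁻¹| : ℝ) • b) = b := by
    intro b
    rw [Complex.real_smul, ← mul_assoc, abs_inv]
    change ((c : ℝ) : ℂ) * ((c⁻¹ : ℝ) : ℂ) * b = b
    rw [← Complex.ofReal_mul, mul_inv_cancel₀ hc, Complex.ofReal_one, one_mul]
  rw [← h5 (∫ w, _), ← h4, ← MeasureTheory.integral_const_mul]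
  refine MeasureTheory.integral_congr_ae (Filter.Eventually.of_forall fun ξ => ?_)
  have h6 : Complex.exp ((↑(2 * Real.pi * inner ℝ (a • ξ) (WithLp.toLp 2 x)) * Complex.I)) =
      Complex.exp (-Complex.I * ∑ l, (x l : ℂ) * ξ l) := by
    congr 1
    have h7 : 2 * Real.pi * inner ℝ (a • ξ) (WithLp.toLp 2 x) = -∑ l, x l * ξ l := by
      rw [inner_smul_left, PiLp.inner_apply]
      have hpi := Real.pi_ne_zero
      simp only [a, RCLike.inner_apply, conj_trivial]
      field_simp
    rw [h7]
    push_cast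
    ring
  simp only [h6]
  change (c : ℂ) * (Complex.exp (-Complex.I * ∑ l, (x l : ℂ) * ξ l) * (𝓕 ψ) (a • ξ)) =
    ((c : ℂ) * (𝓕 ψ) (a • ξ)) * Complex.exp (-Complex.I * ∑ l, (x l : ℂ) * ξ l)
  ring

end Density

/-! ### The symbols of the gradient -/

section Symbols

/-- The symbol `e^{j x} f(e^{y - x})` of `k^j f(𝐲)`, summed over both orders of `x` and `y`. -/
def pairSymbol (j : ℝ) (f : (Fin 1 → ℝ) → ℂ) (x y : ℝ) : ℂ :=
  Complex.exp (j * x) * f ![Real.exp (y - x)] + Complex.exp (j * y) * f ![Real.exp (x - y)]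

/-- The symbol of `k^j K̃(𝐲)` is `-pairSymbol`. -/
theorem cexp_mul_gradK (j : ℝ) (f : (Fin 1 → ℝ) → ℂ) (x y : ℝ) :
    Complex.exp (j * x) * gradK j f ![Real.exp (y - x)] = -pairSymbol j f x y := by
  have h1 : (Fin.cons (Real.exp (y - x))⁻¹ (Fin.init ![Real.exp (y - x)]) : Fin 1 → ℝ) =
      ![Real.exp (x - y)] := by
    funext l
    fin_cases l
    simp [← Real.exp_neg]
  have h2 : Complex.exp (j * x) * ((Real.exp (y - x) ^ j : ℝ) : ℂ) = Complex.exp (j * y) := by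
    rw [← Real.exp_mul, Complex.ofReal_exp, ← Complex.exp_add]
    congr 1
    push_cast
    ring
  have h3 : cyclicOp j f ![Real.exp (y - x)] =
      ((Real.exp (y - x) ^ j : ℝ) : ℂ) * f ![Real.exp (x - y)] := by
    simp [cyclicOp, ← h1]
  simp only [gradK, Pi.neg_apply, Pi.add_apply, h3, pairSymbol, ← h2]
  ring

/-- In the variables `a, b, c` with `y₁ = e^{b-a}`, `y₂ = e^{c-b}`, the operator `𝛔_j` is a cyclic
permutation. -/
theorem cexp_mul_cyclicOp (j : ℝ) (G : (Fin 2 → ℝ) → ℂ) (a b c : ℝ) :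
    Complex.exp (j * a) * cyclicOp j G ![Real.exp (b - a), Real.exp (c - b)] =
      Complex.exp (j * c) * G ![Real.exp (a - c), Real.exp (b - a)] := by
  have h0 : ∏ l, (![Real.exp (b - a), Real.exp (c - b)] : Fin 2 → ℝ) l = Real.exp (c - a) := by
    rw [Fin.prod_univ_two]
    simp only [Matrix.cons_val_zero, Matrix.cons_val_one]
    rw [← Real.exp_add]
    congr 1
    ring
  have h1 : (Fin.cons (Real.exp (c - a))⁻¹ (Fin.init ![Real.exp (b - a), Real.exp (c - b)]) :
      Fin 2 → ℝ) = ![Real.exp (a - c), Real.exp (b - a)] := by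
    funext l
    fin_cases l
    · simp [← Real.exp_neg]
    · simp [Fin.init]
  have h2 : Complex.exp (j * a) * ((Real.exp (c - a) ^ j : ℝ) : ℂ) = Complex.exp (j * c) := by
    rw [← Real.exp_mul, Complex.ofReal_exp, ← Complex.exp_add]
    congr 1
    push_cast
    ring
  rw [cyclicOp, h0, h1, ← mul_assoc, h2]

/-- In the same variables, `■⁺(K̃)` is a divided difference of `pairSymbol` with respect to
`e^b` and `e^c`. -/
theorem cexp_mul_blackSquare (j : ℝ) (f : (Fin 1 → ℝ) → ℂ) {a b c : ℝ} (hbc : b ≠ c) :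
    Complex.exp ((j - 1 : ℝ) * a) *
        blackSquare (gradK j f) ![Real.exp (b - a), Real.exp (c - b)] =
      -((pairSymbol j f a c - pairSymbol j f a b) / (Complex.exp c - Complex.exp b)) := by
  have h1 : Real.exp (b - a) * Real.exp (c - b) = Real.exp (c - a) := by
    rw [← Real.exp_add]
    congr 1
    ring
  have hne : Real.exp (c - a) ≠ Real.exp (b - a) := fun h => hbc (by
    have := Real.exp_injective h
    linarith)
  have hne' : Complex.exp c - Complex.exp b ≠ 0 := by
    rw [← Complex.ofReal_exp, ← Complex.ofReal_exp, sub_ne_zero]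
    exact_mod_cast fun h => hbc (Real.exp_injective h).symm
  have hbs : blackSquare (gradK j f) ![Real.exp (b - a), Real.exp (c - b)] =
      ((Real.exp (c - a) - Real.exp (b - a))⁻¹ : ℝ) •
        (gradK j f ![Real.exp (c - a)] - gradK j f ![Real.exp (b - a)]) := by
    rw [blackSquare]
    simp only [Matrix.cons_val_zero, Matrix.cons_val_one]
    rw [h1, dslope_of_ne _ hne, slope_def_module]
  have e1 : Complex.exp c - Complex.exp b =
      Complex.exp a * ((Real.exp (c - a) - Real.exp (b - a) : ℝ) : ℂ) := by
    push_cast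
    rw [mul_sub, ← Complex.exp_add, ← Complex.exp_add]
    congr 2 <;> ring
  have e2 : Complex.exp (j * a) = Complex.exp ((j - 1 : ℝ) * a) * Complex.exp a := by
    rw [← Complex.exp_add]
    congr 1
    push_cast
    ring
  have k1 := cexp_mul_gradK j f a c
  have k2 := cexp_mul_gradK j f a b
  rw [e2] at k1 k2
  have hd : ((Real.exp (c - a) - Real.exp (b - a) : ℝ) : ℂ) ≠ 0 := by
    exact_mod_cast sub_ne_zero.2 hne
  have ha := Complex.exp_ne_zero (a : ℂ)
  rw [hbs, e1, Complex.real_smul, Complex.ofReal_inv]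
  field_simp
  linear_combination k1 - k2

/-- The symbol of `k^{j-1} H̃(𝐲₁, 𝐲₂)` is a sum of three divided differences, with respect to the
variables `e^{x_i}`, which are cyclic permutations of each other up to sign. -/
theorem cexp_mul_gradH (j : ℝ) (f : (Fin 1 → ℝ) → ℂ) {a b c : ℝ} (hab : a ≠ b) (hbc : b ≠ c)
    (hca : c ≠ a) :
    Complex.exp ((j - 1 : ℝ) * a) * gradH j f ![Real.exp (b - a), Real.exp (c - b)] =
      -((pairSymbol j f a c - pairSymbol j f a b) / (Complex.exp c - Complex.exp b))
      - (pairSymbol j f c b - pairSymbol j f c a) / (Complex.exp b - Complex.exp a)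
      + (pairSymbol j f b a - pairSymbol j f b c) / (Complex.exp a - Complex.exp c) := by
  simp only [gradH, Pi.sub_apply, Pi.add_apply, mul_sub, mul_add, cexp_mul_cyclicOp,
    cexp_mul_blackSquare j f hbc, cexp_mul_blackSquare j f hab, cexp_mul_blackSquare j f hca]
  ring

end Symbols

/-! ### Polynomial growth -/

section Growth

variable {A : Type u} [Ring A] [Algebra ℂ A]

/-- The seminorms of the family `Φ` grow at most polynomially in `w`; the degree may depend on the
seminorm. -/
def PolyGrowth (p : ℕ → Seminorm ℂ A) {ι : Type*} (w : ι → ℝ) (Φ : ι → A) : Prop :=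
  ∀ m, ∃ C : ℝ, ∃ N : ℕ, 0 ≤ C ∧ ∀ i, p m (Φ i) ≤ C * (1 + |w i|) ^ N

variable {p : ℕ → Seminorm ℂ A} {ι : Type*} {w : ι → ℝ} {Φ Ψ : ι → A}

theorem PolyGrowth.mul [TopologicalSpace A] (hp : IsFrechetFamily p) (H : PolyGrowth p w Φ)
    (H' : PolyGrowth p w Ψ) :
    PolyGrowth p w fun i => Φ i * Ψ i := by
  intro m
  obtain ⟨C, N, hC, h⟩ := H m
  obtain ⟨C', N', hC', h'⟩ := H' m
  refine ⟨C * C', N + N', by positivity, fun i => (hp.mul_le m _ _).trans ?_⟩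
  calc p m (Φ i) * p m (Ψ i) ≤ (C * (1 + |w i|) ^ N) * (C' * (1 + |w i|) ^ N') :=
        mul_le_mul (h i) (h' i) (apply_nonneg _ _) (by positivity)
    _ = _ := by ring

theorem PolyGrowth.comp {κ : Type*} (H : PolyGrowth p w Φ) (g : κ → ι) :
    PolyGrowth p (fun k => w (g k)) fun k => Φ (g k) := by
  intro m
  obtain ⟨C, N, hC, h'⟩ := H m
  exact ⟨C, N, hC, fun k => h' (g k)⟩

theorem polyGrowth_const (a : A) : PolyGrowth p w fun _ => a :=
  fun m => ⟨p m a, 0, apply_nonneg _ _, fun i => by simp⟩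

theorem PolyGrowth.add (H : PolyGrowth p w Φ) (H' : PolyGrowth p w Ψ) :
    PolyGrowth p w fun i => Φ i + Ψ i := by
  intro m
  obtain ⟨C, N, hC, h⟩ := H m
  obtain ⟨C', N', hC', h'⟩ := H' m
  refine ⟨C + C', N + N', by positivity, fun i => (map_add_le_add _ _ _).trans ?_⟩
  have h1 : (1 : ℝ) ≤ 1 + |w i| := by linarith [abs_nonneg (w i)]
  rw [add_mul]
  refine add_le_add ((h i).trans (mul_le_mul_of_nonneg_left ?_ hC))
    ((h' i).trans (mul_le_mul_of_nonneg_left ?_ hC'))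
  · exact pow_le_pow_right₀ h1 (Nat.le_add_right _ _)
  · exact pow_le_pow_right₀ h1 (Nat.le_add_left _ _)

theorem PolyGrowth.smul (H : PolyGrowth p w Φ) {c : ι → ℂ} {K : ℝ} (hK : 0 ≤ K)
    (hc : ∀ i, ‖c i‖ ≤ K * (1 + |w i|)) : PolyGrowth p w fun i => c i • Φ i := by
  intro m
  obtain ⟨C, N, hC, h⟩ := H m
  refine ⟨K * C, N + 1, by positivity, fun i => ?_⟩
  rw [map_smul_eq_mul]
  calc ‖c i‖ * p m (Φ i) ≤ (K * (1 + |w i|)) * (C * (1 + |w i|) ^ N) :=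
        mul_le_mul (hc i) (h i) (apply_nonneg _ _) (by positivity)
    _ = _ := by ring

end Growth

section Exponentials

variable {A : Type u} [Ring A] [Algebra ℂ A] [UniformSpace A] [IsUniformAddGroup A]
  [CompleteSpace A] [IsTopologicalRing A] {p : ℕ → Seminorm ℂ A} {ι : Type*} {w : ι → ℝ}

omit [IsUniformAddGroup A] [CompleteSpace A] [IsTopologicalRing A] in
theorem PolyGrowth.map (hp : IsFrechetFamily p) {Φ : ι → A}
    (H : PolyGrowth p w Φ) (T : A →L[ℂ] A) :
    PolyGrowth p w fun i => T (Φ i) := by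
  intro m
  have hc : Continuous ((p m).comp (T : A →ₗ[ℂ] A)) :=
    (hp.continuous_seminorm m).comp T.continuous
  obtain ⟨s, K, -, hK⟩ := Seminorm.bound_of_continuous hp.withSeminorms _ hc
  obtain ⟨n, hn⟩ := hp.finset_sup_le s
  obtain ⟨C, N, hC, h⟩ := H n
  refine ⟨K * C, N, mul_nonneg K.2 hC, fun i => ?_⟩
  calc p m (T (Φ i)) ≤ K * p n (Φ i) :=
        (hK (Φ i)).trans (mul_le_mul_of_nonneg_left (hn _) K.2)
    _ ≤ K * (C * (1 + |w i|) ^ N) := mul_le_mul_of_nonneg_left (h i) K.2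
    _ = _ := by ring

theorem IsFrechetFamily.exp_add_smul (hp : IsFrechetFamily p) (z v : ℂ) (h : A) :
    NormedSpace.exp ((z + v) • h) = NormedSpace.exp (z • h) * NormedSpace.exp (v • h) := by
  obtain ⟨E, _, _, _, π, h1, -, h3⟩ := hp.exists_completion 0
  rw [← sub_eq_zero]
  refine hp.eq_zero _ ?_
  rw [← h1, map_sub, map_mul, hp.map_exp h3, hp.map_exp h3, hp.map_exp h3, map_smul, map_smul,
    map_smul, ModularVariation.exp_add_smul, sub_self, norm_zero]

/-- The seminorms required of a smooth Fréchet *-algebra. -/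
structure IsSmoothFamily {A : Type u} [Ring A] [StarRing A] [Algebra ℂ A] [TopologicalSpace A]
    [IsTopologicalRing A] (p : ℕ → Seminorm ℂ A) : Prop extends IsFrechetFamily p where
  star_mul : ∀ a, p 0 (star a * a) = p 0 a ^ 2
  growth : ∀ n, ∃ m N : ℕ, ∃ C : ℝ, ∀ a : A, IsSelfAdjoint a →
    p n (NormedSpace.exp (Complex.I • a)) ≤ C * (1 + p m a) ^ N

theorem isSelfAdjoint_real_smul {A : Type*} [Ring A] [StarRing A] [Algebra ℂ A] [StarModule ℂ A]
    {h : A} (hh : IsSelfAdjoint h) (t : ℝ) :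
    IsSelfAdjoint ((t : ℂ) • h) := by
  rw [IsSelfAdjoint, star_smul, hh.star_eq, Complex.star_def, Complex.conj_ofReal]

/-- The exponentials `exp (z a)` grow at most polynomially in `Im z` as long as `Re z` and the
self-adjoint elements `a` stay bounded. -/
theorem IsSmoothFamily.polyGrowth_exp [StarRing A] [StarModule ℂ A] (hp : IsSmoothFamily p)
    {z : ι → ℂ} {a : ι → A}
    (ha : ∀ i, IsSelfAdjoint (a i)) {X : ℝ} (hX : ∀ i, |(z i).re| ≤ X)
    (hb : ∀ m, ∃ K, ∀ i, p m (a i) ≤ K) (hw : ∀ i, |(z i).im| ≤ |w i|) :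
    PolyGrowth p w fun i => NormedSpace.exp (z i • a i) := by
  have h1 : PolyGrowth p w fun i => NormedSpace.exp (((z i).re : ℂ) • a i) := by
    intro m
    obtain ⟨K, hK⟩ := hb m
    have h0 := apply_nonneg (p m) (1 : A)
    refine ⟨(p m 1 + 1) * Real.exp (|X| * |K|), 0, by positivity, fun i => ?_⟩
    rw [pow_zero, mul_one]
    refine (hp.seminorm_exp_le m _).trans (mul_le_mul_of_nonneg_left ?_ (by linarith))
    refine Real.exp_le_exp.2 ?_
    rw [map_smul_eq_mul, Complex.norm_real, Real.norm_eq_abs]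
    exact mul_le_mul ((hX i).trans (le_abs_self _)) ((hK i).trans (le_abs_self _))
      (apply_nonneg _ _) (abs_nonneg _)
  have h2 : PolyGrowth p w fun i => NormedSpace.exp ((Complex.I * ((z i).im : ℂ)) • a i) := by
    intro n
    obtain ⟨m, N, C, hC⟩ := hp.growth n
    obtain ⟨K, hK⟩ := hb m
    refine ⟨|C| * (1 + |K|) ^ N, N, by positivity, fun i => ?_⟩
    have hs := hC _ (isSelfAdjoint_real_smul (ha i) (z i).im)
    rw [smul_smul] at hs
    refine hs.trans ?_
    rw [map_smul_eq_mul, Complex.norm_real, Real.norm_eq_abs, mul_assoc, ← mul_pow]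
    refine (mul_le_mul_of_nonneg_right (le_abs_self C) (by positivity)).trans
      (mul_le_mul_of_nonneg_left ?_ (abs_nonneg _))
    refine pow_le_pow_left₀ (by positivity) ?_ N
    have h3 : |(z i).im| * p m (a i) ≤ |w i| * |K| :=
      mul_le_mul (hw i) ((hK i).trans (le_abs_self _)) (apply_nonneg _ _) (abs_nonneg _)
    nlinarith [abs_nonneg (w i), abs_nonneg K]
  have h3 := h1.mul hp.toIsFrechetFamily h2
  have h4 : (fun i => NormedSpace.exp (z i • a i)) = fun i =>
      NormedSpace.exp (((z i).re : ℂ) • a i) *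
      NormedSpace.exp ((Complex.I * ((z i).im : ℂ)) • a i) := by
    funext i
    rw [← hp.exp_add_smul, mul_comm Complex.I, Complex.re_add_im]
  rw [h4]
  exact h3

end Exponentials

/-! ### Domination of weak integrals -/

section Domination

variable {A : Type u} [Ring A] [Algebra ℂ A] [UniformSpace A]
  [IsUniformAddGroup A] [CompleteSpace A] [IsTopologicalRing A] {p : ℕ → Seminorm ℂ A}

theorem one_add_pow_le {t : ℝ} (ht : 0 ≤ t) (N : ℕ) : (1 + t) ^ N ≤ 2 ^ N * (1 + t ^ N) := by
  rcases le_total t 1 with h | h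
  · calc (1 + t) ^ N ≤ 2 ^ N := pow_le_pow_left₀ (by linarith) (by linarith) N
      _ ≤ 2 ^ N * (1 + t ^ N) := le_mul_of_one_le_right (by positivity)
        (by linarith [pow_nonneg ht N])
  · calc (1 + t) ^ N ≤ (2 * t) ^ N := pow_le_pow_left₀ (by linarith) (by linarith) N
      _ = 2 ^ N * t ^ N := mul_pow _ _ _
      _ ≤ 2 ^ N * (1 + t ^ N) := by gcongr; linarith

theorem integrable_schwartz_mul_one_add_pow {n : ℕ} (g : 𝓢(EuclideanSpace ℝ (Fin n), ℂ)) (N : ℕ) :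
    MeasureTheory.Integrable fun ξ => ‖g ξ‖ * (1 + ‖ξ‖) ^ N := by
  have h0 := g.integrable_pow_mul MeasureTheory.volume 0
  have hN := g.integrable_pow_mul MeasureTheory.volume N
  refine ((h0.add hN).const_mul (2 ^ N)).mono' (by fun_prop)
    (Filter.Eventually.of_forall fun ξ => ?_)
  rw [Real.norm_of_nonneg (by positivity)]
  have := mul_le_mul_of_nonneg_left (one_add_pow_le (norm_nonneg ξ) N) (norm_nonneg (g ξ))
  simp only [Pi.add_apply, pow_zero, one_mul]
  linarith

omit [IsUniformAddGroup A] [CompleteSpace A] [IsTopologicalRing A] in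
/-- Against a Schwartz function, families of polynomial growth are dominated; with
`IsDominated.exists_weakIntegral` this yields all weak integrals over the line and the plane. -/
theorem isDominated_schwartz (hp : IsFrechetFamily p) {n : ℕ}
    (g : 𝓢(EuclideanSpace ℝ (Fin n), ℂ)) {Φ : EuclideanSpace ℝ (Fin n) → A} (hΦ : Continuous Φ)
    (hg : PolyGrowth p (fun ξ => ‖ξ‖) Φ) :
    IsDominated p MeasureTheory.volume fun ξ => g ξ • Φ ξ := by
  have := hp.continuousSMul
  refine ⟨g.continuous.smul hΦ, fun m => ?_⟩
  obtain ⟨C, N, hC, h⟩ := hg m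
  refine ⟨fun ξ => C * (‖g ξ‖ * (1 + ‖ξ‖) ^ N),
    (integrable_schwartz_mul_one_add_pow g N).const_mul C, fun ξ => ?_⟩
  rw [map_smul_eq_mul]
  have := mul_le_mul_of_nonneg_left (h ξ) (norm_nonneg (g ξ))
  rw [abs_norm] at this
  linarith

omit [IsUniformAddGroup A] [CompleteSpace A] [IsTopologicalRing A] in
theorem isDominated_schwartz_prod (hp : IsFrechetFamily p) {n : ℕ}
    (g : 𝓢(EuclideanSpace ℝ (Fin n), ℂ)) {Φ : EuclideanSpace ℝ (Fin n) × unitInterval → A}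
    (hΦ : Continuous Φ) (hg : PolyGrowth p (fun y => ‖y.1‖) Φ) :
    IsDominated p (MeasureTheory.volume.prod MeasureTheory.volume) fun y => g y.1 • Φ y := by
  have := hp.continuousSMul
  refine ⟨(g.continuous.comp continuous_fst).smul hΦ, fun m => ?_⟩
  obtain ⟨C, N, hC, h⟩ := hg m
  refine ⟨fun y => C * (‖g y.1‖ * (1 + ‖y.1‖) ^ N),
    ((integrable_schwartz_mul_one_add_pow g N).const_mul C).comp_fst _, fun y => ?_⟩
  rw [map_smul_eq_mul]
  have := mul_le_mul_of_nonneg_left (h y) (norm_nonneg (g y.1))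
  rw [abs_norm] at this
  linarith

omit [IsUniformAddGroup A] [CompleteSpace A] [IsTopologicalRing A] in
theorem isDominated_unitInterval (hp : IsFrechetFamily p) {Φ : unitInterval → A}
    (hΦ : Continuous Φ) : IsDominated p MeasureTheory.volume Φ := by
  refine ⟨hΦ, fun m => ?_⟩
  obtain ⟨K, hK⟩ := (isCompact_range ((hp.continuous_seminorm m).comp hΦ)).bddAbove
  exact ⟨fun _ => K, MeasureTheory.integrable_const _, fun o => hK ⟨o, rfl⟩⟩

end Domination

/-! ### Multiplication by the generator -/

section Generator

variable {B : Type*} [CStarAlgebra B] {R : ℝ} {h ρ σ : B} {F : (Fin 3 → ℝ) → ℂ} {b : B}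

/-- A self-adjoint element is a superposition of its unitary exponentials. -/
theorem integral_density_smul_exp (hh : IsSelfAdjoint h) (hhR : ‖h‖ < R)
    {g : 𝓢(EuclideanSpace ℝ (Fin 1), ℂ)}
    (hg : IsFourierDensityOn (Set.Ioo (-R) R) (fun x => (x 0 : ℂ)) g) :
    ∫ ξ, g ξ • NormedSpace.exp ((-(Complex.I * (ξ 0 : ℂ))) • h) = h := by
  have hn : IsStarNormal h := hh.isStarNormal
  have key := cfc_integral (μ := MeasureTheory.volume)
    (fun (ξ : EuclideanSpace ℝ (Fin 1)) (w : ℂ) => g ξ * Complex.exp (-(Complex.I * (ξ 0 : ℂ)) * w))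
    (fun ξ => ‖g ξ‖) h (by have := g.continuous; fun_prop)
    (Filter.Eventually.of_forall fun ξ w hw => by
      rw [hh.mem_spectrum_eq_re hw, norm_mul, Complex.norm_exp]
      simp) g.integrable.norm.2 hn
  have h1 : ∀ ξ : EuclideanSpace ℝ (Fin 1),
      cfc (fun w : ℂ => g ξ * Complex.exp (-(Complex.I * (ξ 0 : ℂ)) * w)) h =
        g ξ • NormedSpace.exp ((-(Complex.I * (ξ 0 : ℂ))) • h) := by
    intro ξ
    rw [cfc_const_mul (g ξ) (fun w : ℂ => Complex.exp (-(Complex.I * (ξ 0 : ℂ)) * w)) h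
      (by fun_prop), cfc_cexp_mul hh]
  simp only [h1] at key
  rw [← key]
  conv_rhs => rw [← cfc_id ℂ h]
  refine cfc_congr fun w hw => ?_
  have hw1 := hh.mem_spectrum_eq_re hw
  have hw2 := abs_lt.1 ((abs_re_le_of_mem_spectrum hw).trans_lt hhR)
  have := hg (fun _ => w.re) (fun _ => hw2)
  rw [id, hw1]
  refine Eq.trans ?_ this.symm
  refine MeasureTheory.integral_congr_ae (Filter.Eventually.of_forall fun ξ => ?_)
  simp only [Finset.univ_unique, Fin.default_eq_zero, Finset.sum_singleton]
  ring_nf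

theorem isExpFamily_single (g : 𝓢(EuclideanSpace ℝ (Fin 1), ℂ)) (i : Fin 3) :
    IsExpFamily MeasureTheory.volume g
      fun ξ => (Pi.single i (-(Complex.I * (ξ 0 : ℂ))) : Fin 3 → ℂ) := by
  refine ⟨g.integrable, ?_, 0, fun ξ k => ?_⟩
  · refine (measurable_pi_iff.2 fun k => ?_)
    by_cases hk : k = i
    · subst hk; simp only [Pi.single_eq_same]; fun_prop
    · simp only [Pi.single_eq_of_ne hk]; fun_prop
  · by_cases hk : k = i
    · subst hk; simp
    · simp [Pi.single_eq_of_ne hk]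

theorem expSymbol_single {g : 𝓢(EuclideanSpace ℝ (Fin 1), ℂ)}
    (hg : IsFourierDensityOn (Set.Ioo (-R) R) (fun x => (x 0 : ℂ)) g) (i : Fin 3)
    {x : Fin 3 → ℝ} (hx : ∀ i, |x i| < R) :
    expSymbol MeasureTheory.volume g
      (fun ξ => (Pi.single i (-(Complex.I * (ξ 0 : ℂ))) : Fin 3 → ℂ)) x = x i := by
  refine Eq.trans ?_ (hg (fun _ => x i) (fun _ => abs_lt.1 (hx i))).symm
  refine MeasureTheory.integral_congr_ae (Filter.Eventually.of_forall fun ξ => ?_)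
  simp only [Pi.single_apply, ite_mul, zero_mul, Finset.sum_ite_eq', Finset.mem_univ, if_true,
    Finset.univ_unique, Fin.default_eq_zero, Finset.sum_singleton]
  ring_nf

/-- The identity function has a Fourier density near the spectrum, by which multiplication by `h`
becomes a superposition of multiplications by exponentials. -/
theorem exists_generator_density (R : ℝ) : ∃ g : 𝓢(EuclideanSpace ℝ (Fin 1), ℂ),
    IsFourierDensityOn (Set.Ioo (-R) R) (fun x => (x 0 : ℂ)) g :=
  exists_isFourierDensityOn (Complex.ofRealCLM.contDiff.comp (contDiff_apply ℝ ℝ 0))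
    (Metric.isBounded_Ioo _ _)

theorem integrable_density_smul_exp (hh : IsSelfAdjoint h) (g : 𝓢(EuclideanSpace ℝ (Fin 1), ℂ)) :
    MeasureTheory.Integrable fun ξ =>
      g ξ • NormedSpace.exp ((-(Complex.I * (ξ 0 : ℂ))) • h) := by
  refine ((isExpFamily_single g 0).integrable_word hh 1 1).congr
    (Filter.Eventually.of_forall fun ξ => ?_)
  simp [expWord, NormedSpace.exp_zero]

/-- Left multiplication by `h` multiplies the symbol by the outer left variable. -/
theorem HasSymbol.self_mul (H : HasSymbol R h ρ σ F b) (hh : IsSelfAdjoint h) (hhR : ‖h‖ < R) :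
    HasSymbol R h ρ σ (fun x => x 0 * F x) (h * b) := by
  obtain ⟨g, hg⟩ := exists_generator_density R
  obtain ⟨Ω, _, μ, _, c, z, hz, hF, rfl⟩ := H
  have hD := isExpFamily_single g 0
  convert hasSymbol_prod (h := h) (ρ := ρ) (σ := σ) hz hD hF
    (fun x h1 _ => expSymbol_single hg 0 h1) using 1
  rw [MeasureTheory.integral_prod_symm _ ((hz.prod hD).integrable_word hh ρ σ)]
  conv_lhs => enter [1]; rw [← integral_density_smul_exp hh hhR hg]
  rw [← integral_mul_const_of_integrable (integrable_density_smul_exp hh g)]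
  refine MeasureTheory.integral_congr_ae (Filter.Eventually.of_forall fun ξ => ?_)
  dsimp only
  refine Eq.trans ((ContinuousLinearMap.mul ℂ B
    (g ξ • NormedSpace.exp ((-(Complex.I * (ξ 0 : ℂ))) • h))).integral_comp_comm
      (hz.integrable_word hh ρ σ)).symm ?_
  refine MeasureTheory.integral_congr_ae (Filter.Eventually.of_forall fun o => ?_)
  have e0 : ∀ w, (z o + (Pi.single 0 w : Fin 3 → ℂ)) 0 = w + z o 0 := fun w => by simp [add_comm]
  have e1 : ∀ w, (z o + (Pi.single 0 w : Fin 3 → ℂ)) 1 = z o 1 := fun w => by simp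
  have e2 : ∀ w, (z o + (Pi.single 0 w : Fin 3 → ℂ)) 2 = z o 2 := fun w => by simp
  simp only [expWord, e0, e1, e2, exp_add_smul]
  simp [mul_assoc, smul_smul]

/-- Right multiplication by `h` of words `exp (z₀ h) ρ exp (z₁ h)` multiplies the symbol by the
right variable. -/
theorem HasSymbol.mul_self (H : HasSymbol R h ρ 1 F b) (hh : IsSelfAdjoint h) (hhR : ‖h‖ < R) :
    HasSymbol R h ρ 1 (fun x => x 1 * F x) (b * h) := by
  obtain ⟨g, hg⟩ := exists_generator_density R
  obtain ⟨Ω, _, μ, _, c, z, hz, hF, rfl⟩ := H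
  have hD := isExpFamily_single g 1
  convert hasSymbol_prod (h := h) (ρ := ρ) (σ := 1) hz hD hF
    (fun x h1 _ => expSymbol_single hg 1 h1) using 1
  rw [MeasureTheory.integral_prod_symm _ ((hz.prod hD).integrable_word hh ρ 1)]
  conv_lhs => enter [2]; rw [← integral_density_smul_exp hh hhR hg]
  rw [← integral_const_mul_of_integrable (integrable_density_smul_exp hh g)]
  refine MeasureTheory.integral_congr_ae (Filter.Eventually.of_forall fun ξ => ?_)
  dsimp only
  refine Eq.trans (((ContinuousLinearMap.mul ℂ B).flip
    (g ξ • NormedSpace.exp ((-(Complex.I * (ξ 0 : ℂ))) • h))).integral_comp_comm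
      (hz.integrable_word hh ρ 1)).symm ?_
  refine MeasureTheory.integral_congr_ae (Filter.Eventually.of_forall fun o => ?_)
  have e0 : ∀ w, (z o + (Pi.single 1 w : Fin 3 → ℂ)) 0 = z o 0 := fun w => by simp
  have e1 : ∀ w, (z o + (Pi.single 1 w : Fin 3 → ℂ)) 1 = z o 1 + w := fun w => by simp
  have e2 : ∀ w, (z o + (Pi.single 1 w : Fin 3 → ℂ)) 2 = z o 2 := fun w => by simp
  -- The exponentials of multiples of `h` commute.
  have hc : ∀ w v : ℂ, NormedSpace.exp (v • h) * NormedSpace.exp (w • h) =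
      NormedSpace.exp (w • h) * NormedSpace.exp (v • h) := fun w v => by
    rw [← exp_add_smul, add_comm, exp_add_smul]
  simp only [expWord, e0, e1, e2, exp_add_smul]
  simp [-neg_smul, mul_assoc, smul_smul, hc (-(Complex.I * (ξ 0 : ℂ))) (z o 2)]

theorem hasSymbol_one (R : ℝ) (h ρ σ : B) : HasSymbol R h ρ σ (fun _ => 1) (ρ * σ) := by
  refine ⟨Unit, _, MeasureTheory.Measure.dirac (), inferInstance, fun _ => 1, fun _ => 0,
    ⟨MeasureTheory.integrable_const _, measurable_const, 0, by simp⟩, fun x _ _ => ?_, ?_⟩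
  · simp [expSymbol]
  · simp [expWord, NormedSpace.exp_zero]

end Generator

/-! ### The modular functional calculus -/

section Representation

variable {A : Type u} [Ring A] [StarRing A] [Algebra ℂ A] [StarModule ℂ A] [UniformSpace A]
  [IsUniformAddGroup A] [CompleteSpace A] [IsTopologicalRing A] {p : ℕ → Seminorm ℂ A}

/-- A continuous algebra homomorphism, as a continuous linear map. -/
def homCLM {A E : Type*} [Ring A] [Algebra ℂ A] [TopologicalSpace A] [Ring E] [Algebra ℂ E]
    [TopologicalSpace E] (π : A →ₐ[ℂ] E) (hπ : Continuous π) : A →L[ℂ] E := ⟨π.toLinearMap, hπ⟩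

@[simp]
theorem homCLM_apply {A E : Type*} [Ring A] [Algebra ℂ A] [TopologicalSpace A] [Ring E]
    [Algebra ℂ E] [TopologicalSpace E] (π : A →ₐ[ℂ] E) (hπ : Continuous π) (a : A) :
    homCLM π hπ a = π a := rfl

/-- An isometric representation of `A` with the norm `p 0` in a C*-algebra. -/
structure IsCStarRep (p : ℕ → Seminorm ℂ A) {B : Type*} [CStarAlgebra B] (π : A →ₐ[ℂ] B) :
    Prop where
  continuous : Continuous π
  map_star : ∀ a, π (star a) = star (π a)
  norm_eq : ∀ a, ‖π a‖ = p 0 a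

omit [IsUniformAddGroup A] [CompleteSpace A] in
theorem IsSmoothFamily.exists_rep (hp : IsSmoothFamily p) :
    ∃ (B : Type u) (_ : CStarAlgebra B) (π : A →ₐ[ℂ] B), IsCStarRep p π := by
  obtain ⟨B, _, π, hπ⟩ := exists_cstar_completion (p 0) (hp.mul_le 0) hp.star_mul
  refine ⟨B, _, (π : A →ₐ[ℂ] B), ?_, fun a => StarHomClass.map_star π a, hπ⟩
  refine continuous_of_continuousAt_zero (π : A →ₐ[ℂ] B) ?_
  rw [ContinuousAt, map_zero, tendsto_zero_iff_norm_tendsto_zero]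
  have := (hp.continuous_seminorm 0).tendsto 0
  rw [map_zero] at this
  exact this.congr fun a => (hπ a).symm

variable {B : Type*} [CStarAlgebra B] {π : A →ₐ[ℂ] B} (hp : IsSmoothFamily p)
  (hπ : IsCStarRep p π)

include hp hπ

omit [StarModule ℂ A] [IsUniformAddGroup A] [CompleteSpace A] in
theorem IsCStarRep.injective : Function.Injective π := by
  refine (injective_iff_map_eq_zero π).2 fun a ha => hp.eq_zero a ?_
  rw [← hπ.norm_eq, ha, norm_zero]

omit [StarModule ℂ A] [IsUniformAddGroup A] [CompleteSpace A] hp in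
omit [IsTopologicalRing A] in
theorem IsCStarRep.isSelfAdjoint {h : A} (hh : IsSelfAdjoint h) : IsSelfAdjoint (π h) := by
  rw [IsSelfAdjoint, ← hπ.map_star, hh.star_eq]

omit [StarModule ℂ A] in
theorem IsCStarRep.map_expWord (h ρ σ : A) (z : Fin 3 → ℂ) :
    π (expWord h z ρ σ) = expWord (π h) z (π ρ) (π σ) := by
  simp only [expWord, map_mul, hp.map_exp hπ.continuous, map_smul]

omit [StarModule ℂ A] in
/-- A weak integral of exponential words has the Laplace integral of the exponents as its
symbol. -/
theorem HasWeakIntegralOn.hasSymbol {h ρ σ b : A} (hh : IsSelfAdjoint h) {Ω : Type}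
    [MeasurableSpace Ω] {μ : MeasureTheory.Measure Ω} [MeasureTheory.SFinite μ] {c : Ω → ℂ}
    {z : Ω → Fin 3 → ℂ} (H : IsExpFamily μ c z)
    (hb : HasWeakIntegralOn μ (fun o => c o • expWord h (z o) ρ σ) b) (R : ℝ) :
    HasSymbol R (π h) (π ρ) (π σ) (expSymbol μ c z) (π b) := by
  refine ⟨Ω, _, μ, ‹_›, c, z, H, fun x _ _ => rfl, ?_⟩
  have e : ∀ o, homCLM π hπ.continuous (c o • expWord h (z o) ρ σ) =
      c o • expWord (π h) (z o) (π ρ) (π σ) := fun o => by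
    rw [homCLM_apply, map_smul, hπ.map_expWord hp]
  have := hb.integral_eq (homCLM π hπ.continuous)
    (by simpa only [e] using H.integrable_word (hπ.isSelfAdjoint hh) (π ρ) (π σ))
  simp only [e] at this
  exact this

end Representation

section Flow

variable {A : Type u} [Ring A] [StarRing A] [Algebra ℂ A] [StarModule ℂ A] [UniformSpace A]
  [IsUniformAddGroup A] [CompleteSpace A] [IsTopologicalRing A] {p : ℕ → Seminorm ℂ A}

theorem IsSmoothFamily.polyGrowth_partialModularFlow (hp : IsSmoothFamily p) {n : ℕ} {h : A}
    (hh : IsSelfAdjoint h) (ρ : Fin n → A) :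
    PolyGrowth p (fun ξ : EuclideanSpace ℝ (Fin n) => ‖ξ‖)
      fun ξ => partialModularFlow h ξ ρ := by
  have key : ∀ l, PolyGrowth p (fun ξ : EuclideanSpace ℝ (Fin n) => ‖ξ‖)
      fun ξ => modularFlow h (ξ l) (ρ l) := by
    intro l
    have hle : ∀ ξ : EuclideanSpace ℝ (Fin n), |ξ l| ≤ |‖ξ‖| := fun ξ => by
      rw [abs_norm]; exact PiLp.norm_apply_le ξ l
    refine ((hp.polyGrowth_exp (X := 0) (fun _ => hh) ?_ (fun m => ⟨p m h, fun _ => le_rfl⟩) ?_).mul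
      hp.toIsFrechetFamily (polyGrowth_const (ρ l))).mul hp.toIsFrechetFamily
      (hp.polyGrowth_exp (X := 0) (fun _ => hh) ?_ (fun m => ⟨p m h, fun _ => le_rfl⟩) ?_)
    · simp
    · simpa using hle
    · simp
    · simpa using hle
  simp only [partialModularFlow, List.ofFn_eq_map]
  generalize List.finRange n = L
  induction L with
  | nil => simpa using polyGrowth_const (1 : A)
  | cons l L ih =>
    simp only [List.map_cons, List.prod_cons]
    exact (key l).mul hp.toIsFrechetFamily ih

omit [StarRing A] [StarModule ℂ A] in
theorem IsFrechetFamily.continuous_partialModularFlow (hp : IsFrechetFamily p) {n : ℕ} (h : A)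
    (ρ : Fin n → A) :
    Continuous fun ξ : EuclideanSpace ℝ (Fin n) => partialModularFlow h ξ ρ := by
  have := hp.continuousSMul
  have := hp.continuous_exp
  simp only [partialModularFlow, List.ofFn_eq_map, modularFlow]
  exact continuous_list_prod _ fun l _ => by fun_prop

theorem IsSmoothFamily.exists_hasWeakIntegral_flow (hp : IsSmoothFamily p) {n : ℕ} {h : A}
    (hh : IsSelfAdjoint h) (ρ : Fin n → A) (g : 𝓢(EuclideanSpace ℝ (Fin n), ℂ)) :
    ∃ b, HasWeakIntegral (fun ξ => g ξ • partialModularFlow h ξ ρ) b :=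
  (isDominated_schwartz hp.toIsFrechetFamily g
    (hp.continuous_partialModularFlow h ρ)
    (hp.polyGrowth_partialModularFlow hh ρ)).exists_weakIntegral hp.toIsFrechetFamily

omit [StarRing A] [StarModule ℂ A] [IsUniformAddGroup A] [CompleteSpace A] in
theorem partialModularFlow_one (h : A) (ρ : Fin 1 → A)
    (ξ : EuclideanSpace ℝ (Fin 1)) :
    partialModularFlow h ξ ρ =
      expWord h ![Complex.I * ξ 0, -(Complex.I * ξ 0), 0] (ρ 0) 1 := by
  simp [partialModularFlow, expWord, modularFlow, NormedSpace.exp_zero]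

omit [StarRing A] [StarModule ℂ A] in
theorem IsFrechetFamily.partialModularFlow_two (hp : IsFrechetFamily p) (h : A) (ρ : Fin 2 → A)
    (ξ : EuclideanSpace ℝ (Fin 2)) :
    partialModularFlow h ξ ρ =
      expWord h ![Complex.I * ξ 0, -(Complex.I * ξ 0) + Complex.I * ξ 1, -(Complex.I * ξ 1)]
        (ρ 0) (ρ 1) := by
  simp [-neg_smul, partialModularFlow, expWord, modularFlow, hp.exp_add_smul, mul_assoc]

theorem isExpFamily_flow_one (g : 𝓢(EuclideanSpace ℝ (Fin 1), ℂ)) :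
    IsExpFamily MeasureTheory.volume g
      fun ξ => ![Complex.I * ξ 0, -(Complex.I * ξ 0), 0] := by
  refine ⟨g.integrable, ?_, 0, fun ξ k => ?_⟩
  · refine measurable_pi_iff.2 fun k => ?_
    fin_cases k <;> simp <;> fun_prop
  · fin_cases k <;> simp

theorem isExpFamily_flow_two (g : 𝓢(EuclideanSpace ℝ (Fin 2), ℂ)) :
    IsExpFamily MeasureTheory.volume g
      fun ξ => ![Complex.I * ξ 0, -(Complex.I * ξ 0) + Complex.I * ξ 1, -(Complex.I * ξ 1)] := by
  refine ⟨g.integrable, ?_, 0, fun ξ k => ?_⟩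
  · refine measurable_pi_iff.2 fun k => ?_
    fin_cases k <;> simp <;> fun_prop
  · fin_cases k <;> simp

theorem IsFourierDensityOn.expSymbol_one {R : ℝ} {F : (Fin 1 → ℝ) → ℂ}
    {g : 𝓢(EuclideanSpace ℝ (Fin 1), ℂ)}
    (hg : IsFourierDensityOn (Set.Ioo (-(2 * R)) (2 * R)) F g) {x : Fin 3 → ℝ}
    (hx : ∀ i, |x i| < R) :
    expSymbol MeasureTheory.volume g
      (fun ξ => ![Complex.I * ξ 0, -(Complex.I * ξ 0), 0]) x = F ![x 1 - x 0] := by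
  have h0 := abs_lt.1 (hx 0)
  have h1 := abs_lt.1 (hx 1)
  rw [hg ![x 1 - x 0] (fun l => by
    fin_cases l; simp only [Set.mem_Ioo]; constructor <;> simp <;> linarith)]
  refine MeasureTheory.integral_congr_ae (Filter.Eventually.of_forall fun ξ => ?_)
  refine congrArg (fun t => g ξ * Complex.exp t) ?_
  simp [Fin.sum_univ_succ]
  ring

theorem IsFourierDensityOn.expSymbol_two {R : ℝ} {F : (Fin 2 → ℝ) → ℂ}
    {g : 𝓢(EuclideanSpace ℝ (Fin 2), ℂ)}
    (hg : IsFourierDensityOn (Set.Ioo (-(2 * R)) (2 * R)) F g) {x : Fin 3 → ℝ}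
    (hx : ∀ i, |x i| < R) :
    expSymbol MeasureTheory.volume g
      (fun ξ => ![Complex.I * ξ 0, -(Complex.I * ξ 0) + Complex.I * ξ 1, -(Complex.I * ξ 1)]) x =
      F ![x 1 - x 0, x 2 - x 1] := by
  have h0 := abs_lt.1 (hx 0)
  have h1 := abs_lt.1 (hx 1)
  have h2 := abs_lt.1 (hx 2)
  rw [hg ![x 1 - x 0, x 2 - x 1] (fun l => by
    fin_cases l <;> simp only [Set.mem_Ioo] <;> constructor <;> simp <;> linarith)]
  refine MeasureTheory.integral_congr_ae (Filter.Eventually.of_forall fun ξ => ?_)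
  refine congrArg (fun t => g ξ * Complex.exp t) ?_
  simp [Fin.sum_univ_succ]
  ring

variable {B : Type*} [CStarAlgebra B] {π : A →ₐ[ℂ] B} {R : ℝ} {h b : A}

omit [StarModule ℂ A] in
theorem IsCStarRep.hasSymbol_one (hp : IsSmoothFamily p) (hπ : IsCStarRep p π)
    (hh : IsSelfAdjoint h) {ρ : Fin 1 → A} {F : (Fin 1 → ℝ) → ℂ}
    {g : 𝓢(EuclideanSpace ℝ (Fin 1), ℂ)}
    (hg : IsFourierDensityOn (Set.Ioo (-(2 * R)) (2 * R)) F g)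
    (hb : HasWeakIntegral (fun ξ => g ξ • partialModularFlow h ξ ρ) b) :
    HasSymbol R (π h) (π (ρ 0)) 1 (fun x => F ![x 1 - x 0]) (π b) := by
  simp only [partialModularFlow_one] at hb
  have := HasWeakIntegralOn.hasSymbol hp hπ hh (isExpFamily_flow_one g) hb R
  rw [map_one] at this
  exact this.congr fun x hx _ => hg.expSymbol_one hx

omit [StarModule ℂ A] in
theorem IsCStarRep.hasSymbol_two (hp : IsSmoothFamily p) (hπ : IsCStarRep p π)
    (hh : IsSelfAdjoint h) {ρ : Fin 2 → A} {F : (Fin 2 → ℝ) → ℂ}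
    {g : 𝓢(EuclideanSpace ℝ (Fin 2), ℂ)}
    (hg : IsFourierDensityOn (Set.Ioo (-(2 * R)) (2 * R)) F g)
    (hb : HasWeakIntegral (fun ξ => g ξ • partialModularFlow h ξ ρ) b) :
    HasSymbol R (π h) (π (ρ 0)) (π (ρ 1)) (fun x => F ![x 1 - x 0, x 2 - x 1]) (π b) := by
  simp only [hp.partialModularFlow_two] at hb
  have := HasWeakIntegralOn.hasSymbol hp hπ hh (isExpFamily_flow_two g) hb R
  exact this.congr fun x hx _ => hg.expSymbol_two hx

end Flow

/-! ### The spectrum of the modular derivation -/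

section Spectrum

theorem HasSymbol.smul {B : Type*} [CStarAlgebra B] {R : ℝ} {h ρ σ : B} {F : (Fin 3 → ℝ) → ℂ}
    {b : B} (t : ℂ) (H : HasSymbol R h ρ σ F b) :
    HasSymbol R h ρ σ (fun x => t * F x) (t • b) := by
  obtain ⟨Ω, _, μ, _, c, z, hz, hF, rfl⟩ := H
  refine ⟨Ω, _, μ, ‹_›, fun o => t * c o, z, ⟨hz.integrable.const_mul t, hz.measurable, hz.bounded⟩,
    fun x h1 h2 => ?_, ?_⟩
  · dsimp only
    rw [← hF x h1 h2, expSymbol, expSymbol, ← MeasureTheory.integral_const_mul]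
    simp only [mul_assoc]
  · rw [← MeasureTheory.integral_smul]
    simp only [smul_smul]

/-- For `t` off the real interval `(-r, r)`, the function `1 / (t - ·)` agrees on smaller intervals
with a smooth function. -/
theorem exists_smooth_resolvent {r₀ r : ℝ} (h0 : 0 < r₀) (h1 : r₀ < r) {t : ℂ}
    (ht : t ∉ (fun s : ℝ => (s : ℂ)) '' Set.Ioo (-r) r) :
    ∃ ψ : ℝ → ℂ, ContDiff ℝ ∞ ψ ∧ ∀ s ∈ Set.Ioo (-r₀) r₀, (t - s) * ψ s = 1 := by
  let χ : ContDiffBump (0 : ℝ) := ⟨r₀, (r₀ + r) / 2, h0, by linarith⟩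
  have hne : ∀ s ∈ Set.Ioo (-r) r, t - s ≠ 0 := fun s hs he =>
    ht ⟨s, hs, (sub_eq_zero.1 he).symm⟩
  refine ⟨fun s => (χ s : ℂ) * (t - s)⁻¹, contDiff_iff_contDiffAt.2 fun s => ?_, fun s hs => ?_⟩
  · by_cases hs : s ∈ Set.Ioo (-r) r
    · exact (Complex.ofRealCLM.contDiff.contDiffAt.comp s χ.contDiffAt).mul
        ((contDiffAt_const.sub Complex.ofRealCLM.contDiff.contDiffAt).inv (hne s hs))
    · have hs' : s ∈ (Metric.closedBall (0 : ℝ) ((r₀ + r) / 2))ᶜ := by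
        rw [Set.mem_compl_iff, Metric.mem_closedBall, Real.dist_0_eq_abs, not_le]
        rw [Set.mem_Ioo, ← abs_lt, not_lt] at hs
        linarith
      refine (contDiffAt_const (c := (0 : ℂ))).congr_of_eventuallyEq ?_
      filter_upwards [Metric.isClosed_closedBall.isOpen_compl.mem_nhds hs'] with y hy
      have : χ y = 0 := χ.zero_of_le_dist (by
        rw [Set.mem_compl_iff, Metric.mem_closedBall, not_le] at hy; exact hy.le)
      simp [this]
  · have : χ s = 1 := χ.one_of_mem_closedBall (by
      rw [Metric.mem_closedBall, Real.dist_0_eq_abs]; exact (abs_lt.2 hs).le)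
    simp only [this, Complex.ofReal_one, one_mul]
    exact mul_inv_cancel₀ (hne s ⟨by linarith [hs.1], by linarith [hs.2]⟩)

variable {A : Type u} [Ring A] [StarRing A] [Algebra ℂ A] [StarModule ℂ A] [UniformSpace A]
  [IsUniformAddGroup A] [CompleteSpace A] [IsTopologicalRing A] {p : ℕ → Seminorm ℂ A}

/-- The spectrum is taken in the algebra of all linear endomorphisms of `A`. The resolvent at `t`
is the weak integral of the flow against a Fourier density of `1 / (t - ·)`: that this is a right
inverse is a comparison of symbols, and it is injective because the flow commutes with the
derivation. -/
theorem IsSmoothFamily.spectrum_modularDerivation_subset (hp : IsSmoothFamily p) {h : A}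
    (hh : IsSelfAdjoint h) {R : ℝ} (hR : p 0 h < R) :
    spectrum ℂ (modularDerivation h) ⊆ (fun t : ℝ => (t : ℂ)) '' Set.Ioo (-(2 * R)) (2 * R) := by
  intro t ht
  by_contra hn
  refine ht ((Module.End.isUnit_iff _).2 ?_)
  have hp0 := apply_nonneg (p 0) h
  obtain ⟨R₀, h1, h2⟩ := exists_between hR
  obtain ⟨ψ, hψ, hψ'⟩ := exists_smooth_resolvent (r₀ := 2 * R₀) (by linarith) (by linarith) hn
  obtain ⟨g, hg⟩ := exists_isFourierDensityOn (F := fun x : Fin 1 → ℝ => ψ (x 0))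
    (hψ.comp (contDiff_apply ℝ ℝ 0)) (Metric.isBounded_Ioo (-(2 * R₀)) (2 * R₀))
  obtain ⟨B, _, π, hπ⟩ := hp.exists_rep
  have hπh := hπ.isSelfAdjoint hh
  have hlt : ‖π h‖ < R₀ := by rwa [hπ.norm_eq]
  have hT : ∀ ρ : A, (algebraMap ℂ (Module.End ℂ A) t - modularDerivation h) ρ =
      t • ρ - (ρ * h - h * ρ) := fun ρ => by
    simp [modularDerivation, Module.algebraMap_end_apply]
  -- The integral of the flow against the density of `1 / (t - ·)` is a right inverse.
  have key : ∀ ρ d : A, HasWeakIntegral (fun ξ => g ξ • partialModularFlow h ξ ![ρ]) d →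
      t • d - (d * h - h * d) = ρ := by
    intro ρ d hd
    refine hπ.injective hp ?_
    have H := hπ.hasSymbol_one hp hh hg hd
    have H' := (H.smul t).sub hπh ((H.mul_self hπh hlt).sub hπh (H.self_mul hπh hlt))
    simp only [map_sub, map_smul, map_mul]
    have H1 := hasSymbol_one R₀ (π h) (π ρ) 1
    rw [mul_one] at H1
    refine H'.unique hπh hlt H1 fun x hx _ => ?_
    have a0 := abs_lt.1 (hx 0)
    have a1 := abs_lt.1 (hx 1)
    refine Eq.trans ?_ (hψ' (x 1 - x 0) ⟨by linarith, by linarith⟩)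
    simp
    ring
  constructor
  · refine (injective_iff_map_eq_zero _).2 fun ρ hρ => ?_
    obtain ⟨d, hd⟩ := hp.exists_hasWeakIntegral_flow hh ![ρ] g
    have hk := key ρ d hd
    have := hp.continuousSMul
    have := hp.t2Space
    rw [hT] at hρ
    let T : A →L[ℂ] A := ⟨algebraMap ℂ (Module.End ℂ A) t - modularDerivation h, by
      change Continuous fun ρ => (algebraMap ℂ (Module.End ℂ A) t - modularDerivation h) ρ
      simp only [hT]
      fun_prop⟩
    have hTa : ∀ a, T a = t • a - (a * h - h * a) := hT
    have h3 := HasWeakIntegralOn.map hd T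
    have h4 : ∀ ξ : EuclideanSpace ℝ (Fin 1), T (g ξ • partialModularFlow h ξ ![ρ]) = 0 := by
      intro ξ
      have c1 : ∀ z : ℂ, h * NormedSpace.exp (z • h) = NormedSpace.exp (z • h) * h := fun z =>
        ((Commute.refl h).smul_right z).exp_right
      have e : T (partialModularFlow h ξ ![ρ]) =
          partialModularFlow h ξ ![t • ρ - (ρ * h - h * ρ)] := by
        rw [hTa]
        simp only [partialModularFlow, modularFlow, List.ofFn_succ, List.ofFn_zero,
          List.prod_cons, List.prod_nil, mul_one, Matrix.cons_val_zero]
        have c2 := c1 (Complex.I * (ξ 0 : ℂ))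
        have c3 := c1 (-(Complex.I * (ξ 0 : ℂ)))
        generalize NormedSpace.exp ((Complex.I * (ξ 0 : ℂ)) • h) = u at c2 ⊢
        generalize NormedSpace.exp ((-(Complex.I * (ξ 0 : ℂ))) • h) = v at c3 ⊢
        have e1 : u * ρ * v * h = u * (ρ * h) * v := by rw [mul_assoc _ v h, ← c3]; noncomm_ring
        have e2 : h * (u * ρ * v) = u * (h * ρ) * v := by rw [← mul_assoc u h, ← c2]; noncomm_ring
        rw [e1, e2]
        simp only [mul_sub, sub_mul, mul_smul_comm, smul_mul_assoc]
      rw [map_smul, e, hρ]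
      simp [partialModularFlow, modularFlow]
    simp only [h4] at h3
    have h5 : HasWeakIntegralOn MeasureTheory.volume
        (fun _ : EuclideanSpace ℝ (Fin 1) => (0 : A)) 0 := fun l => by simp
    have h6 := h3.unique hp.toIsFrechetFamily h5
    rw [← hk, ← hTa, h6]
  · intro ρ
    obtain ⟨d, hd⟩ := hp.exists_hasWeakIntegral_flow hh ![ρ] g
    exact ⟨d, (hT d).trans (key ρ d hd)⟩

end Spectrum

/-! ### The calculus is well defined -/

section WellDefined

variable {A : Type u} [Ring A] [StarRing A] [Algebra ℂ A] [StarModule ℂ A] [UniformSpace A]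
  [IsUniformAddGroup A] [CompleteSpace A] [IsTopologicalRing A] {p : ℕ → Seminorm ℂ A}

/-- Integrals of the flow in `n` variables depend only on the values which the Fourier transforms
of their densities take near the spectrum. -/
def IsDensityIndependent (p : ℕ → Seminorm ℂ A) (n : ℕ) : Prop :=
  ∀ h : A, IsSelfAdjoint h → ∀ R, p 0 h < R → ∀ (ρ : Fin n → A) (F : (Fin n → ℝ) → ℂ)
    (g g' : 𝓢(EuclideanSpace ℝ (Fin n), ℂ)) (b b' : A),
    IsFourierDensityOn (Set.Ioo (-(2 * R)) (2 * R)) F g →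
    IsFourierDensityOn (Set.Ioo (-(2 * R)) (2 * R)) F g' →
    HasWeakIntegral (fun ξ => g ξ • partialModularFlow h ξ ρ) b →
    HasWeakIntegral (fun ξ => g' ξ • partialModularFlow h ξ ρ) b' → b = b'

theorem IsSmoothFamily.isDensityIndependent_one (hp : IsSmoothFamily p) :
    IsDensityIndependent p 1 := by
  intro h hh R hR ρ F g g' b b' hg hg' hb hb'
  obtain ⟨B, _, π, hπ⟩ := hp.exists_rep
  exact hπ.injective hp ((hπ.hasSymbol_one hp hh hg hb).unique (hπ.isSelfAdjoint hh)
    (by rwa [hπ.norm_eq]) (hπ.hasSymbol_one hp hh hg' hb') fun _ _ _ => rfl)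

theorem IsSmoothFamily.isDensityIndependent_two (hp : IsSmoothFamily p) :
    IsDensityIndependent p 2 := by
  intro h hh R hR ρ F g g' b b' hg hg' hb hb'
  obtain ⟨B, _, π, hπ⟩ := hp.exists_rep
  exact hπ.injective hp ((hπ.hasSymbol_two hp hh hg hb).unique (hπ.isSelfAdjoint hh)
    (by rwa [hπ.norm_eq]) (hπ.hasSymbol_two hp hh hg' hb') fun _ _ _ => rfl)

variable {n : ℕ} {f : (Fin n → ℝ) → ℂ} {h : A} {R : ℝ}

theorem IsDensityIndependent.isModularCalculus (hp : IsSmoothFamily p)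
    (hn : IsDensityIndependent p n) (hf : IsLogSmooth f) (hh : IsSelfAdjoint h) (hR : p 0 h < R)
    {ρ : Fin n → A} {g : 𝓢(EuclideanSpace ℝ (Fin n), ℂ)}
    (hg : IsFourierDensityOn (Set.Ioo (-(2 * R)) (2 * R)) (fun x => f fun l => Real.exp (x l)) g)
    {b : A} (hb : HasWeakIntegral (fun ξ => g ξ • partialModularFlow h ξ ρ) b) :
    IsModularCalculus h f ρ b := by
  refine ⟨Set.Ioo (-(2 * R)) (2 * R), isOpen_Ioo, Metric.isBounded_Ioo _ _,
    hp.spectrum_modularDerivation_subset hh hR,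
    exists_isFourierDensityOn hf (Metric.isBounded_Ioo _ _), fun g' hg' => ?_⟩
  obtain ⟨b', hb'⟩ := hp.exists_hasWeakIntegral_flow hh ρ g'
  rwa [hn h hh R hR ρ _ g g' b b' hg hg' hb hb']

omit [StarModule ℂ A] in
omit [IsUniformAddGroup A] [CompleteSpace A] in
/-- Two values of the calculus, obtained from different sets `U`, agree: a density on the union
serves for both. -/
theorem IsModularCalculus.unique (hp : IsSmoothFamily p) (hf : IsLogSmooth f)
    {ρ : Fin n → A} {b b' : A} (hb : IsModularCalculus h f ρ b)
    (hb' : IsModularCalculus h f ρ b') : b = b' := by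
  obtain ⟨U, -, hU, -, -, H⟩ := hb
  obtain ⟨U', -, hU', -, -, H'⟩ := hb'
  obtain ⟨g, hg⟩ := exists_isFourierDensityOn hf (hU.union hU')
  exact HasWeakIntegralOn.unique hp.toIsFrechetFamily
    (H g fun x hx => hg x fun l => Or.inl (hx l)) (H' g fun x hx => hg x fun l => Or.inr (hx l))

theorem IsDensityIndependent.isSpectralFunction (hp : IsSmoothFamily p)
    (hn : IsDensityIndependent p n) (hf : IsLogSmooth f) : IsSpectralFunction A f := by
  intro h hh ρ
  obtain ⟨g, hg⟩ := exists_isFourierDensityOn hf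
    (Metric.isBounded_Ioo (-(2 * (p 0 h + 1))) (2 * (p 0 h + 1)))
  obtain ⟨b, hb⟩ := hp.exists_hasWeakIntegral_flow hh ρ g
  have H := hn.isModularCalculus hp hf hh (lt_add_one _) hg hb
  exact ⟨b, H, fun b' H' => H'.unique hp hf H⟩

theorem IsDensityIndependent.modularCalculus_eq (hp : IsSmoothFamily p)
    (hn : IsDensityIndependent p n) (hf : IsLogSmooth f) (hh : IsSelfAdjoint h) (hR : p 0 h < R)
    {ρ : Fin n → A} {g : 𝓢(EuclideanSpace ℝ (Fin n), ℂ)}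
    (hg : IsFourierDensityOn (Set.Ioo (-(2 * R)) (2 * R)) (fun x => f fun l => Real.exp (x l)) g)
    {b : A} (hb : HasWeakIntegral (fun ξ => g ξ • partialModularFlow h ξ ρ) b) :
    modularCalculus h f ρ = b := by
  have H := hn.isModularCalculus hp hf hh hR hg hb
  exact (Classical.epsilon_spec ⟨b, H⟩ : IsModularCalculus h f ρ _).unique hp hf H

end WellDefined

/-! ### Derivations and exponentials -/

section DerivationExp

variable {A : Type u} [Ring A] [Algebra ℂ A] [UniformSpace A] [IsUniformAddGroup A]
  [CompleteSpace A] [IsTopologicalRing A] {p : ℕ → Seminorm ℂ A}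

/-- Duhamel's formula for `δ (exp y)`, read in a Banach algebra `E` to which `A` is mapped. As `δ`
need not descend to `E`, the differentiation of `δ (exp (s y))` takes place in another Banach
algebra, through which the map to `E` after `δ` factors. -/
theorem IsFrechetFamily.map_derivation_exp (hp : IsFrechetFamily p) {δ : A →L[ℂ] A}
    (hδ : ∀ a b : A, δ (a * b) = δ a * b + a * δ b) {E : Type*} [NormedRing E] [NormedAlgebra ℂ E]
    [CompleteSpace E] {π : A →ₐ[ℂ] E} (hπ : Continuous π) (y : A) :
    π (δ (NormedSpace.exp y)) = ∫ s : unitInterval, NormedSpace.exp (((s : ℝ) : ℂ) • π y) *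
      π (δ y) * NormedSpace.exp ((1 - ((s : ℝ) : ℂ)) • π y) := by
  obtain ⟨D, _, _, _, π', S, hπ', hS⟩ := hp.exists_factor ((homCLM π hπ).comp δ)
  have hS' : ∀ a, π (δ a) = S (π' a) := hS
  have hexp := continuous_normedSpace_exp (E := E)
  rw [integral_unitInterval (fun s : ℝ => NormedSpace.exp ((s : ℂ) • π y) *
      π (δ y) * NormedSpace.exp ((1 - (s : ℂ)) • π y))]
  have hd : ∀ s : ℝ, HasDerivAt (fun s : ℝ => π (δ (NormedSpace.exp ((s : ℂ) • y))) *
      NormedSpace.exp ((1 - (s : ℂ)) • π y)) (NormedSpace.exp ((s : ℂ) • π y) * π (δ y) *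
      NormedSpace.exp ((1 - (s : ℂ)) • π y)) s := by
    intro s
    have h1 : HasDerivAt (fun s : ℝ => π (δ (NormedSpace.exp ((s : ℂ) • y))))
        (S (NormedSpace.exp ((s : ℂ) • π' y) * π' y)) s := by
      have h0 : HasDerivAt (fun s : ℝ => NormedSpace.exp ((s : ℂ) • π' y))
          (NormedSpace.exp ((s : ℂ) • π' y) * π' y) s := by
        simpa using! (hasDerivAt_exp_smul_const (π' y) (s : ℂ)).scomp s
          Complex.ofRealCLM.hasDerivAt
      refine ((S.restrictScalars ℝ).hasFDerivAt.comp_hasDerivAt s h0).congr_of_eventuallyEq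
        (Filter.Eventually.of_forall fun t => ?_)
      simp only [hS', hp.map_exp hπ', map_smul, Function.comp,
        ContinuousLinearMap.coe_restrictScalars']
    have h2 : HasDerivAt (fun s : ℝ => NormedSpace.exp ((1 - (s : ℂ)) • π y))
        (-(π y * NormedSpace.exp ((1 - (s : ℂ)) • π y))) s := by
      simpa using! (hasDerivAt_exp_smul_const' (π y) (1 - (s : ℂ))).scomp s
        (Complex.ofRealCLM.hasDerivAt.const_sub 1)
    have h3 : S (NormedSpace.exp ((s : ℂ) • π' y) * π' y) =
        π (δ (NormedSpace.exp ((s : ℂ) • y))) * π y +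
          NormedSpace.exp ((s : ℂ) • π y) * π (δ y) := by
      rw [← map_smul, ← hp.map_exp hπ', ← map_mul, ← hS', hδ, map_add, map_mul, map_mul,
        hp.map_exp hπ, map_smul]
    refine (h1.mul h2).congr_deriv ?_
    rw [h3]
    noncomm_ring
  have hδ1 : δ 1 = 0 := by simpa using hδ 1 1
  rw [intervalIntegral.integral_eq_sub_of_hasDerivAt (fun s _ => hd s)
    (Continuous.intervalIntegrable (by fun_prop) _ _)]
  simp [NormedSpace.exp_zero, hδ1]

end DerivationExp

/-! ### Exponents on the line -/

section Exponents

/-- An exponent `z` whose real part is bounded and whose imaginary part grows at most linearly. -/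
structure IsExponent (z : EuclideanSpace ℝ (Fin 1) → ℂ) : Prop where
  continuous : Continuous z
  re_le : ∃ M, ∀ ξ, |(z ξ).re| ≤ M
  im_le : ∀ ξ, |(z ξ).im| ≤ ‖ξ‖

theorem isExponent_const (t : ℝ) : IsExponent fun _ => (t : ℂ) :=
  ⟨continuous_const, ⟨|t|, by simp⟩, by simp⟩

theorem isExponent_right : IsExponent fun ξ => -(Complex.I * (ξ 0 : ℂ)) :=
  ⟨by fun_prop, ⟨0, by simp⟩, fun ξ => by simpa using PiLp.norm_apply_le ξ 0⟩

theorem isExponent_left (j : ℝ) : IsExponent fun ξ => (j : ℂ) + Complex.I * (ξ 0 : ℂ) :=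
  ⟨by fun_prop, ⟨|j|, by simp⟩, fun ξ => by simpa using PiLp.norm_apply_le ξ 0⟩

variable {z w : EuclideanSpace ℝ (Fin 1) → ℂ}

theorem IsExponent.norm_le (hz : IsExponent z) : ∃ K, 0 ≤ K ∧ ∀ ξ, ‖z ξ‖ ≤ K * (1 + ‖ξ‖) := by
  obtain ⟨M, hM⟩ := hz.re_le
  refine ⟨|M| + 1, by positivity, fun ξ => (Complex.norm_le_abs_re_add_abs_im _).trans ?_⟩
  have h1 := (hM ξ).trans (le_abs_self M)
  nlinarith [hz.im_le ξ, norm_nonneg ξ, abs_nonneg M]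

variable {A : Type u} [Ring A] [StarRing A] [Algebra ℂ A] [StarModule ℂ A] [UniformSpace A]
  [IsUniformAddGroup A] [CompleteSpace A] [IsTopologicalRing A] {p : ℕ → Seminorm ℂ A}
  {h a ρ σ : A}

theorem IsExponent.polyGrowth_exp_perturbed (hz : IsExponent z) (hp : IsSmoothFamily p)
    (hh : IsSelfAdjoint h) (ha : IsSelfAdjoint a) {ι : Type*} {t ε : ι → ℝ}
    (ht : ∀ i, |t i| ≤ 1) (hε : ∀ i, |ε i| ≤ 1) (ξ : ι → EuclideanSpace ℝ (Fin 1)) :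
    PolyGrowth p (fun i => ‖ξ i‖)
      fun i => NormedSpace.exp (((t i : ℂ) * z (ξ i)) • (h + (ε i : ℂ) • a)) := by
  obtain ⟨M, hM⟩ := hz.re_le
  refine hp.polyGrowth_exp (X := M) (fun i => hh.add (isSelfAdjoint_real_smul ha _)) (fun i => ?_)
    (fun m => ⟨p m h + p m a, fun i => (map_add_le_add _ _ _).trans (add_le_add le_rfl ?_)⟩)
    (fun i => ?_)
  · rw [Complex.re_ofReal_mul, abs_mul]
    exact (mul_le_of_le_one_left (abs_nonneg _) (ht i)).trans (hM _)
  · rw [map_smul_eq_mul, Complex.norm_real]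
    exact mul_le_of_le_one_left (apply_nonneg _ _) (hε i)
  · rw [Complex.im_ofReal_mul, abs_mul, abs_norm]
    exact (mul_le_of_le_one_left (abs_nonneg _) (ht i)).trans (hz.im_le _)

theorem IsExponent.polyGrowth_exp (hz : IsExponent z) (hp : IsSmoothFamily p)
    (hh : IsSelfAdjoint h) {ι : Type*} {t : ι → ℝ}
    (ht : ∀ i, |t i| ≤ 1) (ξ : ι → EuclideanSpace ℝ (Fin 1)) :
    PolyGrowth p (fun i => ‖ξ i‖) fun i => NormedSpace.exp (((t i : ℂ) * z (ξ i)) • h) := by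
  simpa using hz.polyGrowth_exp_perturbed hp hh hh ht (ε := fun _ => 0) (by simp) ξ

theorem IsExponent.polyGrowth_exp' (hz : IsExponent z) (hp : IsSmoothFamily p)
    (hh : IsSelfAdjoint h) {ι : Type*} (ξ : ι → EuclideanSpace ℝ (Fin 1)) :
    PolyGrowth p (fun i => ‖ξ i‖) fun i => NormedSpace.exp (z (ξ i) • h) := by
  simpa using hz.polyGrowth_exp hp hh (t := fun _ => 1) (by simp) ξ

/-- The weak integrals `∫∫ g(ξ) z(ξ) e^{(1-s)zh} ρ e^{wh} ρ e^{szh} ds dξ` which arise from varying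
`exp (z h)` exist. -/
theorem IsExponent.exists_splitIntegral (hz : IsExponent z) (hw : IsExponent w)
    (hp : IsSmoothFamily p) (hh : IsSelfAdjoint h) (g : 𝓢(EuclideanSpace ℝ (Fin 1), ℂ))
    (ρ σ : A) : ∃ b, HasWeakIntegralOn
      (MeasureTheory.volume.prod (MeasureTheory.volume : MeasureTheory.Measure unitInterval))
      (fun y => (g y.1 * z y.1) • expWord h (splitExponent 2 0 1 (z y.1) (w y.1) y.2) ρ σ) b := by
  have := hp.continuousSMul
  have := hp.continuous_exp
  have := hz.continuous
  have := hw.continuous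
  obtain ⟨K, hK, hK'⟩ := hz.norm_le
  have e : ∀ y : EuclideanSpace ℝ (Fin 1) × unitInterval,
      expWord h (splitExponent 2 0 1 (z y.1) (w y.1) y.2) ρ σ =
      NormedSpace.exp ((((1 - (y.2 : ℝ) : ℝ) : ℂ) * z y.1) • h) * ρ *
        NormedSpace.exp (w y.1 • h) * σ *
        NormedSpace.exp (((((y.2 : ℝ)) : ℂ) * z y.1) • h) := fun y => by
    simp [expWord, splitExponent]
  simp only [mul_smul (g _) (z _), e]
  refine (isDominated_schwartz_prod hp.toIsFrechetFamily g
    (Φ := fun y => z y.1 • (NormedSpace.exp ((((1 - (y.2 : ℝ) : ℝ) : ℂ) * z y.1) • h) * ρ *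
        NormedSpace.exp (w y.1 • h) * σ *
        NormedSpace.exp (((((y.2 : ℝ)) : ℂ) * z y.1) • h)))
    (by fun_prop) ?_).exists_weakIntegral hp.toIsFrechetFamily
  refine PolyGrowth.smul (K := K) ?_ hK fun y => ?_
  · have hF := hp.toIsFrechetFamily
    refine ((((hz.polyGrowth_exp hp hh (fun y => ?_) _).mul hF (polyGrowth_const ρ)).mul hF
      (hw.polyGrowth_exp' hp hh _)).mul hF (polyGrowth_const σ)).mul hF
      (hz.polyGrowth_exp hp hh (fun y => ?_) _)
    · rw [abs_le]; constructor <;> linarith [y.2.2.1, y.2.2.2]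
    · rw [abs_le]; constructor <;> linarith [y.2.2.1, y.2.2.2]
  · simpa using hK' y.1

end Exponents

/-! ### Differentiation under the weak integral -/

section DiffFamily

variable {A : Type u} [Ring A] [StarRing A] [Algebra ℂ A] [StarModule ℂ A] [UniformSpace A]
  [IsUniformAddGroup A] [CompleteSpace A] [IsTopologicalRing A] {p : ℕ → Seminorm ℂ A}

/-- The difference quotient of `u` at `0`; it is `0` for `ε = 0`. -/
def diffQuotient {X A : Type*} [Ring A] [Algebra ℂ A] (u : ℝ → X → A) (ε : ℝ) (ξ : X) : A :=
  ((ε⁻¹ : ℝ) : ℂ) • (u ε ξ - u 0 ξ)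

/-- A family `u ε ξ` in `A` with derivative `u'` at `ε = 0`, such that `u` and its difference
quotients grow at most polynomially in `ξ`, uniformly in `|ε| ≤ 1`. -/
structure IsDiffFamily (p : ℕ → Seminorm ℂ A) (u : ℝ → EuclideanSpace ℝ (Fin 1) → A)
    (u' : EuclideanSpace ℝ (Fin 1) → A) : Prop where
  continuous : ∀ ε, Continuous (u ε)
  growth : PolyGrowth p (fun y : Set.Icc (-1 : ℝ) 1 × EuclideanSpace ℝ (Fin 1) => ‖y.2‖)
    fun y => u y.1 y.2
  growth_quotient : PolyGrowth p (fun y : Set.Icc (-1 : ℝ) 1 × EuclideanSpace ℝ (Fin 1) => ‖y.2‖)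
    fun y => diffQuotient u y.1 y.2
  tendsto : ∀ ξ, Filter.Tendsto (fun ε => diffQuotient u ε ξ) (𝓝[≠] 0) (𝓝 (u' ξ))

variable {u v : ℝ → EuclideanSpace ℝ (Fin 1) → A} {u' v' : EuclideanSpace ℝ (Fin 1) → A}

omit [StarRing A] [StarModule ℂ A] in
omit [IsUniformAddGroup A] [CompleteSpace A] in
theorem IsDiffFamily.tendsto_zero (hp : IsFrechetFamily p) (H : IsDiffFamily p u u')
    (ξ : EuclideanSpace ℝ (Fin 1)) : Filter.Tendsto (fun ε => u ε ξ) (𝓝[≠] 0) (𝓝 (u 0 ξ)) := by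
  have := hp.continuousSMul
  have h1 : Filter.Tendsto (fun ε : ℝ => (ε : ℂ)) (𝓝[≠] 0) (𝓝 0) := by
    have := (Complex.continuous_ofReal.tendsto (0 : ℝ)).mono_left
      (nhdsWithin_le_nhds (s := {0}ᶜ))
    rwa [Complex.ofReal_zero] at this
  have h2 := (h1.smul (H.tendsto ξ)).add (tendsto_const_nhds (x := u 0 ξ))
  rw [zero_smul, zero_add] at h2
  refine h2.congr' ?_
  filter_upwards [self_mem_nhdsWithin] with ε hε
  have hε' : (ε : ℂ) ≠ 0 := Complex.ofReal_ne_zero.2 hε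
  rw [diffQuotient, smul_smul, Complex.ofReal_inv, mul_inv_cancel₀ hε', one_smul, sub_add_cancel]

omit [StarRing A] [StarModule ℂ A] in
omit [IsUniformAddGroup A] [CompleteSpace A] in
theorem IsDiffFamily.mul (hp : IsFrechetFamily p) (H : IsDiffFamily p u u')
    (H' : IsDiffFamily p v v') :
    IsDiffFamily p (fun ε ξ => u ε ξ * v ε ξ) fun ξ => u' ξ * v 0 ξ + u 0 ξ * v' ξ := by
  have hq : ∀ ε ξ, diffQuotient (fun ε ξ => u ε ξ * v ε ξ) ε ξ =
      diffQuotient u ε ξ * v ε ξ + u 0 ξ * diffQuotient v ε ξ := fun ε ξ => by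
    simp only [diffQuotient, smul_mul_assoc, mul_smul_comm, ← smul_add]
    congr 1
    noncomm_ring
  refine ⟨fun ε => (H.continuous ε).mul (H'.continuous ε), H.growth.mul hp H'.growth, ?_, ?_⟩
  · simp only [hq]
    have h0 := H.growth.comp fun y : Set.Icc (-1 : ℝ) 1 × EuclideanSpace ℝ (Fin 1) =>
      ((⟨0, by norm_num⟩ : Set.Icc (-1 : ℝ) 1), y.2)
    exact (H.growth_quotient.mul hp H'.growth).add (h0.mul hp H'.growth_quotient)
  · intro ξ
    simp only [hq]
    exact ((H.tendsto ξ).mul (H'.tendsto_zero hp ξ)).add (tendsto_const_nhds.mul (H'.tendsto ξ))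

omit [StarRing A] [StarModule ℂ A] in
omit [IsUniformAddGroup A] [CompleteSpace A] [IsTopologicalRing A] in
theorem IsDiffFamily.map (hp : IsFrechetFamily p) (H : IsDiffFamily p u u') (T : A →L[ℂ] A) :
    IsDiffFamily p (fun ε ξ => T (u ε ξ)) fun ξ => T (u' ξ) := by
  have hq : ∀ ε ξ, diffQuotient (fun ε ξ => T (u ε ξ)) ε ξ = T (diffQuotient u ε ξ) :=
    fun ε ξ => by simp only [diffQuotient, map_smul, map_sub]
  refine ⟨fun ε => T.continuous.comp (H.continuous ε), H.growth.map hp T, ?_, fun ξ => ?_⟩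
  · simp only [hq]
    exact H.growth_quotient.map hp T
  · simp only [hq]
    exact (T.continuous.tendsto _).comp (H.tendsto ξ)

omit [StarRing A] [StarModule ℂ A] in
omit [IsUniformAddGroup A] [CompleteSpace A] [IsTopologicalRing A] in
theorem IsDiffFamily.hasDerivAt_integral (hp : IsFrechetFamily p) (H : IsDiffFamily p u u')
    (g : 𝓢(EuclideanSpace ℝ (Fin 1), ℂ)) (φ : A →L[ℂ] ℂ) :
    HasDerivAt (fun ε : ℝ => ∫ ξ, g ξ * φ (u ε ξ)) (∫ ξ, g ξ * φ (u' ξ)) 0 := by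
  obtain ⟨n, K, hK, hφ⟩ := hp.exists_bound φ
  obtain ⟨C, N, hC, hu⟩ := H.growth n
  obtain ⟨C', N', hC', hu'⟩ := H.growth_quotient n
  have hmeas : ∀ ε, MeasureTheory.AEStronglyMeasurable (fun ξ => g ξ * φ (u ε ξ)) := fun ε =>
    (g.continuous.mul (φ.continuous.comp (H.continuous ε))).aestronglyMeasurable
  have hint : ∀ ε ∈ Set.Icc (-1 : ℝ) 1, MeasureTheory.Integrable fun ξ => g ξ * φ (u ε ξ) := by
    intro ε hε
    refine ((integrable_schwartz_mul_one_add_pow g N).const_mul (K * C)).mono' (hmeas ε)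
      (Filter.Eventually.of_forall fun ξ => ?_)
    have h1 := hu (⟨ε, hε⟩, ξ)
    rw [abs_norm] at h1
    rw [norm_mul]
    calc ‖g ξ‖ * ‖φ (u ε ξ)‖ ≤ ‖g ξ‖ * (K * (C * (1 + ‖ξ‖) ^ N)) :=
          mul_le_mul_of_nonneg_left ((hφ _).trans (mul_le_mul_of_nonneg_left h1 hK)) (norm_nonneg _)
      _ = _ := by ring
  have hsmall : Set.Icc (-1 : ℝ) 1 ∈ 𝓝[≠] (0 : ℝ) :=
    nhdsWithin_le_nhds (Icc_mem_nhds (by norm_num) (by norm_num))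
  rw [hasDerivAt_iff_tendsto_slope_zero]
  have hlim : Filter.Tendsto (fun ε : ℝ => ∫ ξ, g ξ * φ (diffQuotient u ε ξ)) (𝓝[≠] 0)
      (𝓝 (∫ ξ, g ξ * φ (u' ξ))) := by
    refine MeasureTheory.tendsto_integral_filter_of_dominated_convergence
      (fun ξ => K * C' * (‖g ξ‖ * (1 + ‖ξ‖) ^ N')) (Filter.Eventually.of_forall fun ε => ?_) ?_
      ((integrable_schwartz_mul_one_add_pow g N').const_mul _)
      (Filter.Eventually.of_forall fun ξ => ?_)
    · have h1 : (fun ξ => g ξ * φ (diffQuotient u ε ξ)) = fun ξ => ((ε⁻¹ : ℝ) : ℂ) *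
          (g ξ * φ (u ε ξ) - g ξ * φ (u 0 ξ)) := by
        funext ξ
        simp only [diffQuotient, map_smul, map_sub, smul_eq_mul]
        ring
      rw [h1]
      exact ((hmeas ε).sub (hmeas 0)).const_mul _
    · filter_upwards [hsmall] with ε hε
      refine Filter.Eventually.of_forall fun ξ => ?_
      have h1 := hu' (⟨ε, hε⟩, ξ)
      rw [abs_norm] at h1
      rw [norm_mul]
      calc ‖g ξ‖ * ‖φ (diffQuotient u ε ξ)‖ ≤ ‖g ξ‖ * (K * (C' * (1 + ‖ξ‖) ^ N')) :=
            mul_le_mul_of_nonneg_left ((hφ _).trans (mul_le_mul_of_nonneg_left h1 hK))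
              (norm_nonneg _)
        _ = _ := by ring
    · exact tendsto_const_nhds.mul ((φ.continuous.tendsto _).comp (H.tendsto ξ))
  refine hlim.congr' ?_
  filter_upwards [hsmall] with ε hε
  rw [zero_add, ← MeasureTheory.integral_sub (hint ε hε) (hint 0 (by norm_num)),
    ← MeasureTheory.integral_smul]
  refine MeasureTheory.integral_congr_ae (Filter.Eventually.of_forall fun ξ => ?_)
  simp only [diffQuotient, map_smul, map_sub, smul_eq_mul, Complex.real_smul]
  ring

/-- The family `exp (z(ξ) (h + ε a))` is differentiable in `ε`, with the derivative given by
Duhamel's formula. -/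
theorem IsExponent.exists_isDiffFamily_exp {z : EuclideanSpace ℝ (Fin 1) → ℂ} (hz : IsExponent z)
    (hp : IsSmoothFamily p) {h a : A} (hh : IsSelfAdjoint h) (ha : IsSelfAdjoint a) :
    ∃ D : EuclideanSpace ℝ (Fin 1) → A,
      (∀ ξ, HasWeakIntegralOn (MeasureTheory.volume : MeasureTheory.Measure unitInterval)
        (fun s => NormedSpace.exp ((((s : ℝ) : ℂ) * z ξ) • h) * (z ξ • a) *
          NormedSpace.exp ((((1 - (s : ℝ) : ℝ) : ℂ) * z ξ) • h)) (D ξ)) ∧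
      IsDiffFamily p (fun ε ξ => NormedSpace.exp (z ξ • (h + (ε : ℂ) • a))) D := by
  have hF := hp.toIsFrechetFamily
  have := hp.continuousSMul
  have := hp.continuous_exp
  have := hz.continuous
  obtain ⟨K, hK, hK'⟩ := hz.norm_le
  let Φ : ℝ → EuclideanSpace ℝ (Fin 1) → unitInterval → A := fun ε ξ s =>
    NormedSpace.exp ((((s : ℝ) : ℂ) * z ξ) • (h + (ε : ℂ) • a)) * (z ξ • a) *
      NormedSpace.exp ((((1 - (s : ℝ) : ℝ) : ℂ) * z ξ) • h)
  have hΦ0 : ∀ ξ s, Φ 0 ξ s = NormedSpace.exp ((((s : ℝ) : ℂ) * z ξ) • h) * (z ξ • a) *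
      NormedSpace.exp ((((1 - (s : ℝ) : ℝ) : ℂ) * z ξ) • h) := fun ξ s => by simp [Φ]
  have hdom : ∀ ξ, IsDominated p (MeasureTheory.volume : MeasureTheory.Measure unitInterval)
      (Φ 0 ξ) := fun ξ => isDominated_unitInterval hF (by fun_prop)
  choose D hD using fun ξ => (hdom ξ).exists_weakIntegral hF
  have hgrow : PolyGrowth p
      (fun y : (Set.Icc (-1 : ℝ) 1 × EuclideanSpace ℝ (Fin 1)) × unitInterval => ‖y.1.2‖)
      fun y => Φ y.1.1 y.1.2 y.2 := by
    refine ((hz.polyGrowth_exp_perturbed hp hh ha (fun y => ?_)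
      (fun y => abs_le.2 y.1.1.2) _).mul hF
      ((polyGrowth_const a).smul hK fun y => ?_)).mul hF (hz.polyGrowth_exp hp hh (fun y => ?_) _)
    · rw [abs_le]; constructor <;> linarith [y.2.2.1, y.2.2.2]
    · simpa using hK' y.1.2
    · rw [abs_le]; constructor <;> linarith [y.2.2.1, y.2.2.2]
  -- Duhamel's formula in the Banach algebras to which `A` maps.
  have hquot : ∀ {E : Type u} [NormedRing E] [NormedAlgebra ℂ E] [CompleteSpace E] (π : A →ₐ[ℂ] E),
      Continuous π → ∀ ε : ℝ, ε ≠ 0 → ∀ ξ,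
      π (diffQuotient (fun ε ξ => NormedSpace.exp (z ξ • (h + (ε : ℂ) • a))) ε ξ) =
        ∫ s, π (Φ ε ξ s) := by
    intro E _ _ _ π hπ ε hε ξ
    have hε' : (ε : ℂ) ≠ 0 := Complex.ofReal_ne_zero.2 hε
    simp only [diffQuotient, map_smul, map_sub, Φ, map_mul, hF.map_exp hπ]
    rw [exp_sub_exp, ← MeasureTheory.integral_smul]
    refine MeasureTheory.integral_congr_ae (Filter.Eventually.of_forall fun s => ?_)
    simp only [smul_add, Complex.ofReal_zero, zero_smul, map_add, map_smul,
      add_zero, add_sub_cancel_left, smul_smul, Complex.ofReal_sub, Complex.ofReal_one,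
      Complex.ofReal_inv, mul_smul_comm, smul_mul_assoc,
      mul_assoc]
    congr 1
    field_simp
  refine ⟨D, fun ξ => by simpa only [← hΦ0] using hD ξ, fun ε => by fun_prop, ?_, fun m => ?_,
    fun ξ => ?_⟩
  · simpa using hz.polyGrowth_exp_perturbed hp hh ha (t := fun _ => 1) (by simp)
      (fun y : Set.Icc (-1 : ℝ) 1 × EuclideanSpace ℝ (Fin 1) => abs_le.2 y.1.2) fun y => y.2
  · obtain ⟨E, _, _, _, π, h1, -, h3⟩ := hF.exists_completion m
    obtain ⟨C, N, hC, hb⟩ := hgrow m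
    refine ⟨C, N, hC, fun y => ?_⟩
    by_cases hy : (y.1 : ℝ) = 0
    · simp only [diffQuotient, hy, inv_zero, Complex.ofReal_zero, zero_smul, map_zero]
      positivity
    · rw [← h1, hquot π h3 _ hy]
      refine (MeasureTheory.norm_integral_le_of_norm_le_const (C := C * (1 + |‖y.2‖|) ^ N)
        (Filter.Eventually.of_forall fun s => ?_)).trans_eq (by simp)
      rw [h1]
      exact hb (y, s)
  · rw [hF.tendsto_iff]
    intro m
    obtain ⟨E, _, _, _, π, h1, -, h3⟩ := hF.exists_completion m
    have hDπ : ∫ s, π (Φ 0 ξ s) = π (D ξ) :=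
      (hD ξ).integral_eq (homCLM π h3) ((hdom ξ).integrable hF (homCLM π h3))
    have hc : Continuous fun ε : ℝ => ∫ s, π (Φ ε ξ s) := by
      have := continuous_parametric_integral_of_continuous
        (μ := (MeasureTheory.volume : MeasureTheory.Measure unitInterval))
        (f := fun (ε : ℝ) s => π (Φ ε ξ s)) (by
          simp only [Function.uncurry_def, Φ]; fun_prop) isCompact_univ
      simpa using this
    have h4 : Filter.Tendsto (fun ε : ℝ => ‖(∫ s, π (Φ ε ξ s)) - π (D ξ)‖) (𝓝[≠] 0) (𝓝 0) := by
      rw [← hDπ]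
      exact (tendsto_iff_norm_sub_tendsto_zero.1 (hc.tendsto 0)).mono_left nhdsWithin_le_nhds
    refine h4.congr' ?_
    filter_upwards [self_mem_nhdsWithin] with ε hε
    rw [← hquot π h3 ε hε, ← map_sub, h1]

end DiffFamily

/-! ### The variation of the functional -/

section Variation

variable {A : Type u} [Ring A] [StarRing A] [Algebra ℂ A] [StarModule ℂ A] [UniformSpace A]
  [IsUniformAddGroup A] [CompleteSpace A] [IsTopologicalRing A] {p : ℕ → Seminorm ℂ A}

/-- `v = ∫₀¹ exp (s h) a exp ((1 - s) h) ds`, the derivative of `exp` at `h` in the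
direction `a`. -/
def IsDuhamelIntegral (h a v : A) : Prop :=
  HasWeakIntegralOn (MeasureTheory.volume : MeasureTheory.Measure unitInterval)
    (fun s => NormedSpace.exp (((s : ℝ) : ℂ) • h) * a * NormedSpace.exp ((1 - ((s : ℝ) : ℂ)) • h)) v

/-- `b' = ∫₀¹ exp ((1 - s) h) b exp (s h) ds`, the transposed derivative of `exp` at `h`. -/
def IsDuhamelTranspose (h b b' : A) : Prop :=
  HasWeakIntegralOn (MeasureTheory.volume : MeasureTheory.Measure unitInterval)
    (fun s => NormedSpace.exp ((1 - ((s : ℝ) : ℂ)) • h) * b *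
      NormedSpace.exp (((s : ℝ) : ℂ) • h)) b'

/-- `b = ∫ g(ξ) exp (z(ξ) h) ρ exp (w(ξ) h) dξ`. -/
def IsSandwich (g : 𝓢(EuclideanSpace ℝ (Fin 1), ℂ)) (z w : EuclideanSpace ℝ (Fin 1) → ℂ)
    (h ρ b : A) : Prop :=
  HasWeakIntegralOn MeasureTheory.volume
    (fun ξ => g ξ • (NormedSpace.exp (z ξ • h) * ρ * NormedSpace.exp (w ξ • h))) b

/-- `b = ∫∫ g(ξ) z(ξ) e^{(1-s)zh} ρ e^{wh} ρ e^{szh} ds dξ`. -/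
def IsSplitIntegral (g : 𝓢(EuclideanSpace ℝ (Fin 1), ℂ)) (z w : EuclideanSpace ℝ (Fin 1) → ℂ)
    (h ρ b : A) : Prop :=
  HasWeakIntegralOn
      (MeasureTheory.volume.prod (MeasureTheory.volume : MeasureTheory.Measure unitInterval))
      (fun y => (g y.1 * z y.1) • expWord h (splitExponent 2 0 1 (z y.1) (w y.1) y.2) ρ ρ) b

variable {z w : EuclideanSpace ℝ (Fin 1) → ℂ} {h a b b' v ρ Y P Q : A}
  {g : 𝓢(EuclideanSpace ℝ (Fin 1), ℂ)} {φ : A →L[ℂ] ℂ}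

/-- The functional `x ↦ φ (a x b)`. -/
def sandwichFunctional (φ : A →L[ℂ] ℂ) (a b : A) : A →L[ℂ] ℂ :=
  φ.comp ⟨LinearMap.mulRight ℂ b ∘ₗ LinearMap.mulLeft ℂ a, by
    change Continuous fun x => a * x * b
    fun_prop⟩

omit [StarRing A] [StarModule ℂ A] [IsUniformAddGroup A] [CompleteSpace A] in
@[simp]
theorem sandwichFunctional_apply (φ : A →L[ℂ] ℂ) (a b x : A) :
    sandwichFunctional φ a b x = φ (a * x * b) := rfl

omit [StarRing A] [StarModule ℂ A] in
theorem IsFrechetFamily.exists_isDuhamelTranspose (hp : IsFrechetFamily p) (h b : A) :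
    ∃ b', IsDuhamelTranspose h b b' := by
  have := hp.continuousSMul
  have := hp.continuous_exp
  exact (isDominated_unitInterval hp (by fun_prop)).exists_weakIntegral hp

theorem IsExponent.exists_isSandwich (hz : IsExponent z) (hw : IsExponent w)
    (hp : IsSmoothFamily p) (hh : IsSelfAdjoint h) (g : 𝓢(EuclideanSpace ℝ (Fin 1), ℂ)) (ρ : A) :
    ∃ b, IsSandwich g z w h ρ b := by
  have hF := hp.toIsFrechetFamily
  have := hp.continuousSMul
  have := hp.continuous_exp
  have := hz.continuous
  have := hw.continuous
  exact (isDominated_schwartz hF g (by fun_prop) (((hz.polyGrowth_exp' hp hh _).mul hF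
    (polyGrowth_const ρ)).mul hF (hw.polyGrowth_exp' hp hh _))).exists_weakIntegral hF

omit [StarRing A] [StarModule ℂ A] [IsUniformAddGroup A] [CompleteSpace A] in
/-- The transposition rule `φ(v b) = φ(a Q(b))` for a trace `φ`. -/
theorem IsDuhamelIntegral.trace_mul (hφ : ∀ a b : A, φ (a * b) = φ (b * a))
    (hv : IsDuhamelIntegral h a v) (hb : IsDuhamelTranspose h b b') : φ (v * b) = φ (a * b') := by
  have h1 := (hv (sandwichFunctional φ 1 b)).2
  have h2 := (hb (sandwichFunctional φ a 1)).2
  simp only [sandwichFunctional_apply, one_mul, mul_one] at h1 h2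
  rw [← h1, ← h2]
  refine MeasureTheory.integral_congr_ae (Filter.Eventually.of_forall fun s => ?_)
  dsimp only
  rw [mul_assoc, mul_assoc, hφ]
  simp only [mul_assoc]

omit [StarRing A] [StarModule ℂ A] [IsUniformAddGroup A] [CompleteSpace A] in
/-- The contribution of the variation `D` of `exp (z h)` to the variation of the functional. -/
theorem IsSplitIntegral.trace_mul (hφ : ∀ a b : A, φ (a * b) = φ (b * a))
    (hY : IsSplitIntegral g z w h ρ Y) {D : EuclideanSpace ℝ (Fin 1) → A}
    (hD : ∀ ξ, HasWeakIntegralOn (MeasureTheory.volume : MeasureTheory.Measure unitInterval)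
        (fun s => NormedSpace.exp ((((s : ℝ) : ℂ) * z ξ) • h) * (z ξ • a) *
          NormedSpace.exp ((((1 - (s : ℝ) : ℝ) : ℂ) * z ξ) • h)) (D ξ)) :
    MeasureTheory.Integrable
      (fun ξ => g ξ * φ (D ξ * (ρ * NormedSpace.exp (w ξ • h) * ρ))) ∧
    ∫ ξ, g ξ * φ (D ξ * (ρ * NormedSpace.exp (w ξ • h) * ρ)) = φ (a * Y) := by
  obtain ⟨hi, he⟩ := hY (sandwichFunctional φ a 1)
  rw [MeasureTheory.integral_prod _ hi] at he
  have hi' := hi.integral_prod_left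
  have key : ∀ ξ, ∫ s : unitInterval, sandwichFunctional φ a 1 ((g ξ * z ξ) •
      expWord h (splitExponent 2 0 1 (z ξ) (w ξ) s) ρ ρ) =
      g ξ * φ (D ξ * (ρ * NormedSpace.exp (w ξ • h) * ρ)) := by
    intro ξ
    have h1 := (hD ξ (sandwichFunctional φ 1 (ρ * NormedSpace.exp (w ξ • h) * ρ))).2
    simp only [sandwichFunctional_apply, one_mul] at h1
    rw [← h1, ← MeasureTheory.integral_const_mul]
    refine MeasureTheory.integral_congr_ae (Filter.Eventually.of_forall fun s => ?_)
    have e0 : splitExponent 2 0 1 (z ξ) (w ξ) s 0 = ((1 - (s : ℝ) : ℝ) : ℂ) * z ξ := by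
      simp [splitExponent]
    have e1 : splitExponent 2 0 1 (z ξ) (w ξ) s 1 = w ξ := by simp [splitExponent]
    have e2 : splitExponent 2 0 1 (z ξ) (w ξ) s 2 = ((s : ℝ) : ℂ) * z ξ := by simp [splitExponent]
    simp only [sandwichFunctional_apply, mul_one, expWord, e0, e1, e2, mul_smul_comm,
      smul_mul_assoc, map_smul, smul_eq_mul, mul_assoc]
    rw [hφ (NormedSpace.exp ((((s : ℝ) : ℂ) * z ξ) • h))]
    simp only [mul_assoc]
  simp only [key] at hi' he
  exact ⟨hi', by simpa only [sandwichFunctional_apply, mul_one] using he⟩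

omit [StarRing A] [StarModule ℂ A] [IsUniformAddGroup A] [CompleteSpace A] in
theorem IsSandwich.trace_mul (hP : IsSandwich g z w h ρ P) (φ : A →L[ℂ] ℂ) (c : A) :
    MeasureTheory.Integrable
      (fun ξ => g ξ * φ (c * (NormedSpace.exp (z ξ • h) * ρ * NormedSpace.exp (w ξ • h)))) ∧
    ∫ ξ, g ξ * φ (c * (NormedSpace.exp (z ξ • h) * ρ * NormedSpace.exp (w ξ • h))) =
      φ (c * P) := by
  simpa only [sandwichFunctional_apply, mul_one, mul_smul_comm, map_smul, smul_eq_mul] using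
    hP (sandwichFunctional φ c 1)

/-- The functional as an integral over the line, by a density which is adapted to all `h` of norm
less than `R`; so the same density serves for the varied functional. -/
theorem weylFunctional_eq_integral (hp : IsSmoothFamily p) (φ : A →L[ℂ] ℂ) (δ : A →L[ℂ] A) (j : ℝ)
    {f : (Fin 1 → ℝ) → ℂ} (hf : IsLogSmooth f) (hh : IsSelfAdjoint h) {R : ℝ} (hR : p 0 h < R)
    (hg : IsFourierDensityOn (Set.Ioo (-(2 * R)) (2 * R)) (fun x => f fun l => Real.exp (x l)) g) :
    weylFunctional φ δ j f h = ∫ ξ, g ξ * φ (NormedSpace.exp ((j + Complex.I * (ξ 0 : ℂ)) • h) *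
      δ (NormedSpace.exp h) * NormedSpace.exp ((-(Complex.I * (ξ 0 : ℂ))) • h) *
      δ (NormedSpace.exp h)) := by
  obtain ⟨b, hb⟩ := hp.exists_hasWeakIntegral_flow hh ![δ (NormedSpace.exp h)] g
  rw [weylFunctional, hp.isDensityIndependent_one.modularCalculus_eq hp hf hh hR hg hb]
  rw [← sandwichFunctional_apply, ← (hb (sandwichFunctional φ _ _)).2]
  refine MeasureTheory.integral_congr_ae (Filter.Eventually.of_forall fun ξ => ?_)
  simp only [sandwichFunctional_apply, weylPow, hp.exp_add_smul, partialModularFlow, modularFlow,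
    List.ofFn_succ, List.ofFn_zero, List.prod_cons, List.prod_nil, mul_one, Matrix.cons_val_zero,
    map_smul, smul_eq_mul, mul_assoc]

/-- The first variation of the functional: `Y₁` and `Y₂` collect the variations of the two
exponentials, `P₁` and `P₂` those of the two factors `δ k`. -/
theorem exists_variation (hp : IsSmoothFamily p) (hφ : ∀ a b : A, φ (a * b) = φ (b * a))
    (δ : A →L[ℂ] A) (j : ℝ) {f : (Fin 1 → ℝ) → ℂ} (hf : IsLogSmooth f)
    (hh : IsSelfAdjoint h) (ha : IsSelfAdjoint a) {R : ℝ} (hR : p 0 h + p 0 a < R)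
    (hg : IsFourierDensityOn (Set.Ioo (-(2 * R)) (2 * R)) (fun x => f fun l => Real.exp (x l)) g)
    {Y₁ Y₂ P₁ P₂ : A}
    (hY₁ : IsSplitIntegral g (fun ξ => j + Complex.I * (ξ 0 : ℂ))
      (fun ξ => -(Complex.I * (ξ 0 : ℂ))) h (δ (NormedSpace.exp h)) Y₁)
    (hY₂ : IsSplitIntegral g (fun ξ => -(Complex.I * (ξ 0 : ℂ)))
      (fun ξ => j + Complex.I * (ξ 0 : ℂ)) h (δ (NormedSpace.exp h)) Y₂)
    (hP₁ : IsSandwich g (fun ξ => -(Complex.I * (ξ 0 : ℂ))) (fun ξ => j + Complex.I * (ξ 0 : ℂ)) h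
      (δ (NormedSpace.exp h)) P₁)
    (hP₂ : IsSandwich g (fun ξ => j + Complex.I * (ξ 0 : ℂ)) (fun ξ => -(Complex.I * (ξ 0 : ℂ))) h
      (δ (NormedSpace.exp h)) P₂) :
    ∃ v, IsWeylVariation h a v ∧ IsDuhamelIntegral h a v ∧
      HasDerivAt (fun ε : ℝ => weylFunctional φ δ j f (h + (ε : ℂ) • a))
        (φ (a * Y₁) + φ (a * Y₂) + φ (δ v * P₁) + φ (δ v * P₂)) 0 := by
  have hF := hp.toIsFrechetFamily
  obtain ⟨D₁, hD₁, H₁⟩ := (isExponent_left j).exists_isDiffFamily_exp hp hh ha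
  obtain ⟨D₂, hD₂, H₂⟩ := isExponent_right.exists_isDiffFamily_exp hp hh ha
  obtain ⟨D, hD, H⟩ := (isExponent_const 1).exists_isDiffFamily_exp hp hh ha
  simp only [Complex.ofReal_one, one_smul] at H
  have hv : IsDuhamelIntegral h a (D 0) := by
    have := hD 0
    simp only [Complex.ofReal_sub, Complex.ofReal_one, one_smul, mul_one] at this
    exact this
  have hDv : ∀ ξ, D ξ = D 0 := fun ξ => (hD ξ).unique hF (hD 0)
  refine ⟨D 0, ?_, hv, ?_⟩
  · have := H.tendsto 0
    simp only [diffQuotient, Complex.ofReal_zero, zero_smul, add_zero] at this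
    exact this
  have Hρ := H.map hF δ
  have Hall := ((H₁.mul hF Hρ).mul hF H₂).mul hF Hρ
  have hderiv := Hall.hasDerivAt_integral hF g φ
  simp only [Complex.ofReal_zero, zero_smul, add_zero, hDv] at hderiv
  have hval : ∫ ξ, g ξ * φ (((D₁ ξ * δ (NormedSpace.exp h) +
      NormedSpace.exp ((j + Complex.I * (ξ 0 : ℂ)) • h) * δ (D 0)) *
      NormedSpace.exp ((-(Complex.I * (ξ 0 : ℂ))) • h) +
      NormedSpace.exp ((j + Complex.I * (ξ 0 : ℂ)) • h) * δ (NormedSpace.exp h) * D₂ ξ) *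
      δ (NormedSpace.exp h) + NormedSpace.exp ((j + Complex.I * (ξ 0 : ℂ)) • h) *
      δ (NormedSpace.exp h) * NormedSpace.exp ((-(Complex.I * (ξ 0 : ℂ))) • h) * δ (D 0)) =
      φ (a * Y₁) + φ (a * Y₂) + φ (δ (D 0) * P₁) + φ (δ (D 0) * P₂) := by
    obtain ⟨i1, e1⟩ := hY₁.trace_mul hφ hD₁
    obtain ⟨i2, e2⟩ := hY₂.trace_mul hφ hD₂
    obtain ⟨i3, e3⟩ := hP₁.trace_mul φ (δ (D 0))
    obtain ⟨i4, e4⟩ := hP₂.trace_mul φ (δ (D 0))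
    refine Eq.trans ?_ ((MeasureTheory.integral_add ((i1.add i2).add i3) i4).trans
      (congrArg₂ (· + ·) ((MeasureTheory.integral_add (i1.add i2) i3).trans
        (congrArg₂ (· + ·) ((MeasureTheory.integral_add i1 i2).trans
          (congrArg₂ (· + ·) e1 e2)) e3)) e4))
    refine MeasureTheory.integral_congr_ae (Filter.Eventually.of_forall fun ξ => ?_)
    simp only [Pi.add_apply, ← mul_add]
    congr 1
    generalize NormedSpace.exp ((j + Complex.I * (ξ 0 : ℂ)) • h) = Ez
    generalize NormedSpace.exp ((-(Complex.I * (ξ 0 : ℂ))) • h) = Ew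
    generalize δ (NormedSpace.exp h) = ρ
    generalize δ (D 0) = δv
    have c1 : φ (Ez * ρ * D₂ ξ * ρ) = φ (D₂ ξ * (ρ * Ez * ρ)) := by
      rw [mul_assoc (Ez * ρ), hφ]; simp only [mul_assoc]
    have c2 : φ (Ez * δv * Ew * ρ) = φ (δv * (Ew * ρ * Ez)) := by
      rw [mul_assoc Ez, mul_assoc Ez, hφ]; simp only [mul_assoc]
    have c3 : φ (Ez * ρ * Ew * δv) = φ (δv * (Ez * ρ * Ew)) := hφ _ _
    have c4 : D₁ ξ * ρ * Ew * ρ = D₁ ξ * (ρ * Ew * ρ) := by simp only [mul_assoc]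
    simp only [add_mul, map_add, c1, c2, c3, c4]
    ring
  rw [hval] at hderiv
  refine hderiv.congr_of_eventuallyEq ?_
  filter_upwards [Icc_mem_nhds (show (-1 : ℝ) < 0 by norm_num) (show (0 : ℝ) < 1 by norm_num)]
    with ε hε
  refine weylFunctional_eq_integral hp φ δ j hf (hh.add (isSelfAdjoint_real_smul ha ε)) ?_ hg
  refine (map_add_le_add _ _ _).trans_lt (lt_of_le_of_lt ?_ hR)
  rw [map_smul_eq_mul, Complex.norm_real]
  exact add_le_add le_rfl (mul_le_of_le_one_left (apply_nonneg _ _) (abs_le.2 hε))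

end Variation

/-! ### The derivation of the sandwich integrals -/

section Leibniz

variable {A : Type u} [Ring A] [StarRing A] [Algebra ℂ A] [StarModule ℂ A] [UniformSpace A]
  [IsUniformAddGroup A] [CompleteSpace A] [IsTopologicalRing A] {p : ℕ → Seminorm ℂ A}
  {z w : EuclideanSpace ℝ (Fin 1) → ℂ} {h ρ P : A} {δ : A →L[ℂ] A}
  {B : Type*} [CStarAlgebra B] {π : A →ₐ[ℂ] B}

/-- The symbol of the integrals which arise from differentiating `exp (w h)` by Duhamel's formula:
the two halves of `exp (w h)` stand at the places `p` and `q`, and `exp (z h)` at the place `r`. -/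
def splitSymbol (g : 𝓢(EuclideanSpace ℝ (Fin 1), ℂ)) (p q r : Fin 3)
    (w z : EuclideanSpace ℝ (Fin 1) → ℂ) : (Fin 3 → ℝ) → ℂ :=
  expSymbol (MeasureTheory.volume.prod (MeasureTheory.volume : MeasureTheory.Measure unitInterval))
    (fun y => g y.1 * w y.1) (fun y => splitExponent p q r (w y.1) (z y.1) y.2)

theorem IsExponent.integrable_mul (hw : IsExponent w) (g : 𝓢(EuclideanSpace ℝ (Fin 1), ℂ)) :
    MeasureTheory.Integrable fun ξ => g ξ * w ξ := by
  obtain ⟨K, hK, hK'⟩ := hw.norm_le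
  have hc := hw.continuous
  refine ((integrable_schwartz_mul_one_add_pow g 1).const_mul K).mono' (by fun_prop)
    (Filter.Eventually.of_forall fun ξ => ?_)
  rw [norm_mul, pow_one]
  nlinarith [hK' ξ, norm_nonneg (g ξ)]

theorem IsExponent.isExpFamily_split (hw : IsExponent w) (hz : IsExponent z)
    (g : 𝓢(EuclideanSpace ℝ (Fin 1), ℂ)) (p q r : Fin 3) :
    IsExpFamily
      (MeasureTheory.volume.prod (MeasureTheory.volume : MeasureTheory.Measure unitInterval))
      (fun y => g y.1 * w y.1) (fun y => splitExponent p q r (w y.1) (z y.1) y.2) := by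
  obtain ⟨M, hM⟩ := hw.re_le
  obtain ⟨M', hM'⟩ := hz.re_le
  exact ModularVariation.isExpFamily_split (hw.integrable_mul g) hw.continuous.measurable
    hz.continuous.measurable (fun ξ => (hM ξ).trans (le_max_left M M'))
    (fun ξ => (hM' ξ).trans (le_max_right M M')) p q r

theorem IsExponent.splitSymbol_eq (hw : IsExponent w) (hz : IsExponent z)
    (g : 𝓢(EuclideanSpace ℝ (Fin 1), ℂ)) (p q r : Fin 3) (x : Fin 3 → ℝ) :
    ((x p : ℂ) - x q) * splitSymbol g p q r w z x =
      ∫ ξ, g ξ * (Complex.exp (w ξ * x p) - Complex.exp (w ξ * x q)) *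
        Complex.exp (z ξ * x r) := by
  obtain ⟨M, hM⟩ := hw.re_le
  obtain ⟨M', hM'⟩ := hz.re_le
  exact expSymbol_split (hw.integrable_mul g) hw.continuous.measurable
    hz.continuous.measurable (fun ξ => (hM ξ).trans (le_max_left M M'))
    (fun ξ => (hM' ξ).trans (le_max_right M M')) p q r x

/-- The term of `δ (∫ g exp (w h) ρ exp (z h))` in which `δ` falls on the left exponential. -/
theorem IsExponent.exists_derivation_left (hw : IsExponent w) (hz : IsExponent z)
    (hp : IsSmoothFamily p) (hπ : IsCStarRep p π) (hh : IsSelfAdjoint h)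
    (hδ : ∀ a b : A, δ (a * b) = δ a * b + a * δ b)
    (g : 𝓢(EuclideanSpace ℝ (Fin 1), ℂ)) (ρ : A) (R : ℝ) :
    ∃ N, HasWeakIntegralOn MeasureTheory.volume (fun ξ =>
        g ξ • (δ (NormedSpace.exp (w ξ • h)) * ρ * NormedSpace.exp (z ξ • h))) N ∧
      HasSymbol R (π h) (π (δ h)) (π ρ) (splitSymbol g 0 1 2 w z) (π N) := by
  have hF := hp.toIsFrechetFamily
  have := hp.continuousSMul
  have := hp.continuous_exp
  have := hz.continuous
  have := hw.continuous
  have hdom := isDominated_schwartz hF g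
    (Φ := fun ξ => δ (NormedSpace.exp (w ξ • h)) * ρ * NormedSpace.exp (z ξ • h)) (by fun_prop)
    ((((hw.polyGrowth_exp' hp hh _).map hF δ).mul hF (polyGrowth_const ρ)).mul hF
      (hz.polyGrowth_exp' hp hh _))
  obtain ⟨N, hN⟩ := hdom.exists_weakIntegral hF
  have hfam := hw.isExpFamily_split hz g 0 1 2
  refine ⟨N, hN, _, _, _, inferInstance, _, _, hfam, fun _ _ _ => rfl, ?_⟩
  have hint := hfam.integrable_word (hπ.isSelfAdjoint hh) (π (δ h)) (π ρ)
  rw [MeasureTheory.integral_prod _ hint]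
  refine Eq.trans ?_ (hN.integral_eq (homCLM π hπ.continuous) (hdom.integrable hF _))
  refine MeasureTheory.integral_congr_ae (Filter.Eventually.of_forall fun ξ => ?_)
  simp only [homCLM_apply, map_smul, map_mul, hF.map_exp hπ.continuous]
  rw [hF.map_derivation_exp hδ hπ.continuous, mul_assoc]
  have hi : MeasureTheory.Integrable fun s : unitInterval =>
      NormedSpace.exp (((s : ℝ) : ℂ) • π (w ξ • h)) * π (δ (w ξ • h)) *
        NormedSpace.exp ((1 - ((s : ℝ) : ℂ)) • π (w ξ • h)) := by
    have := continuous_normedSpace_exp (E := B)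
    exact Continuous.integrable_of_hasCompactSupport (by fun_prop)
      (HasCompactSupport.of_compactSpace _)
  rw [← integral_mul_const_of_integrable hi, ← MeasureTheory.integral_smul]
  refine MeasureTheory.integral_congr_ae (Filter.Eventually.of_forall fun s => ?_)
  have e0 : splitExponent 0 1 2 (w ξ) (z ξ) s 0 = ((s : ℝ) : ℂ) * w ξ := by simp [splitExponent]
  have e1 : splitExponent 0 1 2 (w ξ) (z ξ) s 1 = (1 - ((s : ℝ) : ℂ)) * w ξ := by
    simp [splitExponent]
  have e2 : splitExponent 0 1 2 (w ξ) (z ξ) s 2 = z ξ := by simp [splitExponent]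
  simp only [expWord, e0, e1, e2, map_smul, smul_smul, mul_smul_comm, smul_mul_assoc, mul_assoc]

/-- The term of `δ (∫ g exp (w h) ρ exp (z h))` in which `δ` falls on the right exponential. -/
theorem IsExponent.exists_derivation_right (hw : IsExponent w) (hz : IsExponent z)
    (hp : IsSmoothFamily p) (hπ : IsCStarRep p π) (hh : IsSelfAdjoint h)
    (hδ : ∀ a b : A, δ (a * b) = δ a * b + a * δ b)
    (g : 𝓢(EuclideanSpace ℝ (Fin 1), ℂ)) (ρ : A) (R : ℝ) :
    ∃ N, HasWeakIntegralOn MeasureTheory.volume (fun ξ =>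
        g ξ • (NormedSpace.exp (w ξ • h) * ρ * δ (NormedSpace.exp (z ξ • h)))) N ∧
      HasSymbol R (π h) (π ρ) (π (δ h)) (splitSymbol g 1 2 0 z w) (π N) := by
  have hF := hp.toIsFrechetFamily
  have := hp.continuousSMul
  have := hp.continuous_exp
  have := hz.continuous
  have := hw.continuous
  have hdom := isDominated_schwartz hF g
    (Φ := fun ξ => NormedSpace.exp (w ξ • h) * ρ * δ (NormedSpace.exp (z ξ • h))) (by fun_prop)
    (((hw.polyGrowth_exp' hp hh _).mul hF (polyGrowth_const ρ)).mul hF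
      ((hz.polyGrowth_exp' hp hh _).map hF δ))
  obtain ⟨N, hN⟩ := hdom.exists_weakIntegral hF
  have hfam := hz.isExpFamily_split hw g 1 2 0
  refine ⟨N, hN, _, _, _, inferInstance, _, _, hfam, fun _ _ _ => rfl, ?_⟩
  have hint := hfam.integrable_word (hπ.isSelfAdjoint hh) (π ρ) (π (δ h))
  rw [MeasureTheory.integral_prod _ hint]
  refine Eq.trans ?_ (hN.integral_eq (homCLM π hπ.continuous) (hdom.integrable hF _))
  refine MeasureTheory.integral_congr_ae (Filter.Eventually.of_forall fun ξ => ?_)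
  simp only [homCLM_apply, map_smul, map_mul, hF.map_exp hπ.continuous]
  rw [hF.map_derivation_exp hδ hπ.continuous]
  have hi : MeasureTheory.Integrable fun s : unitInterval =>
      NormedSpace.exp (((s : ℝ) : ℂ) • π (z ξ • h)) * π (δ (z ξ • h)) *
        NormedSpace.exp ((1 - ((s : ℝ) : ℂ)) • π (z ξ • h)) := by
    have := continuous_normedSpace_exp (E := B)
    exact Continuous.integrable_of_hasCompactSupport (by fun_prop)
      (HasCompactSupport.of_compactSpace _)
  rw [← integral_const_mul_of_integrable hi, ← MeasureTheory.integral_smul]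
  refine MeasureTheory.integral_congr_ae (Filter.Eventually.of_forall fun s => ?_)
  have e0 : splitExponent 1 2 0 (z ξ) (w ξ) s 0 = w ξ := by simp [splitExponent]
  have e1 : splitExponent 1 2 0 (z ξ) (w ξ) s 1 = ((s : ℝ) : ℂ) * z ξ := by simp [splitExponent]
  have e2 : splitExponent 1 2 0 (z ξ) (w ξ) s 2 = (1 - ((s : ℝ) : ℂ)) * z ξ := by
    simp [splitExponent]
  simp only [expWord, e0, e1, e2, map_smul, smul_smul, mul_smul_comm, smul_mul_assoc, mul_assoc]

theorem HasWeakIntegralOn.add {A : Type*} [Ring A] [Algebra ℂ A] [TopologicalSpace A] {Ω : Type*}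
    [MeasurableSpace Ω] {μ : MeasureTheory.Measure Ω} {Φ Ψ : Ω → A} {a b : A}
    (H : HasWeakIntegralOn μ Φ a) (H' : HasWeakIntegralOn μ Ψ b) :
    HasWeakIntegralOn μ (fun o => Φ o + Ψ o) (a + b) := fun l => by
  simp only [map_add]
  exact ⟨(H l).1.add (H' l).1,
    by rw [MeasureTheory.integral_add (H l).1 (H' l).1, (H l).2, (H' l).2]⟩

omit [StarRing A] [StarModule ℂ A] in
omit [IsUniformAddGroup A] [CompleteSpace A] in
/-- The Leibniz rule under the integral. -/
theorem IsSandwich.derivation_eq (hp : IsFrechetFamily p)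
    (hδ : ∀ a b : A, δ (a * b) = δ a * b + a * δ b) {g : 𝓢(EuclideanSpace ℝ (Fin 1), ℂ)}
    (hP : IsSandwich g w z h ρ P) {N M N' : A}
    (hN : HasWeakIntegralOn MeasureTheory.volume (fun ξ =>
        g ξ • (δ (NormedSpace.exp (w ξ • h)) * ρ * NormedSpace.exp (z ξ • h))) N)
    (hM : IsSandwich g w z h (δ ρ) M)
    (hN' : HasWeakIntegralOn MeasureTheory.volume (fun ξ =>
        g ξ • (NormedSpace.exp (w ξ • h) * ρ * δ (NormedSpace.exp (z ξ • h)))) N') :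
    δ P = N + M + N' := by
  refine (HasWeakIntegralOn.map hP δ).unique hp ?_
  convert (hN.add hM).add hN' using 2 with ξ
  rw [map_smul, hδ, hδ, add_mul, smul_add, smul_add]

end Leibniz

/-! ### Symbols of the terms of the gradient -/

section Symbols

variable {A : Type u} [Ring A] [StarRing A] [Algebra ℂ A] [StarModule ℂ A] [UniformSpace A]
  [IsUniformAddGroup A] [CompleteSpace A] [IsTopologicalRing A] {p : ℕ → Seminorm ℂ A}
  {z w : EuclideanSpace ℝ (Fin 1) → ℂ} {h ρ σ b b' : A} {g : 𝓢(EuclideanSpace ℝ (Fin 1), ℂ)}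
  {B : Type*} [CStarAlgebra B] {π : A →ₐ[ℂ] B}

omit [StarModule ℂ A] in
theorem IsSandwich.hasSymbol (hp : IsSmoothFamily p) (hπ : IsCStarRep p π) (hz : IsExponent z)
    (hw : IsExponent w) (hh : IsSelfAdjoint h) (hb : IsSandwich g z w h ρ b) (R : ℝ) :
    HasSymbol R (π h) (π ρ) 1
      (fun x => ∫ ξ, g ξ * Complex.exp (z ξ * x 0 + w ξ * x 1)) (π b) := by
  obtain ⟨M, hM⟩ := hz.re_le
  obtain ⟨M', hM'⟩ := hw.re_le
  have hfam : IsExpFamily MeasureTheory.volume g fun ξ => ![z ξ, w ξ, 0] := by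
    refine ⟨g.integrable, ?_, max (max M M') 0, fun ξ k => ?_⟩
    · have h1 := hz.continuous.measurable
      have h2 := hw.continuous.measurable
      refine measurable_pi_iff.2 fun k => ?_
      fin_cases k <;> simp <;> fun_prop
    · fin_cases k <;> simp [hM, hM']
  have h1 : HasWeakIntegralOn MeasureTheory.volume
      (fun ξ => g ξ • expWord h ![z ξ, w ξ, 0] ρ 1) b := by
    simpa [expWord, NormedSpace.exp_zero] using! hb
  have h2 := HasWeakIntegralOn.hasSymbol hp hπ hh hfam h1 R
  rw [map_one] at h2
  refine h2.congr fun x _ _ => ?_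
  simp [expSymbol, Fin.sum_univ_three]

omit [StarModule ℂ A] in
theorem IsDuhamelTranspose.hasSymbol (hp : IsSmoothFamily p) (hπ : IsCStarRep p π)
    (hh : IsSelfAdjoint h) (hb : IsDuhamelTranspose h b b') {R : ℝ} {ρ σ : B}
    {F : (Fin 3 → ℝ) → ℂ} (H : HasSymbol R (π h) ρ σ F (π b)) :
    HasSymbol R (π h) ρ σ (fun x => expDiff 2 0 x * F x) (π b') := by
  have hF := hp.toIsFrechetFamily
  have := hp.continuousSMul
  have := hp.continuous_exp
  convert H.conj (hπ.isSelfAdjoint hh) using 1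
  refine (hb.integral_eq (homCLM π hπ.continuous)
    ((isDominated_unitInterval hF (by fun_prop)).integrable hF _)).symm.trans ?_
  refine MeasureTheory.integral_congr_ae (Filter.Eventually.of_forall fun s => ?_)
  simp only [homCLM_apply, map_mul, hF.map_exp hπ.continuous, map_smul]

end Symbols

/-! ### The gradient identity -/

section Gradient

theorem exp_vec_one (s : ℝ) :
    (fun l => Real.exp ((![s] : Fin 1 → ℝ) l)) = ![Real.exp s] := by
  funext l; fin_cases l; rfl

theorem exp_vec_two (s t : ℝ) :
    (fun l => Real.exp ((![s, t] : Fin 2 → ℝ) l)) = ![Real.exp s, Real.exp t] := by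
  funext l; fin_cases l <;> rfl

/-- The two-variable symbol of `k^j f(𝐲)`, as a Laplace integral. -/
theorem IsFourierDensityOn.integral_exponents {j R : ℝ} {f : (Fin 1 → ℝ) → ℂ}
    {g : 𝓢(EuclideanSpace ℝ (Fin 1), ℂ)}
    (hg : IsFourierDensityOn (Set.Ioo (-(2 * R)) (2 * R)) (fun x => f fun l => Real.exp (x l)) g)
    {s t : ℝ} (hs : |s| < R) (ht : |t| < R) :
    ∫ ξ, g ξ * Complex.exp (((j : ℂ) + Complex.I * (ξ 0 : ℂ)) * s + -(Complex.I * (ξ 0 : ℂ)) * t) =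
      Complex.exp (j * s) * f ![Real.exp (t - s)] := by
  have h0 := abs_lt.1 hs
  have h1 := abs_lt.1 ht
  have h3 := hg ![t - s] (fun l => by
    fin_cases l; simp only [Set.mem_Ioo]; constructor <;> simp <;> linarith)
  dsimp only at h3
  rw [exp_vec_one] at h3
  rw [h3, ← MeasureTheory.integral_const_mul]
  refine MeasureTheory.integral_congr_ae (Filter.Eventually.of_forall fun ξ => ?_)
  dsimp only
  rw [mul_left_comm, ← Complex.exp_add]
  refine congrArg (fun t => g ξ * Complex.exp t) ?_
  simp
  ring

theorem IsExponent.splitSymbol_eq' {w z : EuclideanSpace ℝ (Fin 1) → ℂ} (hw : IsExponent w)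
    (hz : IsExponent z) (g : 𝓢(EuclideanSpace ℝ (Fin 1), ℂ)) (p q r : Fin 3) (x : Fin 3 → ℝ) :
    ((x p : ℂ) - x q) * splitSymbol g p q r w z x =
      (∫ ξ, g ξ * Complex.exp (w ξ * x p + z ξ * x r)) -
        ∫ ξ, g ξ * Complex.exp (w ξ * x q + z ξ * x r) := by
  have hi : ∀ s t : ℝ, MeasureTheory.Integrable fun ξ => g ξ * Complex.exp (w ξ * s + z ξ * t) := by
    intro s t
    obtain ⟨M, hM⟩ := hw.re_le
    obtain ⟨M', hM'⟩ := hz.re_le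
    have h1 := hw.continuous
    have h2 := hz.continuous
    refine g.integrable.mul_bdd (c := Real.exp (M * |s| + M' * |t|))
      (Continuous.aestronglyMeasurable (by fun_prop)) (Filter.Eventually.of_forall fun ξ => ?_)
    rw [Complex.norm_exp, Complex.add_re, Complex.re_mul_ofReal, Complex.re_mul_ofReal]
    refine Real.exp_le_exp.2 (add_le_add ?_ ?_)
    · exact (le_abs_self _).trans ((abs_mul _ _).trans_le
        (mul_le_mul_of_nonneg_right (hM ξ) (abs_nonneg _)))
    · exact (le_abs_self _).trans ((abs_mul _ _).trans_le
        (mul_le_mul_of_nonneg_right (hM' ξ) (abs_nonneg _)))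
  rw [hw.splitSymbol_eq hz, ← MeasureTheory.integral_sub (hi _ _) (hi _ _)]
  refine MeasureTheory.integral_congr_ae (Filter.Eventually.of_forall fun ξ => ?_)
  simp only [Complex.exp_add]
  ring

/-- The terms `T` of the Leibniz rule cancel two of the three divided differences of which the
symbol of `gradH` consists; the third one is the symbol of the variation of the exponentials. Here
`e` stands for `exp x`, and `r a b` for the value of the symbol of `k^j f(𝐲)` at `x a, x b`. -/
theorem gradient_symbol_identity {x₀ x₁ x₂ e₀ e₁ e₂ : ℂ} (h01 : x₀ ≠ x₁) (h12 : x₁ ≠ x₂)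
    (h20 : x₂ ≠ x₀) (k01 : e₀ ≠ e₁) (k12 : e₁ ≠ e₂) (k20 : e₂ ≠ e₀)
    {r01 r10 r12 r21 r20 r02 T₁ T₂ T₃ T₄ S₁ S₂ : ℂ}
    (hT₁ : (x₀ - x₁) * T₁ = r20 - r21) (hT₂ : (x₁ - x₂) * T₂ = r10 - r20)
    (hT₃ : (x₀ - x₁) * T₃ = r02 - r12) (hT₄ : (x₁ - x₂) * T₄ = r01 - r02)
    (hS₁ : (x₂ - x₀) * S₁ = r21 - r01) (hS₂ : (x₂ - x₀) * S₂ = r12 - r10) :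
    (e₂ - e₀) / (x₂ - x₀) * ((e₁ - e₂) / (x₁ - x₂) * ((e₀ - e₁) / (x₀ - x₁) *
        (-(((r02 + r20) - (r01 + r10)) / (e₂ - e₁)) - ((r21 + r12) - (r20 + r02)) / (e₁ - e₀) +
          ((r10 + r01) - (r12 + r21)) / (e₀ - e₂))) +
        (e₁ - e₂) / (x₁ - x₂) * T₁ + (e₀ - e₁) / (x₀ - x₁) * T₂ + (e₁ - e₂) / (x₁ - x₂) * T₃ +
        (e₀ - e₁) / (x₀ - x₁) * T₄) =
      (e₁ - e₂) / (x₁ - x₂) * ((e₀ - e₁) / (x₀ - x₁) * S₁) +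
        (e₁ - e₂) / (x₁ - x₂) * ((e₀ - e₁) / (x₀ - x₁) * S₂) := by
  have d01 := sub_ne_zero.2 h01
  have d12 := sub_ne_zero.2 h12
  have d20 := sub_ne_zero.2 h20
  have f01 := sub_ne_zero.2 k01
  have f12 := sub_ne_zero.2 k12
  have f20 := sub_ne_zero.2 k20
  have g01 : e₁ - e₀ = -(e₀ - e₁) := by ring
  have g12 : e₂ - e₁ = -(e₁ - e₂) := by ring
  have g20 : e₀ - e₂ = -(e₂ - e₀) := by ring
  rw [g01, g12, g20, eq_div_of_mul_eq d01 ((mul_comm _ _).trans hT₁),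
    eq_div_of_mul_eq d12 ((mul_comm _ _).trans hT₂),
    eq_div_of_mul_eq d01 ((mul_comm _ _).trans hT₃),
    eq_div_of_mul_eq d12 ((mul_comm _ _).trans hT₄),
    eq_div_of_mul_eq d20 ((mul_comm _ _).trans hS₁),
    eq_div_of_mul_eq d20 ((mul_comm _ _).trans hS₂)]
  generalize x₀ - x₁ = u at *
  generalize x₁ - x₂ = v at *
  generalize x₂ - x₀ = t at *
  generalize e₀ - e₁ = a at *
  generalize e₁ - e₂ = b at *
  generalize e₂ - e₀ = c at *
  field_simp
  ring

variable {A : Type u} [Ring A] [StarRing A] [Algebra ℂ A] [StarModule ℂ A] [UniformSpace A]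
  [IsUniformAddGroup A] [CompleteSpace A] [IsTopologicalRing A] {p : ℕ → Seminorm ℂ A}

/-- The transposed derivative of `exp` maps `grad + δ P₁ + δ P₂` to `Y₁ + Y₂`, in the notation of
`exists_variation`. Both sides are integrals of exponential words in `δ h, δ h`, once `δ k` is
expressed by `δ h`; their symbols are compared in `gradient_symbol_identity`. The terms with `δ² k`,
which are not of this form, cancel beforehand. -/
theorem transpose_gradFormula_eq (hp : IsSmoothFamily p) {δ : A →L[ℂ] A}
    (hδ : ∀ a b : A, δ (a * b) = δ a * b + a * δ b) {j : ℝ} {f : (Fin 1 → ℝ) → ℂ}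
    (hf : IsLogSmooth f) {h : A} (hh : IsSelfAdjoint h) {R : ℝ} (hR : p 0 h < R)
    {g : 𝓢(EuclideanSpace ℝ (Fin 1), ℂ)}
    (hg : IsFourierDensityOn (Set.Ioo (-(2 * R)) (2 * R)) (fun x => f fun l => Real.exp (x l)) g)
    {Y₁ Y₂ P₁ P₂ Q : A}
    (hY₁ : IsSplitIntegral g (fun ξ => j + Complex.I * (ξ 0 : ℂ))
      (fun ξ => -(Complex.I * (ξ 0 : ℂ))) h (δ (NormedSpace.exp h)) Y₁)
    (hY₂ : IsSplitIntegral g (fun ξ => -(Complex.I * (ξ 0 : ℂ)))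
      (fun ξ => j + Complex.I * (ξ 0 : ℂ)) h (δ (NormedSpace.exp h)) Y₂)
    (hP₁ : IsSandwich g (fun ξ => -(Complex.I * (ξ 0 : ℂ))) (fun ξ => j + Complex.I * (ξ 0 : ℂ)) h
      (δ (NormedSpace.exp h)) P₁)
    (hP₂ : IsSandwich g (fun ξ => j + Complex.I * (ξ 0 : ℂ)) (fun ξ => -(Complex.I * (ξ 0 : ℂ))) h
      (δ (NormedSpace.exp h)) P₂)
    (hQ : IsDuhamelTranspose h (gradFormula δ j f h + δ P₁ + δ P₂) Q) :
    Q = Y₁ + Y₂ := by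
  have hF := hp.toIsFrechetFamily
  have hz := isExponent_left j
  have hw := isExponent_right
  obtain ⟨B, _, π, hπ⟩ := hp.exists_rep
  have hπh := hπ.isSelfAdjoint hh
  have hlt : ‖π h‖ < R := by rwa [hπ.norm_eq]
  -- `δ k` in terms of `δ h`.
  have hκ := hF.map_derivation_exp hδ hπ.continuous h
  obtain ⟨N₁, hN₁, HN₁⟩ := hw.exists_derivation_left hz hp hπ hh hδ g (δ (NormedSpace.exp h)) R
  obtain ⟨N₂, hN₂, HN₂⟩ := hw.exists_derivation_right hz hp hπ hh hδ g (δ (NormedSpace.exp h)) R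
  obtain ⟨N₃, hN₃, HN₃⟩ := hz.exists_derivation_left hw hp hπ hh hδ g (δ (NormedSpace.exp h)) R
  obtain ⟨N₄, hN₄, HN₄⟩ := hz.exists_derivation_right hw hp hπ hh hδ g (δ (NormedSpace.exp h)) R
  obtain ⟨M₁, hM₁⟩ := hw.exists_isSandwich hz hp hh g (δ (δ (NormedSpace.exp h)))
  obtain ⟨M₂, hM₂⟩ := hz.exists_isSandwich hw hp hh g (δ (δ (NormedSpace.exp h)))
  have hI : Bornology.IsBounded (Set.Ioo (-(2 * R)) (2 * R)) := Metric.isBounded_Ioo _ _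
  obtain ⟨gK, hgK⟩ := exists_isFourierDensityOn (hf.gradK j) hI
  obtain ⟨gH, hgH⟩ := exists_isFourierDensityOn (hf.gradH j) hI
  obtain ⟨bK, hbK⟩ := hp.exists_hasWeakIntegral_flow hh ![δ (δ (NormedSpace.exp h))] gK
  obtain ⟨bH, hbH⟩ := hp.exists_hasWeakIntegral_flow hh
    ![δ (NormedSpace.exp h), δ (NormedSpace.exp h)] gH
  have hr : ∀ x : Fin 3 → ℝ, (∀ i, |x i| < R) → ∀ a b : Fin 3,
      ∫ ξ, g ξ * Complex.exp (((j : ℂ) + Complex.I * (ξ 0 : ℂ)) * x a +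
        -(Complex.I * (ξ 0 : ℂ)) * x b) = Complex.exp (j * x a) * f ![Real.exp (x b - x a)] :=
    fun x hx a b => hg.integral_exponents (hx a) (hx b)
  have hr' : ∀ x : Fin 3 → ℝ, (∀ i, |x i| < R) → ∀ a b : Fin 3,
      ∫ ξ, g ξ * Complex.exp (-(Complex.I * (ξ 0 : ℂ)) * x b +
        ((j : ℂ) + Complex.I * (ξ 0 : ℂ)) * x a) =
          Complex.exp (j * x a) * f ![Real.exp (x b - x a)] :=
    fun x hx a b => by simpa only [add_comm] using hr x hx a b
  -- The integrals with both derivations on the same factor make up the second order term.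
  have hKM : weylPow h j * bK + M₁ + M₂ = 0 := by
    have H1 := (hM₁.hasSymbol hp hπ hw hz hh R).add hπh (hM₂.hasSymbol hp hπ hz hw hh R)
    have H2 := ((hπ.hasSymbol_one hp hh hgK hbK).exp_mul (j : ℂ) hπh).neg
    refine hπ.injective hp ?_
    rw [map_zero, map_add, map_add, add_assoc, add_eq_zero_iff_neg_eq, weylPow, map_mul,
      hF.map_exp hπ.continuous, map_smul]
    refine (H1.unique hπh hlt H2 fun x hx _ => ?_).symm
    rw [hr' x hx 1 0, hr x hx 0 1, exp_vec_one, cexp_mul_gradK, pairSymbol]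
    ring
  have hG : gradFormula δ j f h + δ P₁ + δ P₂ =
      weylPow h (j - 1) * bH + N₁ + N₂ + N₃ + N₄ := by
    rw [gradFormula, hp.isDensityIndependent_one.modularCalculus_eq hp (hf.gradK j) hh hR hgK hbK,
      hp.isDensityIndependent_two.modularCalculus_eq hp (hf.gradH j) hh hR hgH hbH,
      hP₁.derivation_eq hF hδ hN₁ hM₁ hN₂, hP₂.derivation_eq hF hδ hN₃ hM₂ hN₄, ← sub_eq_zero,
      ← hKM]
    abel
  have hk : NormedSpace.exp (((j - 1 : ℝ) : ℂ) • π h) = π (weylPow h (j - 1)) := by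
    rw [weylPow, hF.map_exp hπ.continuous, map_smul]
  -- The words in `δ k` become words in `δ h` on substitution of `hκ`.
  have HH := (((hπ.hasSymbol_two hp hh hgH hbH).exp_mul ((j - 1 : ℝ) : ℂ) hπh).subst_left hπh
    hκ).subst_right hπh hκ
  rw [hk, ← map_mul] at HH
  have HG := (((HH.add hπh (HN₁.subst_right hπh hκ)).add hπh (HN₂.subst_left hπh hκ)).add hπh
    (HN₃.subst_right hπh hκ)).add hπh (HN₄.subst_left hπh hκ)
  simp only [← map_add] at HG
  rw [hG] at hQ
  have HQ := hQ.hasSymbol hp hπ hh HG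
  have HY := (((HasWeakIntegralOn.hasSymbol hp hπ hh (hz.isExpFamily_split hw g 2 0 1) hY₁
    R).subst_left hπh hκ).subst_right hπh hκ).add hπh
    (((HasWeakIntegralOn.hasSymbol hp hπ hh (hw.isExpFamily_split hz g 2 0 1) hY₂
    R).subst_left hπh hκ).subst_right hπh hκ)
  rw [← map_add] at HY
  refine hπ.injective hp (HQ.unique hπh hlt HY fun x hx hinj => ?_)
  have hne : ∀ a b : Fin 3, a ≠ b → x a ≠ x b := fun a b hab => hinj.ne hab
  have hneC : ∀ a b : Fin 3, a ≠ b → (x a : ℂ) ≠ x b := fun a b hab h =>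
    hne a b hab (Complex.ofReal_injective h)
  have hexp : ∀ a b : Fin 3, a ≠ b → Complex.exp (x a) ≠ Complex.exp (x b) := fun a b hab h =>
    hne a b hab (Real.exp_injective (Complex.ofReal_injective (by simpa using h)))
  -- All symbols are divided differences of values `e^{j x_a} f(e^{x_b - x_a})`.
  have hwz : ∀ a b c : Fin 3, ((x a : ℂ) - x b) * splitSymbol g a b c
      (fun ξ => -(Complex.I * (ξ 0 : ℂ))) (fun ξ => j + Complex.I * (ξ 0 : ℂ)) x =
      Complex.exp (j * x c) * f ![Real.exp (x a - x c)] -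
        Complex.exp (j * x c) * f ![Real.exp (x b - x c)] := fun a b c => by
    rw [hw.splitSymbol_eq' hz, hr' x hx, hr' x hx]
  have hzw : ∀ a b c : Fin 3, ((x a : ℂ) - x b) * splitSymbol g a b c
      (fun ξ => j + Complex.I * (ξ 0 : ℂ)) (fun ξ => -(Complex.I * (ξ 0 : ℂ))) x =
      Complex.exp (j * x a) * f ![Real.exp (x c - x a)] -
        Complex.exp (j * x b) * f ![Real.exp (x c - x b)] := fun a b c => by
    rw [hz.splitSymbol_eq' hw, hr x hx, hr x hx]
  have key := gradient_symbol_identity (hneC 0 1 (by decide)) (hneC 1 2 (by decide))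
    (hneC 2 0 (by decide)) (hexp 0 1 (by decide)) (hexp 1 2 (by decide)) (hexp 2 0 (by decide))
    (hwz 0 1 2) (hzw 1 2 0) (hzw 0 1 2) (hwz 1 2 0) (hzw 2 0 1) (hwz 2 0 1)
  refine Eq.trans ?_ key
  rw [exp_vec_two, cexp_mul_gradH j f (hne 0 1 (by decide)) (hne 1 2 (by decide))
    (hne 2 0 (by decide))]
  rfl

end Gradient

/-! ### Existence and uniqueness of the gradient -/

section Uniqueness

/-- The transposed derivative `b ↦ ∫₀¹ exp ((1 - s) h) b exp (s h) ds` of `exp` at a self-adjoint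
element is injective: if it kills `b` then `b` commutes with `exp h`, hence with `h`, and is mapped
to `exp h * b`. -/
theorem eq_zero_of_integral_transpose_eq_zero {B : Type*} [CStarAlgebra B] {h b : B}
    (hh : IsSelfAdjoint h) (H : ∫ s : unitInterval, NormedSpace.exp ((1 - ((s : ℝ) : ℂ)) • h) * b *
        NormedSpace.exp (((s : ℝ) : ℂ) • h) = 0) : b = 0 := by
  have hexp := continuous_normedSpace_exp (E := B)
  have hint : ∀ c : B, MeasureTheory.Integrable fun s : unitInterval =>
      NormedSpace.exp ((1 - ((s : ℝ) : ℂ)) • h) * c * NormedSpace.exp (((s : ℝ) : ℂ) • h) :=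
    fun c => Continuous.integrable_of_hasCompactSupport (by fun_prop)
      (HasCompactSupport.of_compactSpace _)
  have hcomm : ∀ z : ℂ, Commute h (NormedSpace.exp (z • h)) := fun z =>
    ((Commute.refl h).smul_right z).exp_right
  have hneg : ∀ z : ℂ, NormedSpace.exp h * NormedSpace.exp (z • -h) =
      NormedSpace.exp ((1 - z) • h) := fun z => by
    rw [smul_neg, ← neg_smul, sub_eq_add_neg, exp_add_smul, one_smul]
  have hneg' : ∀ z : ℂ, NormedSpace.exp ((1 - z) • -h) * NormedSpace.exp h =
      NormedSpace.exp (z • h) := fun z => by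
    rw [smul_neg, ← neg_smul, show z = -(1 - z) + 1 by ring, exp_add_smul, one_smul]
    ring_nf
  have h1 : ∫ s : unitInterval, NormedSpace.exp ((1 - ((s : ℝ) : ℂ)) • h) * (b * h - h * b) *
      NormedSpace.exp (((s : ℝ) : ℂ) • h) = 0 := by
    have e : ∀ s : unitInterval, NormedSpace.exp ((1 - ((s : ℝ) : ℂ)) • h) * (b * h - h * b) *
        NormedSpace.exp (((s : ℝ) : ℂ) • h) =
        NormedSpace.exp ((1 - ((s : ℝ) : ℂ)) • h) * b * NormedSpace.exp (((s : ℝ) : ℂ) • h) * h -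
        h * (NormedSpace.exp ((1 - ((s : ℝ) : ℂ)) • h) * b *
          NormedSpace.exp (((s : ℝ) : ℂ) • h)) := fun s => by
      rw [mul_assoc _ _ h, ← (hcomm _).eq, mul_assoc (NormedSpace.exp _) b (NormedSpace.exp _),
        ← mul_assoc h (NormedSpace.exp _), (hcomm (1 - ((s : ℝ) : ℂ))).eq]
      noncomm_ring
    simp only [e]
    rw [MeasureTheory.integral_sub ((hint b).mul_const h) ((hint b).const_mul h),
      integral_mul_const_of_integrable (hint b), integral_const_mul_of_integrable (hint b), H,
      zero_mul, mul_zero, sub_zero]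
  have h2 := integral_exp_mul_exp (-h) (-h) b
  have h3 : NormedSpace.exp h * (NormedSpace.exp (-h) * b - b * NormedSpace.exp (-h)) *
      NormedSpace.exp h = 0 := by
    rw [← h2, ← h1]
    have hi : MeasureTheory.Integrable fun s : unitInterval =>
        NormedSpace.exp (((s : ℝ) : ℂ) • -h) * (-h * b - b * -h) *
          NormedSpace.exp ((1 - ((s : ℝ) : ℂ)) • -h) :=
      Continuous.integrable_of_hasCompactSupport (by fun_prop)
        (HasCompactSupport.of_compactSpace _)
    rw [← integral_const_mul_of_integrable hi,
      ← integral_mul_const_of_integrable (hi.const_mul _)]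
    refine MeasureTheory.integral_congr_ae (Filter.Eventually.of_forall fun s => ?_)
    dsimp only
    rw [← hneg, ← hneg']
    noncomm_ring
  have hk1 : NormedSpace.exp h * NormedSpace.exp (-h) = 1 := by
    have := hneg 1
    rwa [one_smul, sub_self, zero_smul, NormedSpace.exp_zero] at this
  have hk2 : NormedSpace.exp (-h) * NormedSpace.exp h = 1 := by
    have := hneg' 0
    rwa [sub_zero, one_smul, zero_smul, NormedSpace.exp_zero] at this
  -- Duhamel's formula for `-h` turns the vanishing integral of `[b, h]` into `[exp h, b] = 0`.
  have h4 : Commute (NormedSpace.exp h) b := by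
    have e : NormedSpace.exp h * (NormedSpace.exp (-h) * b - b * NormedSpace.exp (-h)) *
        NormedSpace.exp h = (NormedSpace.exp h * NormedSpace.exp (-h)) * b * NormedSpace.exp h -
        NormedSpace.exp h * b * (NormedSpace.exp (-h) * NormedSpace.exp h) := by noncomm_ring
    rw [e, hk1, hk2, one_mul, mul_one, sub_eq_zero] at h3
    exact h3.symm
  -- `h` is the logarithm of `exp h`.
  have h5 : Commute h b := by
    have hk : IsSelfAdjoint (NormedSpace.exp h) := hh.exp
    rw [← CFC.log_exp h hh]
    exact h4.cfc (by rwa [hk.star_eq]) _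
  have h6 : ∀ s : unitInterval, NormedSpace.exp ((1 - ((s : ℝ) : ℂ)) • h) * b *
      NormedSpace.exp (((s : ℝ) : ℂ) • h) = NormedSpace.exp h * b := fun s => by
    rw [mul_assoc, ← ((h5.smul_left ((s : ℝ) : ℂ)).exp_left).eq, ← mul_assoc, ← exp_add_smul,
      sub_add_cancel, one_smul]
  simp only [h6] at H
  have h7 : NormedSpace.exp h * b = 0 := by simpa using H
  rw [← one_mul b, ← hk2, mul_assoc, h7, mul_zero]

end Uniqueness

section Gradient

variable {A : Type u} [Ring A] [StarRing A] [Algebra ℂ A] [StarModule ℂ A] [UniformSpace A]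
  [IsUniformAddGroup A] [CompleteSpace A] [IsTopologicalRing A] {p : ℕ → Seminorm ℂ A}
  {φ : A →L[ℂ] ℂ} {δ : A →L[ℂ] A} {j : ℝ} {f : (Fin 1 → ℝ) → ℂ} {h a : A}

/-- The gradient property, by partial integration of `φ (δ v P)`, the trace property and
`transpose_gradFormula_eq`. -/
theorem exists_hasDerivAt_gradFormula (hp : IsSmoothFamily p)
    (hφ : ∀ a b : A, φ (a * b) = φ (b * a)) (hδ : ∀ a b : A, δ (a * b) = δ a * b + a * δ b)
    (hφδ : ∀ a : A, φ (δ a) = 0) (j : ℝ) (hf : IsLogSmooth f) (hh : IsSelfAdjoint h)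
    (ha : IsSelfAdjoint a) : ∃ v, IsWeylVariation h a v ∧ IsDuhamelIntegral h a v ∧
      HasDerivAt (fun ε : ℝ => weylFunctional φ δ j f (h + (ε : ℂ) • a))
        (φ (v * gradFormula δ j f h)) 0 := by
  have hz := isExponent_left j
  have hw := isExponent_right
  have hR : p 0 h + p 0 a < p 0 h + p 0 a + 1 := lt_add_one _
  have hR' : p 0 h < p 0 h + p 0 a + 1 := (le_add_of_nonneg_right (apply_nonneg _ _)).trans_lt hR
  obtain ⟨g, hg⟩ := exists_isFourierDensityOn hf
    (Metric.isBounded_Ioo (-(2 * (p 0 h + p 0 a + 1))) (2 * (p 0 h + p 0 a + 1)))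
  obtain ⟨Y₁, hY₁⟩ := hz.exists_splitIntegral hw hp hh g (δ (NormedSpace.exp h))
    (δ (NormedSpace.exp h))
  obtain ⟨Y₂, hY₂⟩ := hw.exists_splitIntegral hz hp hh g (δ (NormedSpace.exp h))
    (δ (NormedSpace.exp h))
  obtain ⟨P₁, hP₁⟩ := hw.exists_isSandwich hz hp hh g (δ (NormedSpace.exp h))
  obtain ⟨P₂, hP₂⟩ := hz.exists_isSandwich hw hp hh g (δ (NormedSpace.exp h))
  obtain ⟨Q, hQ⟩ := hp.exists_isDuhamelTranspose h (gradFormula δ j f h + δ P₁ + δ P₂)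
  have hQY := transpose_gradFormula_eq hp hδ hf hh hR' hg hY₁ hY₂ hP₁ hP₂ hQ
  obtain ⟨v, hv, hv', hF⟩ := exists_variation hp hφ δ j hf hh ha hR hg hY₁ hY₂ hP₁ hP₂
  refine ⟨v, hv, hv', ?_⟩
  -- Partial integration: `φ (δ (v P)) = 0`.
  have hpart : ∀ P : A, φ (δ v * P) = -φ (v * δ P) := fun P => by
    have := hφδ (v * P)
    rw [hδ, map_add] at this
    exact eq_neg_of_add_eq_zero_left this
  have htr := hv'.trace_mul hφ hQ
  rw [hQY, mul_add, mul_add, mul_add, map_add, map_add, map_add] at htr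
  rw [hpart, hpart] at hF
  refine hF.congr_deriv ?_
  rw [← htr]
  ring

/-- An element `D` with `φ (δ_a(k) D) = 0` for all self-adjoint `a` vanishes: the transposed
derivative of `exp` maps it to an element annihilated by `φ`, hence to `0`, and is injective. -/
theorem eq_zero_of_trace_duhamel (hp : IsSmoothFamily p)
    (hφ : ∀ a b : A, φ (a * b) = φ (b * a)) (hnd : ∀ b : A, (∀ a : A, φ (a * b) = 0) → b = 0)
    (hh : IsSelfAdjoint h) {D : A}
    (hD : ∀ a, IsSelfAdjoint a → ∃ v, IsDuhamelIntegral h a v ∧ φ (v * D) = 0) : D = 0 := by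
  have hF := hp.toIsFrechetFamily
  have := hp.continuousSMul
  have := hp.continuous_exp
  obtain ⟨Q, hQ⟩ := hp.exists_isDuhamelTranspose h D
  have hsa : ∀ a, IsSelfAdjoint a → φ (a * Q) = 0 := fun a ha => by
    obtain ⟨v, hv, hv0⟩ := hD a ha
    rw [← hv.trace_mul hφ hQ, hv0]
  have hQ0 : Q = 0 := hnd Q fun a => by
    rw [← realPart_add_I_smul_imaginaryPart a, add_mul, map_add, smul_mul_assoc, map_smul,
      hsa _ (realPart a).2, hsa _ (imaginaryPart a).2, smul_zero, add_zero]
  obtain ⟨B, _, π, hπ⟩ := hp.exists_rep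
  refine hπ.injective hp ?_
  rw [map_zero]
  refine eq_zero_of_integral_transpose_eq_zero (hπ.isSelfAdjoint hh) ?_
  have h1 := hQ.integral_eq (homCLM π hπ.continuous)
    ((isDominated_unitInterval hF (by fun_prop)).integrable hF _)
  simpa only [hQ0, map_zero, homCLM_apply, map_mul, hF.map_exp hπ.continuous, map_smul] using h1

/-- Two gradients of the functional agree, if the trace is nondegenerate. -/
theorem isGradient_unique (hp : IsSmoothFamily p) (hφ : ∀ a b : A, φ (a * b) = φ (b * a))
    (hnd : ∀ b : A, (∀ a : A, φ (a * b) = 0) → b = 0) {F : A → ℂ} {G G' : A}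
    (hh : IsSelfAdjoint h) (hG : IsGradient φ F h G)
    (hG' : ∀ a, IsSelfAdjoint a → ∃ v, IsWeylVariation h a v ∧ IsDuhamelIntegral h a v ∧
      HasDerivAt (fun ε : ℝ => F (h + (ε : ℂ) • a)) (φ (v * G')) 0) : G = G' := by
  have := hp.t2Space
  refine sub_eq_zero.1 (eq_zero_of_trace_duhamel hp hφ hnd hh fun a ha => ?_)
  obtain ⟨v, hv, hF⟩ := hG a ha
  obtain ⟨v', hv', hd, hF'⟩ := hG' a ha
  obtain rfl : v = v' := tendsto_nhds_unique hv hv'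
  exact ⟨v, hd, by rw [mul_sub, map_sub, hF.unique hF', sub_self]⟩

end Gradient

end ModularVariation

end

theorem mainTheorem3 {A : Type*} [Ring A] [StarRing A] [Algebra ℂ A] [StarModule ℂ A]
    [UniformSpace A] [IsUniformAddGroup A] [CompleteSpace A] [IsTopologicalRing A]
    [ContinuousStar A] [ModularVariation.SmoothFrechetStarAlgebra A]
    (φ₀ : A →L[ℂ] ℂ) (hφ₀ : ∀ a b : A, φ₀ (a * b) = φ₀ (b * a))
    (δ : A →L[ℂ] A) (hδ : ∀ a b : A, δ (a * b) = δ a * b + a * δ b)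
    (hφδ : ∀ a : A, φ₀ (δ a) = 0)
    (j : ℝ) (f : (Fin 1 → ℝ) → ℂ) (hf : ContDiffOn ℝ ∞ f {y | ∀ l, 0 < y l})
    (h : A) (hh : IsSelfAdjoint h) :
    ModularVariation.IsSpectralFunction A f ∧
    ModularVariation.IsSpectralFunction A (ModularVariation.gradK j f) ∧
    ModularVariation.IsSpectralFunction A (ModularVariation.gradH j f) ∧
    ModularVariation.IsGradient φ₀ (ModularVariation.weylFunctional φ₀ δ j f) h
      (ModularVariation.gradFormula δ j f h) ∧
    ((∀ b : A, (∀ a : A, φ₀ (a * b) = 0) → b = 0) →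
      ∀ G : A, ModularVariation.IsGradient φ₀ (ModularVariation.weylFunctional φ₀ δ j f) h G →
        G = ModularVariation.gradFormula δ j f h) := by
  obtain ⟨p, hp1, hp2, hp3, hp4, hp5, hp6⟩ :=
    ModularVariation.SmoothFrechetStarAlgebra.exists_seminorms (A := A)
  have hp : ModularVariation.IsSmoothFamily p := ⟨⟨hp1, hp2, hp3, hp5⟩, hp4, hp6⟩
  have hls := ModularVariation.isLogSmooth_of_contDiffOn hf
  have hgrad := fun a ha => ModularVariation.exists_hasDerivAt_gradFormula hp hφ₀ hδ hφδ j hls hh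
    (a := a) ha
  refine ⟨hp.isDensityIndependent_one.isSpectralFunction hp hls,
    hp.isDensityIndependent_one.isSpectralFunction hp (hls.gradK j),
    hp.isDensityIndependent_two.isSpectralFunction hp (hls.gradH j), fun a ha => ?_,
    fun hnd G hG => ModularVariation.isGradient_unique hp hφ₀ hnd hh hG hgrad⟩
  obtain ⟨v, hv, -, hF⟩ := hgrad a ha
  exact ⟨v, hv, hF⟩
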